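/- **Theorem 1.** *Model.* Let $n=mg$ samples be split into $m$ groups $\mathcal N_1,\dots,\mathcal N_m$ of $g\ge 1$ samples each. For $i\in\mathcal N_j$ the feature is $\mathbf x_i=\bar{\mathbf x}_j+\mathbf d_i\in\mathbb R^d$, $d\ge 2$, with group center $\bar{\mathbf x}_j\sim\mathcal N(0,\sigma_1^2 I_d)$ and within-group deviation $\mathbf d_i\sim\mathcal N(0,\sigma_2^2 I_d)$. For each group let $\mathbf X_{\mathcal N_j}\in\mathbb R^{g\times d}$ have rows $\mathbf x_i^\top$, $i\in\mathcal N_j$; the responses are $\mathbf Z_{\mathcal N_j}=\Pi^j(\mathbf X_{\mathcal N_j}\mathbf B^\star+\mathbf E^j)\in\mathbb R^{g\times l}$, with rows $\mathbf z_i^\top$, where $\mathbf B^\star\in\mathbb R^{d\times l}$, $\|\mathbf B^\star\|=1$, the rows of $\mathbf E^j$ are $\mathcal N(0,\sigma_e^2 I_l)$, and $\Pi^j$ is an arbitrary (possibly random) unknown $g\times g$ permutation matrix. All centers, deviations and noise rows are independent; $\sigma_1,\sigma_2,\sigma_e\ge0$ and $\sigma_x:=\sqrt{\sigma_1^2+\sigma_2^2}>0$;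 $\|\cdot\|$ is the spectral norm of a matrix and the Euclidean norm of a vector. *Estimators.* Let $\mathrm{LR}(\{(\mathbf x_i,\mathbf z_i)\}_i)=(\sum_i\mathbf x_i\mathbf x_i^\top)^{-1}\sum_i\mathbf x_i\mathbf z_i^\top$. The estimator without label assignment, $\hat{\mathbf B}_{\mathrm{NoAS}}$, is $\mathrm{LR}$ applied to the $m$ pairs of group sums $\big(\sum_{i\in\mathcal N_j}\mathbf x_i,\ \sum_{i\in\mathcal N_j}\mathbf z_i\big)$. The estimator with label assignment, $\hat{\mathbf B}_{\mathrm{AS}}$, is $\mathrm{LR}$ applied to the $n$ pairs $(\mathbf x_{i'},\mathbf z_i)$, where for $i\in\mathcal N_j$ the index $i'$ is any minimizer of $\|\mathbf z_i-\hat{\mathbf B}_{\mathrm{NoAS}}^\top\mathbf x_k\|$ over $k\in\mathcal N_j$. Put $\mathcal R_1=\|\hat{\mathbf B}_{\mathrm{NoAS}}-\mathbf B^\star\|$ and $\mathcal R_2=\|\hat{\mathbf B}_{\mathrm{AS}}-\mathbf B^\star\|$. *Claim.* For every $l$ there is a constant $C>0$, and for every $c_1>0$ a constant $c_0>0$ (depending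 only on $l$ and $c_1$), such that for all $m,g,d,\sigma_1,\sigma_2,\sigma_e,\mathbf B^\star$ as above and all real $p\ge1$: if $$n\ \ge\ c_0\,p\,g\,d\,\log^2 d\qquad\text{and}\qquad n\ \ge\ c_0\,p\,g\,d\,\log n ,$$ then with probability at least $1-n^{-c_1}$ the matrices inverted in both estimators are invertible and $$\mathcal R_1\le C\,\sqrt{\frac{1}{p(g\sigma_1^2+\sigma_2^2)}}\;\sigma_e,\qquad \mathcal R_2\le C\,\sqrt{\frac1{p\,g\,\sigma_x^2}}\;\sigma_e+C\,\sqrt{\frac{\sigma_e^2}{\sigma_x^2}+\mathcal R_1^2}\,\sqrt{\frac{\sigma_e^2}{\sigma_x^2}+1}.$$ (The second sample-size condition follows from the first, up to the value of $c_0$, whenever $n$ is at most polynomial in $d$.) -/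

import Mathlib

open MeasureTheory ProbabilityTheory
open scoped Matrix NNReal Matrix.Norms.L2Operator

noncomputable section

/-- Least-squares regression on the pairs `(x i, z i)`:
`LR = (∑ i, x i (x i)ᵀ)⁻¹ ∑ i, x i (z i)ᵀ`. -/
def LR {ι : Type*} [Fintype ι] {d l : ℕ} (x : ι → Fin d → ℝ) (z : ι → Fin l → ℝ) :
    Matrix (Fin d) (Fin l) ℝ :=
  (∑ i, Matrix.vecMulVec (x i) (x i))⁻¹ * ∑ i, Matrix.vecMulVec (x i) (z i)

/-- The least-squares problem with features `x` has a unique solution: its Gram matrix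
`∑ i, x i (x i)ᵀ` is invertible. -/
def LRWellPosed {ι : Type*} [Fintype ι] {d : ℕ} (x : ι → Fin d → ℝ) : Prop :=
  IsUnit (∑ i, Matrix.vecMulVec (x i) (x i))

/-- Features: row `i` of group `j` is (center of group `j`) + (deviation of sample `i`). -/
def features {m g d : ℕ} (center : Fin m → Fin d → ℝ) (dev : Fin m → Fin g → Fin d → ℝ)
    (j : Fin m) : Matrix (Fin g) (Fin d) ℝ :=
  Matrix.of fun i a => center j a + dev j i a

/-- Responses: `Z j = Π j (X j B + E j)` with `Π j` the permutation matrix of `perm j`. -/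
def responses {m g d l : ℕ} (perm : Fin m → Equiv.Perm (Fin g))
    (X : Fin m → Matrix (Fin g) (Fin d) ℝ) (B : Matrix (Fin d) (Fin l) ℝ)
    (E : Fin m → Matrix (Fin g) (Fin l) ℝ) (j : Fin m) : Matrix (Fin g) (Fin l) ℝ :=
  (perm j).permMatrix ℝ * (X j * B + E j)

/-- The group sums `1ᵀ A j` of the rows of `A j`. -/
def groupSums {m g k : ℕ} (A : Fin m → Matrix (Fin g) (Fin k) ℝ) (j : Fin m) : Fin k → ℝ :=
  (1 : Fin g → ℝ) ᵥ* A j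

/-- The estimator without label assignment: regression of the group sums of the responses on
the group sums of the features. -/
def estNoAS {m g d l : ℕ} (X : Fin m → Matrix (Fin g) (Fin d) ℝ)
    (Z : Fin m → Matrix (Fin g) (Fin l) ℝ) : Matrix (Fin d) (Fin l) ℝ :=
  LR (groupSums X) (groupSums Z)

/-- `a j i` is a feature index `k` in group `j` that minimizes the Euclidean residual
`‖z_i - Bᵀ x_k‖` (any choice if there are ties). -/
def IsAssignment {m g d l : ℕ} (X : Fin m → Matrix (Fin g) (Fin d) ℝ)
    (Z : Fin m → Matrix (Fin g) (Fin l) ℝ) (B : Matrix (Fin d) (Fin l) ℝ)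
    (a : Fin m → Fin g → Fin g) : Prop :=
  ∀ j i k, ‖WithLp.toLp 2 (Z j i - Bᵀ *ᵥ X j (a j i))‖ ≤ ‖WithLp.toLp 2 (Z j i - Bᵀ *ᵥ X j k)‖

/-- The features selected by the assignment `a`, one for each response. -/
def assigned {m g d : ℕ} (X : Fin m → Matrix (Fin g) (Fin d) ℝ) (a : Fin m → Fin g → Fin g)
    (q : Fin m × Fin g) : Fin d → ℝ :=
  X q.1 (a q.1 q.2)

/-- The estimator with label assignment: regression of every response on its assigned feature. -/
def estAS {m g d l : ℕ} (X : Fin m → Matrix (Fin g) (Fin d) ℝ)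
    (Z : Fin m → Matrix (Fin g) (Fin l) ℝ) (a : Fin m → Fin g → Fin g) :
    Matrix (Fin d) (Fin l) ℝ :=
  LR (assigned X a) (fun q : Fin m × Fin g => Z q.1 q.2)

/-- The group centers are `N(0, σ₁² I_d)`, the deviations `N(0, σ₂² I_d)`, the rows of the noise
`N(0, σₑ² I_l)`, all of them independent: equivalently, all the coordinates are independent
centered real Gaussians with variances `σ₁²`, `σ₂²`, `σₑ²`. -/
structure IsGroupedGaussian {Ω : Type*} [MeasurableSpace Ω] (μ : Measure Ω) {m g d l : ℕ}
    (σ₁ σ₂ σₑ : ℝ≥0) (center : Ω → Fin m → Fin d → ℝ) (dev : Ω → Fin m → Fin g → Fin d → ℝ)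
    (noise : Ω → Fin m → Matrix (Fin g) (Fin l) ℝ) : Prop where
  center_law : ∀ j a, HasLaw (fun ω => center ω j a) (gaussianReal 0 (σ₁ ^ 2)) μ
  dev_law : ∀ j i a, HasLaw (fun ω => dev ω j i a) (gaussianReal 0 (σ₂ ^ 2)) μ
  noise_law : ∀ j i b, HasLaw (fun ω => noise ω j i b) (gaussianReal 0 (σₑ ^ 2)) μ
  indep : iIndepFun
    (Sum.elim (fun (q : Fin m × Fin d) ω => center ω q.1 q.2)
      (Sum.elim (fun (q : Fin m × Fin g × Fin d) ω => dev ω q.1 q.2.1 q.2.2)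
        (fun (q : Fin m × Fin g × Fin l) ω => noise ω q.1 q.2.1 q.2.2))) μ

end

open scoped ENNReal RealInnerProductSpace

/-! ### Product measures -/

section Product

variable {ι : Type*} [Fintype ι] {α : ι → Type*} [∀ i, MeasurableSpace (α i)]
  (μ : ∀ i, Measure (α i)) [∀ i, IsProbabilityMeasure (μ i)]

/-! Decompose each group into its mean and the deviations from the mean. For Gaussian samples the
two are independent; the coordinates of the mean feature have variance `τ² = σ₁² + σ₂²/g` and those
of the mean noise `τ'² = σₑ²/g` (`map_group_eq`, `sampleLaw_map_groupData`). Group sums do not see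
the permutation and depend on the means only. So the first fit `A` is a function of the means, and
conditionally on them it is a fixed map, independent of all the deviations.

First estimator. As `m` is large compared with `d log n`, a net argument bounds the Gram matrix of
the standardized means below by a multiple of `m`, while the cross terms between mean features and
mean noises are subgaussian. Hence `‖A - B‖²` is at most a multiple of `(d log n / m) σₑ² / (g τ²)`,
and `g τ² = g σ₁² + σ₂²` (`GoodMeans.sq_norm_sub_le`).

Second estimator. Its normal equations are compared with `A` instead of `B`: the squared distance to
`A` is at most the sum of the `‖z_i - A x_{i'}‖²` divided by the least eigenvalue of the Gram matrix
of the assigned features (`sq_opNorm_sub_le`). Since `i'` minimizes the residual, the sum is at most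
the one for the true partners, which is of order `n (σₑ² + σₓ² ‖A - B‖²)` (`sum_sq_residual_le`,
`sum_sq_error_le`). If the least eigenvalue is at least of order `n σₓ²`, the triangle inequality
gives slightly more than the claim.

The difficulty is this eigenvalue, because the assigned features are selected by the data. It
suffices that, for each `u` in a net, a fixed proportion of the responses have all their nearest
neighbours at `|⟪u, x⟫|` of order `σₓ`. Quantifying over all nearest neighbours disposes of ties,
and makes the permutation a mere relabelling. In groups of bounded size one asks this of every
member and uses a union bound (`sampleLaw_not_farData_le_of_small`). In large groups a symmetry
argument works, with `A` frozen. Take the singular directions of `A`, completed by the component of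
`u` in its kernel. If the target `ζ` has coordinates of the same signs as `u`, then `{x | ‖ζ - A x‖
< r}` is stable under reflecting a coordinate of the wrong sign and under pushing a short coordinate
outwards. Gaussian measure is invariant under the former and quasi-invariant under the latter, so
wherever the other points lie, the event that a given point is the nearest has a fixed share of its
mass where `⟪u, x⟫` is bounded below (`stdGaussian_le_mul_far`, `one_le_mul_pi_nearest`). The share
depends on `l` only, as there are `l + 1` directions. The signs of the target are right with
positive probability, and the discrepancy between the true response and this model is a bounded
shift of one noise vector, absorbed by a Cameron-Martin comparison (`residual_decomposition`,
`ofReal_assignProb_le`).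

Chernoff bounds over the `m` groups beat the `exp (O(d log n))` points of the net because `m` is at
least a large multiple of `d log n`. -/

theorem measurePreserving_pi_update [DecidableEq ι] (i : ι) :
    MeasurePreserving (fun p : (∀ i, α i) × α i => Function.update p.1 i p.2)
      ((Measure.pi μ).prod (μ i)) (Measure.pi μ) := by
  have hm : Measurable (fun p : (∀ i, α i) × α i => Function.update p.1 i p.2) := by
    refine measurable_pi_iff.2 fun j => ?_
    by_cases h : j = i
    · subst h; simpa using measurable_snd
    · simp only [Function.update_of_ne h]
      exact (measurable_pi_apply j).comp measurable_fst
  refine ⟨hm, ?_⟩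
  symm
  refine Measure.pi_eq fun s hs => ?_
  rw [Measure.map_apply hm (MeasurableSet.univ_pi hs)]
  have : (fun p : (∀ i, α i) × α i => Function.update p.1 i p.2) ⁻¹' (Set.univ.pi s) =
      (Set.univ.pi (Function.update s i Set.univ)) ×ˢ s i := by
    ext p
    simp only [Set.mem_preimage, Set.mem_univ_pi, Set.mem_prod]
    constructor
    · intro h
      refine ⟨fun j => ?_, by simpa using h i⟩
      by_cases hj : j = i
      · subst hj; simp
      · simpa [Function.update_of_ne hj] using h j
    · rintro ⟨h, h'⟩ j
      by_cases hj : j = i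
      · subst hj; simpa using h'
      · simpa [Function.update_of_ne hj] using h j
  rw [this, Measure.prod_prod, Measure.pi_pi]
  rw [← Finset.prod_erase_mul _ _ (Finset.mem_univ i),
    ← Finset.prod_erase_mul (a := i) _ (fun j => μ j (s j)) (Finset.mem_univ i)]
  simp only [Function.update_self, measure_univ, mul_one]
  congr 1
  refine Finset.prod_congr rfl fun j hj => ?_
  rw [Function.update_of_ne (Finset.ne_of_mem_erase hj)]

/-- Conditioning on all the coordinates but one: an inequality for a single Gaussian point, uniform
in the positions of the others, integrates to one for the whole family. -/
theorem pi_apply_eq_lintegral_update [DecidableEq ι] (i : ι) {A : Set (∀ i, α i)}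
    (hA : MeasurableSet A) :
    Measure.pi μ A = ∫⁻ x, μ i {y | Function.update x i y ∈ A} ∂(Measure.pi μ) := by
  have h := measurePreserving_pi_update μ i
  rw [← h.measure_preimage hA.nullMeasurableSet, Measure.prod_apply (h.measurable hA)]
  rfl

/-- The exponential moment of a sum of independent functions. -/
theorem lintegral_exp_sum_pi_le (f : ∀ i, α i → ℝ) (hf : ∀ i, Measurable (f i)) (b : ι → ℝ)
    (hb : ∀ i, ∫⁻ x, ENNReal.ofReal (Real.exp (f i x)) ∂(μ i) ≤ ENNReal.ofReal (Real.exp (b i))) :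
    ∫⁻ x, ENNReal.ofReal (Real.exp (∑ i, f i (x i))) ∂(Measure.pi μ) ≤
      ENNReal.ofReal (Real.exp (∑ i, b i)) := by
  have hm : ∀ i, Measurable fun x => ENNReal.ofReal (Real.exp (f i x)) := fun i => by
    have := hf i; fun_prop
  simp only [Real.exp_sum]
  simp only [ENNReal.ofReal_prod_of_nonneg (fun _ _ => (Real.exp_pos _).le)]
  rw [lintegral_prod_eq_prod_lintegral_of_indepFun Finset.univ
    (fun i (x : ∀ i, α i) => ENNReal.ofReal (Real.exp (f i (x i))))
    (iIndepFun_pi (μ := μ) (X := fun i x => ENNReal.ofReal (Real.exp (f i x)))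
      (fun i => (hm i).aemeasurable))
    (fun i => (hm i).comp (measurable_pi_apply i))]
  refine Finset.prod_le_prod' fun i _ => ?_
  refine le_trans (le_of_eq ?_) (hb i)
  exact (measurePreserving_eval μ i).lintegral_comp (hm i)

/-- Chernoff's bound for a sum of independent functions. -/
theorem pi_sum_ge_le_exp (f : ∀ i, α i → ℝ) (hf : ∀ i, Measurable (f i)) (b : ι → ℝ)
    (hb : ∀ i, ∫⁻ x, ENNReal.ofReal (Real.exp (f i x)) ∂(μ i) ≤ ENNReal.ofReal (Real.exp (b i)))
    (t : ℝ) :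
    Measure.pi μ {x | t ≤ ∑ i, f i (x i)} ≤ ENNReal.ofReal (Real.exp (∑ i, b i - t)) := by
  have h2 : Measure.pi μ {x | t ≤ ∑ i, f i (x i)} ≤
      ∫⁻ x, ENNReal.ofReal (Real.exp (-t)) *
        ENNReal.ofReal (Real.exp (∑ i, f i (x i))) ∂(Measure.pi μ) := by
    have hms : MeasurableSet {x : ∀ i, α i | t ≤ ∑ i, f i (x i)} :=
      measurableSet_le measurable_const
        (Finset.measurable_sum _ fun i _ => (hf i).comp (measurable_pi_apply i))
    rw [← lintegral_indicator_one hms]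
    refine lintegral_mono fun x => ?_
    by_cases hx : t ≤ ∑ i, f i (x i)
    · rw [Set.indicator_of_mem (by exact hx), ← ENNReal.ofReal_mul (Real.exp_pos _).le, ← Real.exp_add, Pi.one_apply,
        ← ENNReal.ofReal_one]
      refine ENNReal.ofReal_le_ofReal (Real.one_le_exp ?_)
      linarith
    · rw [Set.indicator_of_notMem (by exact hx)]; exact zero_le
  refine h2.trans ?_
  rw [lintegral_const_mul' _ _ ENNReal.ofReal_ne_top]
  refine (mul_le_mul_right (lintegral_exp_sum_pi_le μ f hf b hb) _).trans (le_of_eq ?_)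
  rw [← ENNReal.ofReal_mul (Real.exp_pos _).le, ← Real.exp_add]
  congr 2; ring

/-- If independent events all have small probability, then few of them occur. -/
theorem pi_card_bad_ge_le (A : ∀ i, Set (α i)) (hA : ∀ i, MeasurableSet (A i))
    (hp : ∀ i, μ i (A i) ≤ ENNReal.ofReal (1 / 6000)) (c : ℝ)
    (hc : (Fintype.card ι : ℝ) / 8 ≤ c) [∀ x : ∀ i, α i, DecidablePred fun i => x i ∈ A i] :
    Measure.pi μ {x | c ≤ ((Finset.univ.filter fun i => x i ∈ A i).card : ℝ)} ≤
      ENNReal.ofReal (Real.exp (-(Fintype.card ι : ℝ) / 2)) := by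
  -- Each occurrence has weight 8. As `exp 8 / 6000 ≤ 1/2`, every factor of the exponential moment
  -- is at most `3/2 ≤ exp (1/2)`, and the threshold `8 c` is at least the number of events; this
  -- leaves half of that number in the exponent. The value 1/6000 originates here.
  have key := pi_sum_ge_le_exp μ (fun i => (A i).indicator fun _ => (8 : ℝ))
    (fun i => measurable_const.indicator (hA i)) (fun _ => (1 / 2 : ℝ)) (fun i => ?_) (8 * c)
  · refine (measure_mono ?_).trans (key.trans (ENNReal.ofReal_le_ofReal (Real.exp_le_exp.2 ?_)))
    · intro x hx
      simp only [Set.mem_ofPred_eq] at hx ⊢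
      have : ∑ i, (A i).indicator (fun _ => (8 : ℝ)) (x i) =
          8 * ((Finset.univ.filter fun i => x i ∈ A i).card : ℝ) := by
        classical
        simp only [Set.indicator_apply]
        rw [Finset.sum_ite, Finset.sum_const_zero, Finset.sum_const, nsmul_eq_mul, add_zero,
          mul_comm]
      rw [this]; linarith
    · simp only [Finset.sum_const, Finset.card_univ, nsmul_eq_mul]
      linarith
  · have h1 : ∀ x, ENNReal.ofReal (Real.exp ((A i).indicator (fun _ => (8 : ℝ)) x)) ≤
        1 + (A i).indicator (fun _ => ENNReal.ofReal (Real.exp 8)) x := by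
      intro x
      by_cases hx : x ∈ A i
      · simp [hx]
      · simp [hx]
    refine (lintegral_mono h1).trans ?_
    rw [lintegral_add_left measurable_const, lintegral_indicator_const (hA i), lintegral_one,
      measure_univ]
    calc 1 + ENNReal.ofReal (Real.exp 8) * μ i (A i)
        ≤ 1 + ENNReal.ofReal (Real.exp 8) * ENNReal.ofReal (1 / 6000) := by gcongr; exact hp i
      _ = ENNReal.ofReal (1 + Real.exp 8 * (1 / 6000)) := by
          rw [← ENNReal.ofReal_mul (Real.exp_pos _).le, ENNReal.ofReal_add zero_le_one
            (by positivity), ENNReal.ofReal_one]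
      _ ≤ ENNReal.ofReal (Real.exp (1 / 2)) := by
          refine ENNReal.ofReal_le_ofReal ?_
          have e1 : Real.exp 8 ≤ 3000 := by
            have h : Real.exp 8 = Real.exp 1 ^ 8 := by rw [← Real.exp_nat_mul]; norm_num
            have := Real.exp_one_lt_d9
            rw [h]
            calc Real.exp 1 ^ 8 ≤ 2.7182818286 ^ 8 := by gcongr
              _ ≤ 3000 := by norm_num
          have e2 := Real.add_one_le_exp (1 / 2 : ℝ)
          linarith

/-- If independent `[0,1]`-valued functions have means at least `q` on `J`, their sum is not
much smaller than `q * #J`. -/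
theorem pi_sum_le_le_exp (f : ∀ i, α i → ℝ) (hf : ∀ i, Measurable (f i))
    (h0 : ∀ i x, 0 ≤ f i x) (h1 : ∀ i x, f i x ≤ 1) (J : Finset ι) (q : ℝ)
    (hJ : ∀ i ∈ J, q ≤ ∫ x, f i x ∂(μ i)) :
    Measure.pi μ {x | ∑ i, f i (x i) ≤ q * J.card / 4} ≤
      ENNReal.ofReal (Real.exp (-(q * J.card / 4))) := by
  classical
  have key := pi_sum_ge_le_exp μ (fun i x => -f i x) (fun i => (hf i).neg)
    (fun i => if i ∈ J then -(q / 2) else 0) (fun i => ?_) (-(q * J.card / 4))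
  · refine (measure_mono ?_).trans (key.trans (ENNReal.ofReal_le_ofReal (Real.exp_le_exp.2 ?_)))
    · intro x hx
      simp only [Set.mem_ofPred_eq] at hx ⊢
      rw [Finset.sum_neg_distrib]; linarith
    · simp only [Finset.sum_ite_mem, Finset.univ_inter, Finset.sum_const, nsmul_eq_mul]
      linarith
  · have hint : Integrable (f i) (μ i) :=
      Integrable.of_bound (hf i).aestronglyMeasurable 1
        (Filter.Eventually.of_forall fun x => by
          rw [Real.norm_eq_abs, abs_of_nonneg (h0 i x)]; exact h1 i x)
    -- Valid on `[0,1]`. A factor of mean at least `q` thus contributes at most `1 - q/2 ≤ exp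
    -- (-q/2)`, and the threshold `q * #J / 4` gives half of the exponent back.
    have hpt : ∀ x, Real.exp (-f i x) ≤ 1 - f i x / 2 := by
      intro x
      have hx0 := h0 i x
      have hx1 := h1 i x
      have := Real.exp_pos (f i x)
      have h2 : 1 + f i x + f i x ^ 2 / 2 ≤ Real.exp (f i x) :=
        Real.quadratic_le_exp_of_nonneg hx0
      rw [Real.exp_neg, inv_le_iff_one_le_mul₀ this]
      have h3 : 0 ≤ 1 - f i x / 2 := by linarith
      nlinarith [mul_le_mul_of_nonneg_left h2 h3, mul_nonneg hx0 hx0,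
        mul_nonneg (mul_nonneg hx0 hx0) hx0, mul_nonneg hx0 (sub_nonneg.2 hx1)]
    have hle : ∫⁻ x, ENNReal.ofReal (Real.exp (-f i x)) ∂(μ i) ≤
        ENNReal.ofReal (1 - (∫ x, f i x ∂(μ i)) / 2) := by
      have hi2 : Integrable (fun x => 1 - f i x / 2) (μ i) :=
        (integrable_const _).sub (hint.div_const 2)
      refine (lintegral_mono fun x => ENNReal.ofReal_le_ofReal (hpt x)).trans (le_of_eq ?_)
      rw [← ofReal_integral_eq_lintegral_ofReal hi2 (Filter.Eventually.of_forall fun x => by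
        have := h1 i x; simp only [Pi.zero_apply]; linarith)]
      rw [integral_sub (integrable_const _) (hint.div_const 2), integral_div]
      simp
    refine hle.trans (ENNReal.ofReal_le_ofReal ?_)
    have hI0 : 0 ≤ ∫ x, f i x ∂(μ i) := integral_nonneg (h0 i)
    split_ifs with hi
    · have := hJ i hi
      have h4 := Real.add_one_le_exp (-(q / 2))
      linarith
    · simp; linarith

end Product

/-! ### One-dimensional Gaussian estimates -/

/-- The density is at most 1/2 and the interval has length `2r/t`. The bound is uniform in `s`, so
it can be applied conditionally on an independent term. -/
theorem gaussianReal_abs_add_mul_lt_le {r t : ℝ} (s : ℝ) (ht : 0 < t) :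
    gaussianReal 0 1 {x | |s + t * x| < r} ≤ ENNReal.ofReal (r / t) := by
  have hsub : {x : ℝ | |s + t * x| < r} ⊆ Set.Ioo ((-r - s) / t) ((r - s) / t) := by
    intro x hx
    have hx' : |s + t * x| < r := hx
    rw [abs_lt] at hx'
    constructor
    · rw [div_lt_iff₀ ht]; linarith
    · rw [lt_div_iff₀ ht]; linarith
  refine (measure_mono hsub).trans ?_
  rw [gaussianReal_apply 0 one_ne_zero]
  have hpdf : ∀ x, gaussianPDF 0 1 x ≤ ENNReal.ofReal (1 / 2) := by
    intro x
    rw [gaussianPDF]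
    refine ENNReal.ofReal_le_ofReal ?_
    rw [gaussianPDFReal]
    have h1 : Real.exp (-(x - 0) ^ 2 / (2 * ((1 : ℝ≥0) : ℝ))) ≤ 1 := by
      rw [Real.exp_le_one_iff]
      have : 0 ≤ (x - 0) ^ 2 := sq_nonneg _
      simp only [NNReal.coe_one]; linarith
    have h2 : (√(2 * Real.pi * ((1 : ℝ≥0) : ℝ)))⁻¹ ≤ 1 / 2 := by
      rw [inv_le_comm₀ (by positivity) (by norm_num)]
      refine Real.le_sqrt_of_sq_le ?_
      have := Real.pi_gt_three
      simp only [NNReal.coe_one]; norm_num; linarith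
    calc _ ≤ (1 / 2 : ℝ) * 1 := by gcongr
      _ = 1 / 2 := mul_one _
  calc ∫⁻ x in Set.Ioo ((-r - s) / t) ((r - s) / t), gaussianPDF 0 1 x
      ≤ ∫⁻ x in Set.Ioo ((-r - s) / t) ((r - s) / t), ENNReal.ofReal (1 / 2) :=
        lintegral_mono hpdf
    _ = ENNReal.ofReal (1 / 2) * ENNReal.ofReal ((r - s) / t - (-r - s) / t) := by
        rw [lintegral_const, Measure.restrict_apply_univ, Real.volume_Ioo]
    _ = ENNReal.ofReal (r / t) := by
        rw [← ENNReal.ofReal_mul (by norm_num)]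
        congr 1; field_simp; ring

theorem gaussianReal_abs_ge_le {t : ℝ} (ht : 0 ≤ t) :
    gaussianReal 0 1 {x | t ≤ |x|} ≤ ENNReal.ofReal (2 * Real.exp (-t ^ 2 / 2)) := by
  have hs : HasSubgaussianMGF (fun x : ℝ => x) 1 (gaussianReal 0 1) :=
    ⟨fun u => integrable_exp_mul_gaussianReal u, fun u => by
      rw [mgf_fun_id_gaussianReal]; simp⟩
  have h1 := hs.measure_ge_le ht
  have h2 := hs.neg.measure_ge_le ht
  have hsub : {x : ℝ | t ≤ |x|} ⊆ {x | t ≤ x} ∪ {x | t ≤ (-fun x : ℝ => x) x} := by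
    intro x hx
    rcases le_abs.1 (show t ≤ |x| from hx) with h | h
    · exact Or.inl h
    · exact Or.inr h
  refine (measure_mono hsub).trans ((measure_union_le _ _).trans ?_)
  rw [two_mul, ENNReal.ofReal_add (Real.exp_pos _).le (Real.exp_pos _).le]
  gcongr
  · rw [← ENNReal.ofReal_toReal (measure_ne_top (gaussianReal 0 1) {x | t ≤ x})]
    refine ENNReal.ofReal_le_ofReal ?_
    simpa [Measure.real] using h1
  · rw [← ENNReal.ofReal_toReal (measure_ne_top (gaussianReal 0 1) {x | t ≤ (-fun x : ℝ => x) x})]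
    refine ENNReal.ofReal_le_ofReal ?_
    simpa [Measure.real] using h2

/-- The moment equals `√2`. It gives the chi-square tails at level 4 per degree of freedom. -/
theorem lintegral_exp_sq_div_four_gaussianReal :
    ∫⁻ x, ENNReal.ofReal (Real.exp (x ^ 2 / 4)) ∂(gaussianReal 0 1) ≤
      ENNReal.ofReal (Real.exp (1 / 2)) := by
  rw [gaussianReal_of_var_ne_zero 0 one_ne_zero,
    lintegral_withDensity_eq_lintegral_mul _ (measurable_gaussianPDF 0 1) (by fun_prop)]
  have hpt : ∀ x : ℝ, (gaussianPDF 0 1 * fun x => ENNReal.ofReal (Real.exp (x ^ 2 / 4))) x =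
      ENNReal.ofReal ((√(2 * Real.pi))⁻¹ * Real.exp (-(1 / 4) * x ^ 2)) := by
    intro x
    rw [Pi.mul_apply, gaussianPDF, gaussianPDFReal,
      ← ENNReal.ofReal_mul (by positivity), mul_assoc, ← Real.exp_add]
    simp only [NNReal.coe_one, mul_one, sub_zero]
    congr 3; ring
  simp_rw [hpt]
  rw [← ofReal_integral_eq_lintegral_ofReal
    ((integrable_exp_neg_mul_sq (by norm_num)).const_mul _)
    (Filter.Eventually.of_forall fun x => by positivity), integral_const_mul, integral_gaussian]
  refine ENNReal.ofReal_le_ofReal ?_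
  have h1 : √(Real.pi / (1 / 4)) = √2 * √(2 * Real.pi) := by
    rw [← Real.sqrt_mul (by norm_num)]; congr 1; ring
  have hpos : 0 < √(2 * Real.pi) := Real.sqrt_pos.2 (by positivity)
  rw [h1, mul_comm, mul_assoc, mul_inv_cancel₀ hpos.ne', mul_one]
  have h2 : √2 ≤ 1.5 := by
    rw [Real.sqrt_le_left (by norm_num)]; norm_num
  have := Real.add_one_le_exp (1 / 2 : ℝ)
  linarith

/-- The density of `N(0,1)` relative to `N(-s,1)` is `exp (s x + s²/2)`, bounded on `A` by the
hypothesis. -/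
theorem gaussianReal_le_exp_mul_sub {A : Set ℝ} (hA : MeasurableSet A) {s M : ℝ}
    (hM : ∀ x ∈ A, s * x ≤ M) :
    gaussianReal 0 1 A ≤
      ENNReal.ofReal (Real.exp (M + s ^ 2 / 2)) * gaussianReal 0 1 {x | x - s ∈ A} := by
  have h1 : gaussianReal 0 1 {x | x - s ∈ A} = gaussianReal (-s) 1 A := by
    have := gaussianReal_map_sub_const (μ := 0) (v := 1) s
    rw [zero_sub] at this
    rw [← this, Measure.map_apply (by fun_prop) hA]; rfl
  rw [h1, gaussianReal_apply _ one_ne_zero, gaussianReal_apply _ one_ne_zero,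
    ← lintegral_const_mul _ (measurable_gaussianPDF _ _)]
  refine setLIntegral_mono ((measurable_gaussianPDF _ _).const_mul _) fun x hx => ?_
  rw [gaussianPDF, gaussianPDF, ← ENNReal.ofReal_mul (Real.exp_pos _).le]
  refine ENNReal.ofReal_le_ofReal ?_
  rw [gaussianPDFReal, gaussianPDFReal, mul_left_comm, ← Real.exp_add]
  gcongr
  have := hM x hx
  simp only [NNReal.coe_one, mul_one, sub_zero, sub_neg_eq_add]
  nlinarith

/-! ### Standard Gaussian measures on Euclidean spaces -/

section StdGaussian

variable {E E₁ E₂ : Type*}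
  [NormedAddCommGroup E] [InnerProductSpace ℝ E] [FiniteDimensional ℝ E] [MeasurableSpace E]
  [BorelSpace E]
  [NormedAddCommGroup E₁] [InnerProductSpace ℝ E₁] [FiniteDimensional ℝ E₁] [MeasurableSpace E₁]
  [BorelSpace E₁]
  [NormedAddCommGroup E₂] [InnerProductSpace ℝ E₂] [FiniteDimensional ℝ E₂] [MeasurableSpace E₂]
  [BorelSpace E₂]

/-- Equality of two Gaussian laws of this shape reduces to equality of the quadratic forms `‖A' t‖²
+ ‖B' t‖²`. -/
theorem charFun_stdGaussian_map_add (A : E₁ →L[ℝ] E) (B : E₂ →L[ℝ] E) (A' : E → E₁) (B' : E → E₂)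
    (hA : ∀ x t, ⟪A x, t⟫ = ⟪x, A' t⟫) (hB : ∀ x t, ⟪B x, t⟫ = ⟪x, B' t⟫) (t : E) :
    charFun (((stdGaussian E₁).prod (stdGaussian E₂)).map fun p => A p.1 + B p.2) t =
      Complex.exp (-((‖A' t‖ ^ 2 + ‖B' t‖ ^ 2 : ℝ) : ℂ) / 2) := by
  have h1 : charFun (((stdGaussian E₁).prod (stdGaussian E₂)).map fun p => A p.1 + B p.2) t =
      charFun (stdGaussian E₁) (A' t) * charFun (stdGaussian E₂) (B' t) := by
    rw [charFun_apply, integral_map (by fun_prop) (by fun_prop), charFun_apply, charFun_apply,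
      ← integral_prod_mul]
    refine integral_congr_ae (Filter.Eventually.of_forall fun p => ?_)
    simp only [inner_add_left, hA, hB]
    rw [← Complex.exp_add]
    push_cast; congr 1; ring
  rw [h1, charFun_stdGaussian, charFun_stdGaussian, ← Complex.exp_add]
  push_cast; congr 1; ring

theorem stdGaussian_map_inner (v : E) :
    (stdGaussian E).map (fun x => ⟪v, x⟫) = gaussianReal 0 (‖v‖₊ ^ 2) := by
  refine Measure.ext_of_charFun (funext fun t => ?_)
  rw [charFun_gaussianReal, charFun_apply, integral_map (by fun_prop) (by fun_prop)]
  have := charFun_stdGaussian (E := E) (t • v)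
  rw [charFun_apply] at this
  have h2 : ∀ x : E, ⟪⟪v, x⟫, t⟫ = ⟪x, t • v⟫ := fun x => by
    rw [real_inner_smul_right, real_inner_comm v x]; simp
  simp_rw [h2, this]
  rw [norm_smul]
  simp only [Real.norm_eq_abs]
  push_cast
  rw [mul_pow, ← Complex.ofReal_pow, sq_abs]
  push_cast
  congr 1; ring

theorem stdGaussian_map_inner_unit {v : E} (hv : ‖v‖ = 1) :
    (stdGaussian E).map (fun x => ⟪v, x⟫) = gaussianReal 0 1 := by
  rw [stdGaussian_map_inner]
  congr
  ext; simp [hv]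

/-- The component of a standard Gaussian vector along a unit vector can be resampled. -/
theorem measurePreserving_stdGaussian_line {f : E} (hf : ‖f‖ = 1) :
    MeasurePreserving (fun p : E × ℝ => p.1 - ⟪f, p.1⟫ • f + p.2 • f)
      ((stdGaussian E).prod (gaussianReal 0 1)) (stdGaussian E) := by
  refine ⟨by fun_prop, ?_⟩
  have hR : gaussianReal 0 1 = stdGaussian ℝ := by
    refine Measure.ext_of_charFun (funext fun t => ?_)
    rw [charFun_gaussianReal, charFun_stdGaussian]
    simp only [Real.norm_eq_abs]
    rw [← Complex.ofReal_pow |t|, sq_abs]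
    push_cast; congr 1; simp; ring
  rw [hR]
  refine Measure.ext_of_charFun (funext fun t => ?_)
  have := charFun_stdGaussian_map_add (E := E)
    (ContinuousLinearMap.id ℝ E - (innerSL ℝ f).smulRight f)
    ((ContinuousLinearMap.id ℝ ℝ).smulRight f) (fun t => t - ⟪f, t⟫ • f) (fun t => ⟪f, t⟫)
    (fun x t => by
      simp [inner_sub_left, inner_sub_right, real_inner_smul_left, real_inner_smul_right]
      rw [real_inner_comm x f]; ring)
    (fun x t => by simp [real_inner_smul_left, mul_comm]) t
  simp only [sub_apply, ContinuousLinearMap.id_apply,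
    ContinuousLinearMap.smulRight_apply, innerSL_apply_apply] at this
  rw [this, charFun_stdGaussian]
  congr 2
  rw [norm_sub_sq_real, norm_smul, hf, real_inner_smul_right, real_inner_comm f t]
  simp only [Real.norm_eq_abs, mul_one, sq_abs]
  push_cast; ring

theorem stdGaussian_apply_eq_lintegral_line {f : E} (hf : ‖f‖ = 1) {A : Set E}
    (hA : MeasurableSet A) :
    stdGaussian E A = ∫⁻ x, gaussianReal 0 1 {s | x - ⟪f, x⟫ • f + s • f ∈ A} ∂(stdGaussian E) := by
  have h := measurePreserving_stdGaussian_line hf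
  rw [← h.measure_preimage hA.nullMeasurableSet, Measure.prod_apply (h.measurable hA)]
  rfl

/-- A set meeting every line of a given direction in a countable set is a null set. -/
theorem stdGaussian_eq_zero_of_lines {f : E} (hf : ‖f‖ = 1) {A : Set E} (hA : MeasurableSet A)
    (h : ∀ x : E, {s : ℝ | x + s • f ∈ A}.Countable) : stdGaussian E A = 0 := by
  have : NullSingletonClass (gaussianReal 0 1) := nullSingletonClass_gaussianReal one_ne_zero
  rw [stdGaussian_apply_eq_lintegral_line hf hA]
  simp [(h _).measure_zero (gaussianReal 0 1)]

/-- Cameron-Martin comparison of a set and its translate. -/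
theorem stdGaussian_le_exp_mul_sub {A : Set E} (hA : MeasurableSet A) (h : E) {M : ℝ}
    (hM : ∀ x ∈ A, ⟪h, x⟫ ≤ M) :
    stdGaussian E A ≤
      ENNReal.ofReal (Real.exp (M + ‖h‖ ^ 2 / 2)) * stdGaussian E {x | x - h ∈ A} := by
  have hA' : MeasurableSet {x | x - h ∈ A} := by
    have : Measurable fun x : E => x - h := by fun_prop
    exact this hA
  rcases eq_or_ne h 0 with rfl | hne
  · simp only [inner_zero_left] at hM
    rcases A.eq_empty_or_nonempty with rfl | ⟨x, hx⟩
    · simp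
    · have h1 : (1 : ℝ≥0∞) ≤ ENNReal.ofReal (Real.exp (M + ‖(0 : E)‖ ^ 2 / 2)) := by
        rw [ENNReal.one_le_ofReal]
        exact Real.one_le_exp (by have := hM x hx; simpa using this)
      simp only [sub_zero]
      calc stdGaussian E A = 1 * stdGaussian E A := (one_mul _).symm
        _ ≤ _ := by gcongr; rfl
  have hn : 0 < ‖h‖ := norm_pos_iff.2 hne
  set f : E := ‖h‖⁻¹ • h with hfdef
  have hf : ‖f‖ = 1 := by rw [hfdef, norm_smul]; simp [hn.ne']
  have hh : h = ‖h‖ • f := by rw [hfdef, smul_smul, mul_inv_cancel₀ hn.ne', one_smul]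
  have hff : ⟪f, f⟫ = 1 := by rw [real_inner_self_eq_norm_sq, hf]; norm_num
  -- Both sides are disintegrated along the lines parallel to `h`; on each line the claim is the
  -- one-dimensional comparison with shift `‖h‖`.
  rw [stdGaussian_apply_eq_lintegral_line hf hA, stdGaussian_apply_eq_lintegral_line hf hA',
    ← lintegral_const_mul' _ _ ENNReal.ofReal_ne_top]
  refine lintegral_mono fun x => ?_
  have hms : MeasurableSet {s : ℝ | x - ⟪f, x⟫ • f + s • f ∈ A} := by
    have : Measurable fun s : ℝ => x - ⟪f, x⟫ • f + s • f := by fun_prop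
    exact this hA
  refine (gaussianReal_le_exp_mul_sub hms (s := ‖h‖) (M := M) fun s hs => ?_).trans (le_of_eq ?_)
  · have := hM _ hs
    rw [hh] at this
    simp only [inner_add_right, inner_sub_right, real_inner_smul_right, real_inner_smul_left, hff]
      at this
    linarith
  · congr 2
    ext s
    simp only [Set.mem_ofPred_eq]
    have : x - ⟪f, x⟫ • f + (s - ‖h‖) • f = x - ⟪f, x⟫ • f + s • f - h := by
      conv_rhs => rw [hh]
      rw [sub_smul]; abel
    rw [this]

end StdGaussian

/-! ### Reflections and orthants -/

section Householder

variable {E F : Type*} [NormedAddCommGroup E] [InnerProductSpace ℝ E]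

/-- The reflection in the hyperplane orthogonal to `b`; the identity if `b = 0`. -/
noncomputable def householder (b x : E) : E := x - (2 * (⟪b, x⟫ / ‖b‖ ^ 2)) • b

theorem householder_eq_reflection (b x : E) :
    householder b x = (Submodule.span ℝ {b})ᗮ.reflection x := by
  rw [Submodule.reflection_orthogonal_apply, Submodule.reflection_singleton_apply, householder]
  simp only [RCLike.ofReal_real_eq_id, id_eq, two_smul, two_mul, add_smul]
  abel

theorem inner_householder_self (b x : E) : ⟪b, householder b x⟫ = -⟪b, x⟫ := by
  rcases eq_or_ne b 0 with rfl | hb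
  · simp
  · have : ‖b‖ ≠ 0 := norm_ne_zero_iff.2 hb
    rw [householder, inner_sub_right, real_inner_smul_right, real_inner_self_eq_norm_sq]
    field_simp; ring

theorem inner_householder_of_inner_eq_zero {b b' : E} (h : ⟪b', b⟫ = 0) (x : E) :
    ⟪b', householder b x⟫ = ⟪b', x⟫ := by
  rw [householder, inner_sub_right, real_inner_smul_right, h]; ring

variable [FiniteDimensional ℝ E]
  [NormedAddCommGroup F] [InnerProductSpace ℝ F] [FiniteDimensional ℝ F]

/-- A singular value decomposition of `A`, completed by the component of `u` in its kernel. -/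
theorem exists_adapted_family (A : E →L[ℝ] F) (u : E) {l : ℕ} (hl : Module.finrank ℝ F = l) :
    ∃ (v : OrthonormalBasis (Fin l) ℝ F) (b : Option (Fin l) → E),
      (∀ s x, ⟪b (some s), x⟫ = ⟪v s, A x⟫) ∧ (∀ i j, i ≠ j → ⟪b i, b j⟫ = 0) ∧
      A (b none) = 0 ∧ 0 ≤ ⟪b none, u⟫ ∧
      ∀ x, ⟪u, x⟫ = ∑ i, ⟪b i, u⟫ / ‖b i‖ ^ 2 * ⟪b i, x⟫ := by
  -- For an eigenbasis `v` of `A A*` the vectors `A* v s` are pairwise orthogonal. Some of them may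
  -- vanish, which is harmless since the quotients by `‖0‖ ^ 2` are zero. What remains of `u` after
  -- removing its components along them lies in the kernel of `A`.
  let T : F →ₗ[ℝ] F := (A ∘L A.adjoint).toLinearMap
  have hT : T.IsSymmetric := fun x y => by
    change ⟪A (A.adjoint x), y⟫ = ⟪x, A (A.adjoint y)⟫
    rw [← ContinuousLinearMap.adjoint_inner_right, ContinuousLinearMap.adjoint_inner_left]
  let v := hT.eigenvectorBasis hl
  let w : Fin l → E := fun s => A.adjoint (v s)
  have hw : ∀ s x, ⟪w s, x⟫ = ⟪v s, A x⟫ := fun s x =>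
    ContinuousLinearMap.adjoint_inner_left _ _ _
  have hAw : ∀ s, A (w s) = hT.eigenvalues hl s • v s := fun s =>
    hT.apply_eigenvectorBasis hl s
  have hww : ∀ s t, s ≠ t → ⟪w s, w t⟫ = 0 := fun s t hst => by
    rw [hw, hAw, real_inner_smul_right, v.orthonormal.2 hst, mul_zero]
  let b₀ : E := u - ∑ s, (⟪w s, u⟫ / ‖w s‖ ^ 2) • w s
  have hwb : ∀ s, ⟪w s, b₀⟫ = 0 := fun s => by
    change ⟪w s, u - ∑ s, (⟪w s, u⟫ / ‖w s‖ ^ 2) • w s⟫ = 0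
    rw [inner_sub_right, inner_sum, Finset.sum_eq_single s]
    · rw [real_inner_smul_right, real_inner_self_eq_norm_sq]
      rcases eq_or_ne (w s) 0 with h | h
      · simp [h]
      · have : ‖w s‖ ≠ 0 := norm_ne_zero_iff.2 h
        field_simp; ring
    · intro t _ hts
      rw [real_inner_smul_right, hww s t hts.symm, mul_zero]
    · simp
  have hu : u = b₀ + ∑ s, (⟪w s, u⟫ / ‖w s‖ ^ 2) • w s := by simp [b₀]
  have hbu : ⟪b₀, u⟫ = ‖b₀‖ ^ 2 := by
    conv_lhs => rw [hu]
    rw [inner_add_right, real_inner_self_eq_norm_sq, inner_sum]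
    simp only [real_inner_smul_right, fun s => real_inner_comm (w s) b₀, hwb]
    simp
  refine ⟨v, fun i => i.elim b₀ w, hw, ?_, ?_, ?_, ?_⟩
  · rintro (_ | s) (_ | t) hst
    · exact absurd rfl hst
    · simpa [real_inner_comm] using hwb t
    · simpa using hwb s
    · simpa using hww s t (fun h => hst (h ▸ rfl))
  · refine InnerProductSpace.ext_inner_left_basis v.toBasis fun s => ?_
    rw [v.coe_toBasis, ← hw, inner_zero_right]; exact hwb s
  · simp only [Option.elim_none, hbu]; positivity
  · intro x
    rw [Fintype.sum_option]
    simp only [Option.elim_none, Option.elim_some, hbu]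
    conv_lhs => rw [hu]
    rw [inner_add_left, sum_inner]
    congr 1
    · rcases eq_or_ne b₀ 0 with h | h
      · simp [h]
      · have : ‖b₀‖ ≠ 0 := norm_ne_zero_iff.2 h
        field_simp
    · simp [real_inner_smul_left]

end Householder

section Orthant

variable {E : Type*}
  [NormedAddCommGroup E] [InnerProductSpace ℝ E] [FiniteDimensional ℝ E] [MeasurableSpace E]
  [BorelSpace E]

theorem measurePreserving_householder (b : E) :
    MeasurePreserving (householder b) (stdGaussian E) (stdGaussian E) := by
  have h : householder b = ⇑((Submodule.span ℝ {b})ᗮ.reflection) :=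
    funext (householder_eq_reflection b)
  rw [h]
  exact ⟨(LinearIsometryEquiv.continuous _).measurable, stdGaussian_map _⟩

/-- A set that is stable under reflections towards an orthant has a fixed proportion of its
Gaussian mass in this orthant. -/
theorem stdGaussian_le_two_pow_mul_orthant {ι : Type*} [Fintype ι] (b : ι → E)
    (hb : ∀ i j, i ≠ j → ⟪b i, b j⟫ = 0) (α : ι → ℝ) {C : Set E} (hC : MeasurableSet C)
    (href : ∀ i, ∀ x ∈ C, α i * ⟪b i, x⟫ < 0 → householder (b i) x ∈ C) :
    stdGaussian E C ≤
      2 ^ Fintype.card ι * stdGaussian E (C ∩ {x | ∀ i, 0 ≤ α i * ⟪b i, x⟫}) := by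
  classical
  have key : ∀ S : Finset ι, stdGaussian E C ≤
      2 ^ S.card * stdGaussian E (C ∩ {x | ∀ i ∈ S, 0 ≤ α i * ⟪b i, x⟫}) := by
    intro S
    induction S using Finset.induction_on with
    | empty => simp
    | insert s S hs ih =>
      refine ih.trans ?_
      rw [Finset.card_insert_of_notMem hs, pow_succ, mul_assoc]
      gcongr
      have hms : ∀ T : Finset ι, MeasurableSet (C ∩ {x | ∀ i ∈ T, 0 ≤ α i * ⟪b i, x⟫}) := by
        intro T
        refine hC.inter ?_
        have : {x : E | ∀ i ∈ T, 0 ≤ α i * ⟪b i, x⟫} =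
            ⋂ i ∈ T, {x : E | 0 ≤ α i * ⟪b i, x⟫} := by ext; simp
        rw [this]
        exact T.measurableSet_biInter fun i _ => measurableSet_le measurable_const (by fun_prop)
      set P := C ∩ {x | ∀ i ∈ insert s S, 0 ≤ α i * ⟪b i, x⟫} with hP
      -- A point on the wrong side of the hyperplane of `b s` is folded to the right side; by
      -- orthogonality the signs already arranged are kept. Each fold costs a factor 2.
      have hsub : C ∩ {x | ∀ i ∈ S, 0 ≤ α i * ⟪b i, x⟫} ⊆ P ∪ householder (b s) ⁻¹' P := by
        rintro x ⟨hxC, hx⟩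
        rcases lt_or_ge (α s * ⟪b s, x⟫) 0 with h | h
        · refine Or.inr ⟨href s x hxC h, ?_⟩
          intro i hi
          rcases Finset.mem_insert.1 hi with rfl | hi
          · rw [inner_householder_self]; linarith
          · have : i ≠ s := fun h => hs (h ▸ hi)
            rw [inner_householder_of_inner_eq_zero (hb i s this)]
            exact hx i hi
        · refine Or.inl ⟨hxC, ?_⟩
          intro i hi
          rcases Finset.mem_insert.1 hi with rfl | hi
          · exact h
          · exact hx i hi
      refine (measure_mono hsub).trans ((measure_union_le _ _).trans ?_)
      rw [(measurePreserving_householder (b s)).measure_preimage (hms _).nullMeasurableSet, two_mul]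
  simpa using key Finset.univ

/-- A set that is stable under reflections towards an orthant and under short translations along
a unit vector `f` has a fixed proportion of its Gaussian mass in the part of the orthant where the
`f`-component is not small. -/
theorem stdGaussian_le_mul_orthant_far {ι : Type*} [Fintype ι] (b : ι → E)
    (hb : ∀ i j, i ≠ j → ⟪b i, b j⟫ = 0) (α : ι → ℝ) {C : Set E} (hC : MeasurableSet C)
    (href : ∀ i, ∀ x ∈ C, α i * ⟪b i, x⟫ < 0 → householder (b i) x ∈ C)
    {f : E} (hf : ‖f‖ = 1) (hbf : ∀ i, 0 ≤ α i * ⟪b i, f⟫) {c : ℝ} (hc : 0 ≤ c) (hc1 : c ≤ 1)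
    (hfx : ∀ x, (∀ i, 0 ≤ α i * ⟪b i, x⟫) → 0 ≤ ⟪f, x⟫)
    (hshift : ∀ x ∈ C, (∀ i, 0 ≤ α i * ⟪b i, x⟫) → ⟪f, x⟫ ≤ c → x + c • f ∈ C) :
    stdGaussian E C ≤ ENNReal.ofReal (2 ^ Fintype.card ι * 6) *
      stdGaussian E (C ∩ {x | ∀ i, 0 ≤ α i * ⟪b i, x⟫} ∩ {x | c ≤ ⟪f, x⟫}) := by
  set O := {x : E | ∀ i, 0 ≤ α i * ⟪b i, x⟫} with hO
  have hOm : MeasurableSet O := by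
    have : O = ⋂ i, {x : E | 0 ≤ α i * ⟪b i, x⟫} := by ext; simp [hO]
    rw [this]
    exact MeasurableSet.iInter fun i => measurableSet_le measurable_const (by fun_prop)
  set P := C ∩ O ∩ {x | c ≤ ⟪f, x⟫} with hP
  set Q := C ∩ O ∩ {x | ⟪f, x⟫ ≤ c} with hQ
  have hQm : MeasurableSet Q :=
    (hC.inter hOm).inter (measurableSet_le (by fun_prop) measurable_const)
  -- On `Q` the component along `f` is at most `c ≤ 1`. Translating by `c • f` leads into `P` at a
  -- cost of at most `exp (3/2) < 5`; with `P` itself this makes the factor 6.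
  have h1 : stdGaussian E Q ≤ ENNReal.ofReal 5 * stdGaussian E P := by
    refine (stdGaussian_le_exp_mul_sub hQm (c • f) (M := 1) ?_).trans ?_
    · intro x hx
      rw [real_inner_smul_left]
      have h2 : ⟪f, x⟫ ≤ c := hx.2
      have h3 := hfx x hx.1.2
      nlinarith
    · gcongr
      · rw [norm_smul, hf, mul_one, Real.norm_eq_abs, sq_abs]
        have h4 : Real.exp (1 + c ^ 2 / 2) ≤ Real.exp (1.5) := Real.exp_le_exp.2 (by nlinarith)
        have h5 : Real.exp 1.5 ^ 2 = Real.exp 1 ^ 3 := by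
          rw [← Real.exp_nat_mul, ← Real.exp_nat_mul]; norm_num
        have h6 := Real.exp_one_lt_d9
        have h7 : Real.exp 1 ^ 3 ≤ 2.7182818286 ^ 3 := by gcongr
        refine h4.trans ?_
        refine (abs_le_of_sq_le_sq' (a := Real.exp 1.5) (b := 5) ?_ (by norm_num)).2
        rw [h5]; refine h7.trans (by norm_num)
      · rintro x ⟨⟨hxC, hxO⟩, hxf⟩
        have hxf : ⟪f, x - c • f⟫ ≤ c := hxf
        have hff : ⟪f, f⟫ = 1 := by rw [real_inner_self_eq_norm_sq, hf]; norm_num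
        have hx0 := hfx _ hxO
        refine ⟨⟨?_, ?_⟩, ?_⟩
        · have := hshift _ hxC hxO hxf
          simpa using this
        · intro i
          have h2 := hxO i
          have h3 := mul_nonneg hc (hbf i)
          simp only [inner_sub_right, real_inner_smul_right] at h2
          nlinarith
        · simp only [inner_sub_right, real_inner_smul_right, hff] at hx0
          simp only [Set.mem_ofPred_eq]; linarith
  have h2 : stdGaussian E (C ∩ O) ≤ ENNReal.ofReal 6 * stdGaussian E P := by
    have : C ∩ O ⊆ P ∪ Q := by
      intro x hx
      rcases le_total c ⟪f, x⟫ with h | h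
      · exact Or.inl ⟨hx, h⟩
      · exact Or.inr ⟨hx, h⟩
    refine (measure_mono this).trans ((measure_union_le _ _).trans ?_)
    calc _ ≤ stdGaussian E P + ENNReal.ofReal 5 * stdGaussian E P := by gcongr
      _ = (1 + ENNReal.ofReal 5) * stdGaussian E P := by ring
      _ = _ := by
        rw [← ENNReal.ofReal_one, ← ENNReal.ofReal_add (by norm_num) (by norm_num)]; norm_num
  refine (stdGaussian_le_two_pow_mul_orthant b hb α hC href).trans ?_
  rw [ENNReal.ofReal_mul (by positivity), mul_assoc]
  refine mul_le_mul' (le_of_eq ?_) h2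
  rw [ENNReal.ofReal_pow (by norm_num)]; norm_num

end Orthant

/-! ### Nearest neighbours among Gaussian points -/

section Frame

variable {E F : Type*}
  [NormedAddCommGroup E] [InnerProductSpace ℝ E]
  [NormedAddCommGroup F] [InnerProductSpace ℝ F]

/-- A singular frame of `A`, the signs of the coordinates of `u` in this frame, and a direction `f`
of the frame that carries a fixed proportion of `u`. -/
structure AdaptedFrame (A : E →L[ℝ] F) (u : E) (l : ℕ) where
  v : OrthonormalBasis (Fin l) ℝ F
  b : Option (Fin l) → E
  α : Option (Fin l) → ℝ
  i₀ : Option (Fin l)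
  sgn : ℝ
  f : E
  inner_b : ∀ s x, ⟪b (some s), x⟫ = ⟪v s, A x⟫
  orth : ∀ i j, i ≠ j → ⟪b i, b j⟫ = 0
  map_none : A (b none) = 0
  norm_b : 0 < ‖b i₀‖
  f_eq : f = (sgn / ‖b i₀‖) • b i₀
  sgn_sq : sgn ^ 2 = 1
  α_eq : α i₀ = sgn * |α i₀|
  α_ne : α i₀ ≠ 0
  le_inner_u : ∀ x, (∀ i, 0 ≤ α i * ⟪b i, x⟫) → ⟪f, x⟫ ≤ √(l + 1) * ⟪u, x⟫

theorem exists_adaptedFrame [FiniteDimensional ℝ E] [FiniteDimensional ℝ F] (A : E →L[ℝ] F) {u : E} (hu : ‖u‖ = 1) {l : ℕ}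
    (hl : Module.finrank ℝ F = l) : Nonempty (AdaptedFrame A u l) := by
  obtain ⟨v, b, hb, horth, hnone, -, hux⟩ := exists_adapted_family A u hl
  have hsum : ∑ i, ⟪b i, u⟫ ^ 2 / ‖b i‖ ^ 2 = 1 := by
    have := hux u
    rw [real_inner_self_eq_norm_sq, hu] at this
    rw [show (1 : ℝ) = 1 ^ 2 by norm_num, this]
    exact Finset.sum_congr rfl fun i _ => by ring
  -- The squared cosines between `u` and the `l + 1` frame directions sum to 1, so one of them is at
  -- least the average; `f` is that direction, with the sign of `u`.
  obtain ⟨i, hi⟩ : ∃ i, 1 / ((l : ℝ) + 1) ≤ ⟪b i, u⟫ ^ 2 / ‖b i‖ ^ 2 := by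
    by_contra! h
    have h2 : ∑ i, ⟪b i, u⟫ ^ 2 / ‖b i‖ ^ 2 < ∑ _i : Option (Fin l), 1 / ((l : ℝ) + 1) :=
      Finset.sum_lt_sum_of_nonempty Finset.univ_nonempty fun i _ => h i
    rw [hsum, Finset.sum_const, Finset.card_univ, Fintype.card_option, Fintype.card_fin,
      nsmul_eq_mul] at h2
    have : ((l + 1 : ℕ) : ℝ) * (1 / ((l : ℝ) + 1)) = 1 := by
      push_cast; field_simp
    linarith
  have hpos : 0 < ⟪b i, u⟫ ^ 2 / ‖b i‖ ^ 2 := lt_of_lt_of_le (by positivity) hi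
  have hα : ⟪b i, u⟫ ≠ 0 := fun h => by rw [h] at hpos; simp at hpos
  have hbi : 0 < ‖b i‖ := by
    rw [norm_pos_iff]; rintro h; rw [h] at hα; simp at hα
  have habs : 0 < |⟪b i, u⟫| := abs_pos.2 hα
  refine ⟨⟨v, b, fun i => ⟪b i, u⟫, i, ⟪b i, u⟫ / |⟪b i, u⟫|, _, hb, horth, hnone, hbi, rfl, ?_, ?_,
    hα, ?_⟩⟩
  · rw [div_pow, sq_abs]; exact div_self (pow_ne_zero 2 hα)
  · field_simp
  · intro x hx
    rw [real_inner_smul_left]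
    have h1 : ⟪b i, u⟫ / ‖b i‖ ^ 2 * ⟪b i, x⟫ ≤ ⟪u, x⟫ := by
      rw [hux x]
      refine Finset.single_le_sum (f := fun i => ⟪b i, u⟫ / ‖b i‖ ^ 2 * ⟪b i, x⟫) (fun j _ => ?_)
        (Finset.mem_univ i)
      have := hx j
      rw [div_mul_eq_mul_div]
      positivity
    have h2 : 1 ≤ √((l : ℝ) + 1) * (|⟪b i, u⟫| / ‖b i‖) := by
      have h3 : √(1 / ((l : ℝ) + 1)) ≤ |⟪b i, u⟫| / ‖b i‖ := by
        rw [Real.sqrt_le_left (by positivity), div_pow, sq_abs]; exact hi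
      rw [Real.sqrt_div zero_le_one, Real.sqrt_one, div_le_iff₀ (by positivity)] at h3
      linarith
    have hx0 := hx i
    have h3 : 0 ≤ ⟪b i, u⟫ * ⟪b i, x⟫ / (|⟪b i, u⟫| * ‖b i‖) := by positivity
    calc ⟪b i, u⟫ / |⟪b i, u⟫| / ‖b i‖ * ⟪b i, x⟫
        = 1 * (⟪b i, u⟫ * ⟪b i, x⟫ / (|⟪b i, u⟫| * ‖b i‖)) := by field_simp
      _ ≤ √((l : ℝ) + 1) * (|⟪b i, u⟫| / ‖b i‖) *
            (⟪b i, u⟫ * ⟪b i, x⟫ / (|⟪b i, u⟫| * ‖b i‖)) := by gcongr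
      _ = √((l : ℝ) + 1) * (⟪b i, u⟫ / ‖b i‖ ^ 2 * ⟪b i, x⟫) := by field_simp
      _ ≤ _ := by gcongr

namespace AdaptedFrame

variable {A : E →L[ℝ] F} {u : E} {l : ℕ} (fr : AdaptedFrame A u l)

/-- The vectors whose frame coordinates have the same signs as those of `u`. -/
def orthant : Set E := {x | ∀ i, 0 ≤ fr.α i * ⟪fr.b i, x⟫}

/-- The targets for which moving a point of the orthant outwards along `f` is favourable. -/
def IsTarget (c : ℝ) (ζ : F) : Prop :=
  (∀ s, 0 ≤ fr.α (some s) * ⟪fr.v s, ζ⟫) ∧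
    ∀ s, fr.i₀ = some s → 2 * c * ‖fr.b fr.i₀‖ ≤ fr.sgn * ⟪fr.v s, ζ⟫

/-- In the basis `v` the coordinates of `A x` are the frame coordinates of `x`, so distances to `ζ`
can be compared coordinate by coordinate; the kernel direction does not enter. -/
theorem norm_sub_le_of_abs_le {ζ : F} {x y : E}
    (h : ∀ s, |⟪fr.v s, ζ⟫ - ⟪fr.b (some s), x⟫| ≤ |⟪fr.v s, ζ⟫ - ⟪fr.b (some s), y⟫|) :
    ‖ζ - A x‖ ≤ ‖ζ - A y‖ := by
  refine (sq_le_sq₀ (norm_nonneg _) (norm_nonneg _)).1 ?_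
  rw [← fr.v.sum_sq_inner_right, ← fr.v.sum_sq_inner_right]
  refine Finset.sum_le_sum fun s _ => ?_
  rw [inner_sub_right, inner_sub_right, ← fr.inner_b, ← fr.inner_b]
  exact sq_le_sq.2 (h s)

theorem norm_f : ‖fr.f‖ = 1 := by
  have h := fr.sgn_sq
  have h2 : |fr.sgn| = 1 := by
    rw [← sq_eq_sq₀ (abs_nonneg _) zero_le_one, sq_abs, h]; norm_num
  rw [fr.f_eq, norm_smul, Real.norm_eq_abs, abs_div, h2, abs_norm, one_div,
    inv_mul_cancel₀ fr.norm_b.ne']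

theorem inner_b_f_of_ne {i : Option (Fin l)} (h : i ≠ fr.i₀) : ⟪fr.b i, fr.f⟫ = 0 := by
  rw [fr.f_eq, real_inner_smul_right, fr.orth _ _ h, mul_zero]

theorem inner_b_f : ⟪fr.b fr.i₀, fr.f⟫ = fr.sgn * ‖fr.b fr.i₀‖ := by
  have := fr.norm_b
  rw [fr.f_eq, real_inner_smul_right, real_inner_self_eq_norm_sq]
  field_simp

theorem α_mul_inner_b_f (i : Option (Fin l)) : 0 ≤ fr.α i * ⟪fr.b i, fr.f⟫ := by
  rcases eq_or_ne i fr.i₀ with rfl | h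
  · rw [inner_b_f, fr.α_eq]
    have : fr.sgn * |fr.α fr.i₀| * (fr.sgn * ‖fr.b fr.i₀‖) =
      fr.sgn ^ 2 * (|fr.α fr.i₀| * ‖fr.b fr.i₀‖) := by ring
    rw [this]; positivity
  · rw [fr.inner_b_f_of_ne h, mul_zero]

theorem sgn_mul_nonneg {x : ℝ} (h : 0 ≤ fr.α fr.i₀ * x) : 0 ≤ fr.sgn * x := by
  have h1 : 0 < |fr.α fr.i₀| := abs_pos.2 fr.α_ne
  rw [fr.α_eq, mul_right_comm] at h
  exact nonneg_of_mul_nonneg_left h h1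

theorem sgn_mul_inner_b (x : E) : fr.sgn * ⟪fr.b fr.i₀, x⟫ = ‖fr.b fr.i₀‖ * ⟪fr.f, x⟫ := by
  have := fr.norm_b
  rw [fr.f_eq, real_inner_smul_left]; field_simp

theorem inner_f_nonneg {x : E} (hx : x ∈ fr.orthant) : 0 ≤ ⟪fr.f, x⟫ := by
  have h1 := fr.sgn_mul_nonneg (hx fr.i₀)
  rw [sgn_mul_inner_b] at h1
  exact nonneg_of_mul_nonneg_right h1 fr.norm_b

variable [MeasurableSpace E] [BorelSpace E]

theorem measurableSet_orthant : MeasurableSet fr.orthant := by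
  have : fr.orthant = ⋂ i, {x : E | 0 ≤ fr.α i * ⟪fr.b i, x⟫} := by ext; simp [orthant]
  rw [this]
  exact MeasurableSet.iInter fun i => measurableSet_le measurable_const (by fun_prop)

variable [FiniteDimensional ℝ E]

/-- The comparison for the whole space; it bounds below the probability that the feature behind a
response produces a target with the right signs. -/
theorem one_le_mul_orthant_far {c : ℝ} (hc : 0 ≤ c) (hc1 : c ≤ 1) :
    1 ≤ ENNReal.ofReal (2 ^ (l + 1) * 6) * stdGaussian E (fr.orthant ∩ {x | c ≤ ⟪fr.f, x⟫}) := by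
  have := stdGaussian_le_mul_orthant_far fr.b fr.orth fr.α (C := Set.univ) MeasurableSet.univ
    (fun _ _ _ _ => Set.mem_univ _) fr.norm_f fr.α_mul_inner_b_f hc hc1
    (fun x hx => fr.inner_f_nonneg hx) (fun _ _ _ _ => Set.mem_univ _)
  simpa [orthant] using this

/-- The set is described by an upper bound on the distance from `A x` to `ζ`, since `P` is antitone.
Giving a coordinate of `x` the sign of the corresponding coordinate of `ζ` can only reduce this
distance. If the component along `f` is at most `c`, adding `c` brings it to at most `2 c`, which
does not overshoot the coordinate of a target. Both stability hypotheses of the orthant comparison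
therefore hold, with constants that depend on `l` only. -/
theorem stdGaussian_le_mul_far {c : ℝ} (hc : 0 ≤ c) (hc1 : c ≤ 1) {ζ : F}
    (hζ : fr.IsTarget c ζ) {P : ℝ → Prop} (hP : Antitone P)
    (hm : MeasurableSet {x : E | P ‖ζ - A x‖}) :
    stdGaussian E {x | P ‖ζ - A x‖} ≤ ENNReal.ofReal (2 ^ (l + 1) * 6) *
      stdGaussian E ({x | P ‖ζ - A x‖} ∩ {x | c ≤ √(l + 1) * ⟪u, x⟫}) := by
  have key := stdGaussian_le_mul_orthant_far fr.b fr.orth fr.α hm ?_ fr.norm_f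
    fr.α_mul_inner_b_f hc hc1 (fun x hx => fr.inner_f_nonneg hx) ?_
  · refine key.trans ?_
    simp only [Fintype.card_option, Fintype.card_fin]
    refine mul_le_mul_right (measure_mono ?_) _
    rintro x ⟨⟨hx1, hx2⟩, hx3⟩
    have hx3 : c ≤ ⟪fr.f, x⟫ := hx3
    exact ⟨hx1, hx3.trans (fr.le_inner_u x hx2)⟩
  · intro i x hx hneg
    refine hP (fr.norm_sub_le_of_abs_le fun s => ?_) hx
    rcases eq_or_ne (some s) i with rfl | hsi
    · rw [inner_householder_self]
      refine sq_le_sq.1 ?_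
      have h1 := hζ.1 s
      have h2 : ⟪fr.v s, ζ⟫ * ⟪fr.b (some s), x⟫ ≤ 0 := by
        rcases lt_trichotomy (fr.α (some s)) 0 with h | h | h
        · have e1 := nonpos_of_mul_nonneg_right h1 h
          have e2 := pos_of_mul_neg_right hneg h.le
          nlinarith
        · rw [h, zero_mul] at hneg; exact absurd hneg (lt_irrefl _)
        · have e1 := nonneg_of_mul_nonneg_right h1 h
          have e2 := neg_of_mul_neg_right hneg h.le
          nlinarith
      nlinarith
    · rw [inner_householder_of_inner_eq_zero (fr.orth _ _ hsi)]
  · intro x hx hO hxc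
    refine hP (fr.norm_sub_le_of_abs_le fun s => ?_) hx
    rw [inner_add_right, real_inner_smul_right]
    rcases eq_or_ne (some s) fr.i₀ with hsi | hsi
    · have h1 := hζ.2 s hsi.symm
      rw [hsi, fr.inner_b_f]
      have h2 := fr.sgn_mul_inner_b x
      have h0 := fr.inner_f_nonneg hO
      have hs := fr.sgn_sq
      have hbp := fr.norm_b
      refine sq_le_sq.1 ?_
      set z := ⟪fr.v s, ζ⟫
      set y := ⟪fr.b fr.i₀, x⟫
      set B := ‖fr.b fr.i₀‖
      have e1 : (z - (y + c * (fr.sgn * B))) ^ 2 = (fr.sgn * z - fr.sgn * y - c * B) ^ 2 := by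
        linear_combination (-(z - y) ^ 2 + c ^ 2 * B ^ 2) * hs
      have e2 : (z - y) ^ 2 = (fr.sgn * z - fr.sgn * y) ^ 2 := by
        linear_combination (-(z - y) ^ 2) * hs
      rw [e1, e2]
      have h3 : fr.sgn * y ≤ c * B := by rw [h2]; nlinarith
      have h4 : c * B ≤ fr.sgn * z - fr.sgn * y := by linarith
      have h5 : 0 ≤ c * B := by positivity
      nlinarith
    · rw [fr.inner_b_f_of_ne hsi, mul_zero, add_zero]

end AdaptedFrame

end Frame

theorem finite_quadratic_roots {a : ℝ} (ha : a ≠ 0) (b c : ℝ) :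
    {s : ℝ | a * s ^ 2 + b * s + c = 0}.Finite := by
  rcases {s : ℝ | a * s ^ 2 + b * s + c = 0}.eq_empty_or_nonempty with h | ⟨s₀, h₀⟩
  · rw [h]; exact Set.finite_empty
  · refine (Set.toFinite {s₀, -b / a - s₀}).subset fun s hs => ?_
    have hs : a * s ^ 2 + b * s + c = 0 := hs
    have h₀ : a * s₀ ^ 2 + b * s₀ + c = 0 := h₀
    have h : (s - s₀) * (a * (s + s₀) + b) = 0 := by linear_combination hs - h₀
    rcases mul_eq_zero.1 h with h | h
    · left; linarith
    · right
      have : s = -b / a - s₀ := by field_simp; linarith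
      exact this

section Nearest

variable {E F : Type*}
  [NormedAddCommGroup E] [InnerProductSpace ℝ E] [FiniteDimensional ℝ E] [MeasurableSpace E]
  [BorelSpace E]
  [NormedAddCommGroup F] [InnerProductSpace ℝ F]

/-- On a line whose direction is not in the kernel of `A`, the squared distance is a polynomial of
degree exactly two and takes a value at most twice. Hence ties between neighbours are negligible
when `A ≠ 0`. -/
theorem stdGaussian_norm_sub_eq {A : E →L[ℝ] F} (hA : A ≠ 0) (ζ : F) (ρ : ℝ) :
    stdGaussian E {x | ‖ζ - A x‖ = ρ} = 0 := by
  obtain ⟨h, hh⟩ : ∃ h, A h ≠ 0 := by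
    by_contra! H; exact hA (ContinuousLinearMap.ext H)
  have hne : h ≠ 0 := fun h0 => hh (by rw [h0, map_zero])
  have hn : ‖h‖ ≠ 0 := norm_ne_zero_iff.2 hne
  have hf : ‖‖h‖⁻¹ • h‖ = 1 := by rw [norm_smul]; simp [hn]
  refine stdGaussian_eq_zero_of_lines hf
    (measurableSet_eq_fun (Continuous.measurable (by fun_prop)) measurable_const) fun x => Set.Finite.countable ?_
  have hAf : ‖A (‖h‖⁻¹ • h)‖ ^ 2 ≠ 0 := by
    rw [map_smul, norm_smul]
    simp [hn, hh]
  refine (finite_quadratic_roots hAf (-2 * ⟪ζ - A x, A (‖h‖⁻¹ • h)⟫)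
    (‖ζ - A x‖ ^ 2 - ρ ^ 2)).subset fun s hs => ?_
  have hs : ‖ζ - A (x + s • ‖h‖⁻¹ • h)‖ = ρ := hs
  rw [map_add, map_smul, ← sub_sub] at hs
  have h2 := norm_sub_sq_real (ζ - A x) (s • A (‖h‖⁻¹ • h))
  rw [hs, norm_smul, real_inner_smul_right, mul_pow, Real.norm_eq_abs, sq_abs] at h2
  simp only [Set.mem_ofPred_eq]
  linarith

/-- Up to ties, the space is the disjoint union of the events that a given point is the strict
nearest neighbour. With the other points frozen, such an event is an upper bound on the distance of
that point to the target, so a fixed share of it is favourable. The point `k` is left out because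
the target will be built from it. -/
theorem one_le_mul_pi_nearest [SecondCountableTopology F] [MeasurableSpace F] [BorelSpace F]
    {A : E →L[ℝ] F} (hA : A ≠ 0) {u : E} {l : ℕ}
    (fr : AdaptedFrame A u l) {c : ℝ} (hc : 0 ≤ c) (hc1 : c ≤ 1) {ζ : F} (hζ : fr.IsTarget c ζ)
    {ι : Type*} [Fintype ι] [DecidableEq ι] (k : ι) (hk : ∃ κ, κ ≠ k) :
    1 ≤ ENNReal.ofReal (2 ^ (l + 1) * 6) *
      Measure.pi (fun _ : ι => stdGaussian E) {N | ∀ κ ≠ k,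
        (∀ κ' ≠ k, ‖ζ - A (N κ)‖ ≤ ‖ζ - A (N κ')‖) → c ≤ √(l + 1) * ⟪u, N κ⟫} := by
  set μ := Measure.pi (fun _ : ι => stdGaussian E) with hμ
  set T := {N : ι → E | ∀ κ ≠ k,
        (∀ κ' ≠ k, ‖ζ - A (N κ)‖ ≤ ‖ζ - A (N κ')‖) → c ≤ √(l + 1) * ⟪u, N κ⟫} with hT
  have hmn : ∀ κ : ι, Measurable fun N : ι → E => ‖ζ - A (N κ)‖ := fun κ => by fun_prop
  let U : ι → Set (ι → E) := fun κ =>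
    {N | ∀ κ', κ' ≠ k → κ' ≠ κ → ‖ζ - A (N κ)‖ < ‖ζ - A (N κ')‖}
  let G : ι → Set (ι → E) := fun κ => {N | c ≤ √(l + 1) * ⟪u, N κ⟫}
  have hUm : ∀ κ, MeasurableSet (U κ) := by
    intro κ
    have : U κ = ⋂ κ', ⋂ (_ : κ' ≠ k), ⋂ (_ : κ' ≠ κ),
        {N : ι → E | ‖ζ - A (N κ)‖ < ‖ζ - A (N κ')‖} := by ext; simp [U]
    rw [this]
    exact MeasurableSet.iInter fun κ' => MeasurableSet.iInter fun _ => MeasurableSet.iInter fun _ =>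
      measurableSet_lt (hmn κ) (hmn κ')
  have hGm : ∀ κ, MeasurableSet (G κ) := fun κ =>
    measurableSet_le measurable_const (by fun_prop)
  -- each strict nearest neighbour is favourable with a fixed proportion
  have h1 : ∀ κ, κ ≠ k → μ (U κ) ≤ ENNReal.ofReal (2 ^ (l + 1) * 6) * μ (U κ ∩ G κ) := by
    intro κ _
    rw [hμ, pi_apply_eq_lintegral_update _ κ (hUm κ),
      pi_apply_eq_lintegral_update _ κ ((hUm κ).inter (hGm κ)),
      ← lintegral_const_mul' _ _ ENNReal.ofReal_ne_top]
    refine lintegral_mono fun N => ?_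
    have hU : ∀ y : E, Function.update N κ y ∈ U κ ↔
        ∀ κ', κ' ≠ k → κ' ≠ κ → ‖ζ - A y‖ < ‖ζ - A (N κ')‖ := by
      intro y
      simp only [U, Set.mem_ofPred_eq, Function.update_self]
      refine forall_congr' fun κ' => forall_congr' fun _ => forall_congr' fun h => ?_
      rw [Function.update_of_ne h]
    have hm : MeasurableSet {y : E | ∀ κ', κ' ≠ k → κ' ≠ κ → ‖ζ - A y‖ < ‖ζ - A (N κ')‖} := by
      have : {y : E | ∀ κ', κ' ≠ k → κ' ≠ κ → ‖ζ - A y‖ < ‖ζ - A (N κ')‖} =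
          ⋂ κ', ⋂ (_ : κ' ≠ k), ⋂ (_ : κ' ≠ κ), {y : E | ‖ζ - A y‖ < ‖ζ - A (N κ')‖} := by
        ext; simp
      rw [this]
      exact MeasurableSet.iInter fun κ' => MeasurableSet.iInter fun _ =>
        MeasurableSet.iInter fun _ => measurableSet_lt (by fun_prop) measurable_const
    have key := fr.stdGaussian_le_mul_far hc hc1 hζ
      (P := fun r => ∀ κ', κ' ≠ k → κ' ≠ κ → r < ‖ζ - A (N κ')‖)
      (fun r r' hr h κ' h1 h2 => lt_of_le_of_lt hr (h κ' h1 h2)) hm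
    have e1 : {y : E | Function.update N κ y ∈ U κ} =
        {y : E | ∀ κ', κ' ≠ k → κ' ≠ κ → ‖ζ - A y‖ < ‖ζ - A (N κ')‖} := Set.ext hU
    have e2 : {y : E | Function.update N κ y ∈ U κ ∩ G κ} =
        {y : E | ∀ κ', κ' ≠ k → κ' ≠ κ → ‖ζ - A y‖ < ‖ζ - A (N κ')‖} ∩
          {x | c ≤ √(l + 1) * ⟪u, x⟫} := by
      rw [← e1]; ext y; simp [G]
    rw [e1, e2]
    exact key
  -- ties are negligible
  have hties : ∀ κ κ', κ ≠ κ' → μ {N | ‖ζ - A (N κ)‖ = ‖ζ - A (N κ')‖} = 0 := by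
    intro κ κ' hne
    rw [hμ, pi_apply_eq_lintegral_update _ κ (measurableSet_eq_fun (hmn κ) (hmn κ'))]
    simp only [Set.mem_ofPred_eq, Function.update_self, Function.update_of_ne hne.symm,
      stdGaussian_norm_sub_eq hA, lintegral_zero]
  have hcover : (Set.univ : Set (ι → E)) ⊆ (⋃ κ ∈ Finset.univ.filter (· ≠ k), U κ) ∪
      ⋃ κ, ⋃ κ', ⋃ (_ : κ ≠ κ'), {N | ‖ζ - A (N κ)‖ = ‖ζ - A (N κ')‖} := by
    intro N _
    obtain ⟨κ₁, hκ₁⟩ := hk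
    obtain ⟨κ, hκ, hmin⟩ := Finset.exists_min_image (Finset.univ.filter (· ≠ k))
      (fun κ => ‖ζ - A (N κ)‖) ⟨κ₁, by simpa using hκ₁⟩
    by_cases hU : N ∈ U κ
    · exact Or.inl (Set.mem_biUnion (by exact hκ) hU)
    · right
      simp only [U, Set.mem_ofPred_eq] at hU
      push Not at hU
      obtain ⟨κ', h1, h2, h3⟩ := hU
      have h4 := hmin κ' (by simpa using h1)
      simp only [Set.mem_iUnion]
      exact ⟨κ, κ', h2.symm, le_antisymm h4 h3⟩
  have htot : 1 ≤ ∑ κ ∈ Finset.univ.filter (· ≠ k), μ (U κ) := by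
    calc (1 : ℝ≥0∞) = μ Set.univ := measure_univ.symm
      _ ≤ _ := (measure_mono hcover).trans (measure_union_le _ _)
      _ ≤ ∑ κ ∈ Finset.univ.filter (· ≠ k), μ (U κ) + 0 := by
          gcongr
          · exact measure_biUnion_finset_le _ _
          · refine le_of_eq ?_
            simp only [measure_iUnion_null_iff]
            exact hties
      _ = _ := add_zero _
  have hdisj : Set.PairwiseDisjoint (↑(Finset.univ.filter (· ≠ k))) fun κ => U κ ∩ G κ := by
    intro κ hκ κ' hκ' hne
    refine Set.disjoint_left.2 fun N hN hN' => ?_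
    have e1 := hN.1 κ' (by simpa using hκ') hne.symm
    have e2 := hN'.1 κ (by simpa using hκ) hne
    exact lt_asymm e1 e2
  have hsub : (⋃ κ ∈ Finset.univ.filter (· ≠ k), U κ ∩ G κ) ⊆ T := by
    intro N hN
    simp only [Set.mem_iUnion] at hN
    obtain ⟨κ, hκ, hNU, hNG⟩ := hN
    intro κ' hκ' hmin
    by_cases h : κ' = κ
    · rw [h]; exact hNG
    · have e1 := hNU κ' hκ' h
      have e2 := hmin κ (by simpa using hκ)
      exact absurd e1 (not_lt.2 e2)
  calc (1 : ℝ≥0∞) ≤ ∑ κ ∈ Finset.univ.filter (· ≠ k), μ (U κ) := htot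
    _ ≤ ∑ κ ∈ Finset.univ.filter (· ≠ k),
        ENNReal.ofReal (2 ^ (l + 1) * 6) * μ (U κ ∩ G κ) :=
        Finset.sum_le_sum fun κ hκ => h1 κ (by simpa using hκ)
    _ = ENNReal.ofReal (2 ^ (l + 1) * 6) *
        μ (⋃ κ ∈ Finset.univ.filter (· ≠ k), U κ ∩ G κ) := by
        rw [measure_biUnion_finset hdisj fun κ _ => (hUm κ).inter (hGm κ), Finset.mul_sum]
    _ ≤ _ := by gcongr

/-- With probability bounded below, all the nearest neighbours of a noisy linear image of one of
several Gaussian vectors have a large component in a prescribed direction. -/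
theorem one_le_mul_nearest_neighbour [FiniteDimensional ℝ F] [MeasurableSpace F] [BorelSpace F]
    {A : E →L[ℝ] F} (hA : A ≠ 0) {u : E} (hu : ‖u‖ = 1) {l : ℕ} (hl : Module.finrank ℝ F = l)
    {σ : ℝ} (hσ : 0 ≤ σ) {ι : Type*} [Fintype ι] [DecidableEq ι] (k : ι) (hk : ∃ κ, κ ≠ k) :
    1 ≤ ENNReal.ofReal ((2 ^ (l + 1) * 6) ^ 3) *
      ((Measure.pi fun _ : ι => stdGaussian E).prod (stdGaussian F)) {p | ∀ κ,
        (∀ κ', ‖A (p.1 k) + σ • p.2 - A (p.1 κ)‖ ≤ ‖A (p.1 k) + σ • p.2 - A (p.1 κ')‖) →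
          1 / 2 ≤ √(l + 1) * ⟪u, p.1 κ⟫} := by
  obtain ⟨fr⟩ := exists_adaptedFrame A hu hl
  set K : ℝ := 2 ^ (l + 1) * 6 with hK
  have hK0 : 0 < K := by positivity
  set μ := Measure.pi (fun _ : ι => stdGaussian E) with hμ
  -- With the signs of both the feature and the noise equal to those of `u`, so are the signs of the
  -- target; the component at least 1 along `f` supplies the margin `2 c` for `c = 1/2`.
  let W₁ : Set E := fr.orthant ∩ {x | 1 ≤ ⟪fr.f, x⟫}
  let W₂ : Set F := {y | ∀ s, 0 ≤ fr.α (some s) * ⟪fr.v s, y⟫}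
  have hW₁m : MeasurableSet W₁ :=
    fr.measurableSet_orthant.inter (measurableSet_le measurable_const (by fun_prop))
  have hW₂m : MeasurableSet W₂ := by
    have : W₂ = ⋂ s, {y : F | 0 ≤ fr.α (some s) * ⟪fr.v s, y⟫} := by ext; simp [W₂]
    rw [this]
    exact MeasurableSet.iInter fun i => measurableSet_le measurable_const (by fun_prop)
  have hW₁ : 1 ≤ ENNReal.ofReal K * stdGaussian E W₁ := fr.one_le_mul_orthant_far zero_le_one le_rfl
  have hW₂ : 1 ≤ ENNReal.ofReal K * stdGaussian F W₂ := by
    have h1 := stdGaussian_le_two_pow_mul_orthant (E := F) (fun s => fr.v s)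
      (fun i j h => fr.v.orthonormal.2 h) (fun s => fr.α (some s)) (C := Set.univ) MeasurableSet.univ
      (fun _ _ _ _ => Set.mem_univ _)
    simp only [measure_univ, Fintype.card_fin, Set.univ_inter] at h1
    refine h1.trans ?_
    gcongr
    · rw [hK, ← ENNReal.ofReal_ofNat, ← ENNReal.ofReal_pow (by norm_num)]
      refine ENNReal.ofReal_le_ofReal ?_
      have : (0 : ℝ) < 2 ^ l := by positivity
      rw [pow_succ]; linarith
  have htarget : ∀ x ∈ W₁, ∀ y ∈ W₂, fr.IsTarget (1 / 2) (A x + σ • y) := by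
    rintro x ⟨hx, hx1⟩ y hy
    have hx1 : 1 ≤ ⟪fr.f, x⟫ := hx1
    refine ⟨fun s => ?_, fun s hs => ?_⟩
    · rw [inner_add_right, real_inner_smul_right, ← fr.inner_b]
      have e1 := hx (some s)
      have e2 := mul_nonneg hσ (hy s)
      linarith
    · rw [inner_add_right, real_inner_smul_right, ← fr.inner_b, ← hs, mul_add, fr.sgn_mul_inner_b]
      have e1 : 0 ≤ fr.sgn * ⟪fr.v s, y⟫ := fr.sgn_mul_nonneg (by rw [hs]; exact hy s)
      have e2 := mul_nonneg hσ e1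
      have e3 := fr.norm_b
      nlinarith
  let T : E × F → Set (ι → E) := fun q => {N | ∀ κ ≠ k,
        (∀ κ' ≠ k, ‖A q.1 + σ • q.2 - A (N κ)‖ ≤ ‖A q.1 + σ • q.2 - A (N κ')‖) →
          1 / 2 ≤ √(l + 1) * ⟪u, N κ⟫}
  let D : Set ((ι → E) × F) := {p | ∀ κ,
        (∀ κ', ‖A (p.1 k) + σ • p.2 - A (p.1 κ)‖ ≤ ‖A (p.1 k) + σ • p.2 - A (p.1 κ')‖) →
          1 / 2 ≤ √(l + 1) * ⟪u, p.1 κ⟫}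
  have hDm : MeasurableSet D := by
    have : D = ⋂ κ, ((⋂ κ', {p : (ι → E) × F |
        ‖A (p.1 k) + σ • p.2 - A (p.1 κ)‖ ≤ ‖A (p.1 k) + σ • p.2 - A (p.1 κ')‖})ᶜ ∪
        {p | 1 / 2 ≤ √(l + 1) * ⟪u, p.1 κ⟫}) := by
      ext p; simp only [D, Set.mem_iInter, Set.mem_union, Set.mem_compl_iff, Set.mem_ofPred_eq,
        imp_iff_not_or]
    rw [this]
    refine MeasurableSet.iInter fun κ => MeasurableSet.union (MeasurableSet.compl
      (MeasurableSet.iInter fun κ' => measurableSet_le (by fun_prop) (by fun_prop)))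
      (measurableSet_le measurable_const (by fun_prop))
  have hpres : MeasurePreserving
      (fun p : (ι → E) × (E × F) => (Function.update p.1 k p.2.1, p.2.2))
      (μ.prod ((stdGaussian E).prod (stdGaussian F))) (μ.prod (stdGaussian F)) := by
    have h1 := (measurePreserving_pi_update (fun _ : ι => stdGaussian E) k).prod
      (MeasurePreserving.id (stdGaussian F))
    exact h1.comp ((measurePreserving_prodAssoc μ (stdGaussian E) (stdGaussian F)).symm _)
  have hsub : ∀ q ∈ W₁ ×ˢ W₂, T q ⊆ {N | (Function.update N k q.1, q.2) ∈ D} := by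
    rintro ⟨x, y⟩ ⟨hx, hy⟩ N hN κ hmin
    simp only [Function.update_self] at hmin ⊢
    -- The nearest neighbour may be the feature of the response itself; it lies in `W₁`, hence
    -- qualifies without any selection argument.
    by_cases hκ : κ = k
    · subst hκ
      rw [Function.update_self]
      have e1 := fr.le_inner_u x hx.1
      have e2 : 1 ≤ ⟪fr.f, x⟫ := hx.2
      linarith
    · rw [Function.update_of_ne hκ]
      refine hN κ hκ fun κ' hκ' => ?_
      have := hmin κ'
      rwa [Function.update_of_ne hκ, Function.update_of_ne hκ'] at this
  change 1 ≤ ENNReal.ofReal (K ^ 3) * (μ.prod (stdGaussian F)) D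
  rw [← hpres.measure_preimage hDm.nullMeasurableSet, Measure.prod_apply_symm (hpres.measurable hDm)]
  have hWm : MeasurableSet (W₁ ×ˢ W₂) := hW₁m.prod hW₂m
  have h3 : ((stdGaussian E).prod (stdGaussian F)) (W₁ ×ˢ W₂) ≤ ENNReal.ofReal K *
      ∫⁻ q, μ ((fun N => (N, q)) ⁻¹' ((fun p : (ι → E) × (E × F) =>
        (Function.update p.1 k p.2.1, p.2.2)) ⁻¹' D)) ∂((stdGaussian E).prod (stdGaussian F)) := by
    rw [← lintegral_indicator_one hWm, ← lintegral_const_mul' _ _ ENNReal.ofReal_ne_top]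
    refine lintegral_mono fun q => ?_
    by_cases hq : q ∈ W₁ ×ˢ W₂
    · rw [Set.indicator_of_mem hq, Pi.one_apply]
      refine (one_le_mul_pi_nearest hA fr (by norm_num) (by norm_num)
        (htarget q.1 hq.1 q.2 hq.2) k hk).trans ?_
      exact mul_le_mul_right (measure_mono (hsub q hq)) _
    · rw [Set.indicator_of_notMem hq]; exact zero_le
  calc (1 : ℝ≥0∞) = 1 * 1 := (mul_one 1).symm
    _ ≤ (ENNReal.ofReal K * stdGaussian E W₁) * (ENNReal.ofReal K * stdGaussian F W₂) := by
        gcongr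
    _ = ENNReal.ofReal K * ENNReal.ofReal K *
          ((stdGaussian E).prod (stdGaussian F)) (W₁ ×ˢ W₂) := by
        rw [Measure.prod_prod]; ring
    _ ≤ _ := by
        refine (mul_le_mul_right h3 _).trans (le_of_eq ?_)
        rw [← mul_assoc, ENNReal.ofReal_pow hK0.le]; congr 1; ring

end Nearest

/-! ### Second moments -/

section Moments

variable {E F : Type*}
  [NormedAddCommGroup E] [InnerProductSpace ℝ E] [FiniteDimensional ℝ E] [MeasurableSpace E]
  [BorelSpace E]
  [NormedAddCommGroup F] [InnerProductSpace ℝ F] [FiniteDimensional ℝ F]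
  {ι : Type*} [Fintype ι]

theorem lintegral_sq_inner_sum_smul (w : E) (β : ι → ℝ) :
    ∫⁻ N, ENNReal.ofReal (⟪w, ∑ κ, β κ • N κ⟫ ^ 2) ∂(Measure.pi fun _ : ι => stdGaussian E) =
      ENNReal.ofReal (‖w‖ ^ 2 * ∑ κ, β κ ^ 2) := by
  have hLp : ∀ κ, MemLp (fun x : E => β κ * ⟪w, x⟫) 2 (stdGaussian E) := fun κ => by
    have h : MemLp (fun x : E => innerSL ℝ w x) 2 (stdGaussian E) :=
      IsGaussian.memLp_dual (stdGaussian E) (innerSL ℝ w) 2 (by norm_num)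
    simpa using h.const_mul (β κ)
  have hvar : ∀ κ, Var[fun x : E => β κ * ⟪w, x⟫; stdGaussian E] = β κ ^ 2 * ‖w‖ ^ 2 := fun κ => by
    rw [variance_const_mul]
    congr 1
    have := variance_dual_stdGaussian (innerSL ℝ w : StrongDual ℝ E)
    rw [innerSL_apply_norm] at this
    exact this
  have hmean : ∀ κ, ∫ x : E, β κ * ⟪w, x⟫ ∂(stdGaussian E) = 0 := fun κ => by
    rw [integral_const_mul]
    have := integral_strongDual_stdGaussian (innerSL ℝ w : StrongDual ℝ E)
    simp only [innerSL_apply_apply] at this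
    rw [this, mul_zero]
  have hev : ∀ κ, MemLp (fun N : ι → E => β κ * ⟪w, N κ⟫) 2
      (Measure.pi fun _ : ι => stdGaussian E) := fun κ =>
    (hLp κ).comp_measurePreserving (measurePreserving_eval (fun _ : ι => stdGaussian E) κ)
  have hsum := variance_sum_pi (μ := fun _ : ι => stdGaussian E)
    (X := fun κ (x : E) => β κ * ⟪w, x⟫) hLp
  simp only [hvar] at hsum
  have hfun : (∑ κ, fun N : ι → E => β κ * ⟪w, N κ⟫) = fun N => ⟪w, ∑ κ, β κ • N κ⟫ := by
    ext N; simp [inner_sum, real_inner_smul_right]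
  have hmem : MemLp (fun N : ι → E => ⟪w, ∑ κ, β κ • N κ⟫) 2
      (Measure.pi fun _ : ι => stdGaussian E) := by
    rw [← hfun]; exact memLp_finsetSum' _ fun κ _ => hev κ
  have hzero : ∫ N, ⟪w, ∑ κ, β κ • N κ⟫ ∂(Measure.pi fun _ : ι => stdGaussian E) = 0 := by
    have hfun' : (fun N : ι → E => ⟪w, ∑ κ, β κ • N κ⟫) = fun N => ∑ κ, β κ * ⟪w, N κ⟫ := by
      ext N; simp [inner_sum, real_inner_smul_right]
    rw [hfun']
    rw [integral_finsetSum _ fun κ _ => (hev κ).integrable (by norm_num)]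
    refine Finset.sum_eq_zero fun κ _ => ?_
    rw [integral_comp_eval (μ := fun _ : ι => stdGaussian E) (f := fun x : E => β κ * ⟪w, x⟫)
      (hLp κ).aestronglyMeasurable]
    exact hmean κ
  rw [← ofReal_integral_eq_lintegral_ofReal hmem.integrable_sq
    (Filter.Eventually.of_forall fun _ => sq_nonneg _)]
  rw [hfun, variance_of_integral_eq_zero hmem.aemeasurable hzero] at hsum
  rw [hsum, ← Finset.sum_mul, mul_comm]

/-- Chebyshev's inequality for a linear image of a combination of Gaussian vectors. -/
theorem pi_le_norm_map_sum_smul (L : E →L[ℝ] F) (β : ι → ℝ) {r : ℝ} (hr : 0 < r) :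
    (Measure.pi fun _ : ι => stdGaussian E) {N | r ≤ ‖L (∑ κ, β κ • N κ)‖} ≤
      ENNReal.ofReal (Module.finrank ℝ F * ‖L‖ ^ 2 * (∑ κ, β κ ^ 2) / r ^ 2) := by
  set v := stdOrthonormalBasis ℝ F
  have hnorm : ∀ x : E, ENNReal.ofReal (‖L x‖ ^ 2) =
      ∑ s, ENNReal.ofReal (⟪L.adjoint (v s), x⟫ ^ 2) := fun x => by
    rw [← ENNReal.ofReal_sum_of_nonneg fun _ _ => sq_nonneg _, ← v.sum_sq_inner_right]
    simp only [ContinuousLinearMap.adjoint_inner_left]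
  have hr2 : ENNReal.ofReal (r ^ 2) ≠ 0 := by
    rw [Ne, ENNReal.ofReal_eq_zero, not_le]; positivity
  have h1 : (Measure.pi fun _ : ι => stdGaussian E) {N | r ≤ ‖L (∑ κ, β κ • N κ)‖} ≤
      (Measure.pi fun _ : ι => stdGaussian E)
        {N | ENNReal.ofReal (r ^ 2) ≤ ENNReal.ofReal (‖L (∑ κ, β κ • N κ)‖ ^ 2)} := by
    refine measure_mono fun N hN => ENNReal.ofReal_le_ofReal ?_
    have hN : r ≤ ‖L (∑ κ, β κ • N κ)‖ := hN
    gcongr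
  refine h1.trans ((meas_ge_le_lintegral_div (Measurable.aemeasurable ?_) hr2
    ENNReal.ofReal_ne_top).trans ?_)
  · have : Measurable fun N : ι → E => ‖L (∑ κ, β κ • N κ)‖ := Continuous.measurable (by fun_prop)
    fun_prop
  · rw [ENNReal.ofReal_div_of_pos (by positivity)]
    refine ENNReal.div_le_div_right ?_ _
    simp only [hnorm]
    rw [lintegral_finsetSum _ fun s _ => by fun_prop]
    simp only [lintegral_sq_inner_sum_smul]
    rw [← ENNReal.ofReal_sum_of_nonneg fun _ _ => by positivity]
    refine ENNReal.ofReal_le_ofReal ?_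
    rw [← Finset.sum_mul]
    refine mul_le_mul_of_nonneg_right ?_ (by positivity)
    calc ∑ s, ‖L.adjoint (v s)‖ ^ 2 ≤ ∑ _s : Fin (Module.finrank ℝ F), ‖L‖ ^ 2 := by
          refine Finset.sum_le_sum fun s _ => ?_
          have h2 := L.adjoint.le_opNorm (v s)
          rw [v.orthonormal.1 s, mul_one, LinearIsometryEquiv.norm_map] at h2
          gcongr
      _ = _ := by simp

end Moments

/-! ### Groups with a prescribed mean -/

theorem measurableSet_forall_minimizer {Ω ι : Type*} [MeasurableSpace Ω] [Finite ι]
    {r : ι → Ω → ℝ} (hr : ∀ κ, Measurable (r κ)) {P : ι → Set Ω} (hP : ∀ κ, MeasurableSet (P κ)) :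
    MeasurableSet {ω | ∀ κ, (∀ κ', r κ ω ≤ r κ' ω) → ω ∈ P κ} := by
  have : {ω | ∀ κ, (∀ κ', r κ ω ≤ r κ' ω) → ω ∈ P κ} =
      ⋂ κ, ((⋂ κ', {ω | r κ ω ≤ r κ' ω})ᶜ ∪ P κ) := by
    ext p; simp only [Set.mem_iInter, Set.mem_union, Set.mem_compl_iff, Set.mem_ofPred_eq,
      imp_iff_not_or]
  rw [this]
  exact MeasurableSet.iInter fun κ => (MeasurableSet.iInter fun κ' =>
    measurableSet_le (hr κ) (hr κ')).compl.union (hP κ)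

section Group

variable {E F : Type*} [NormedAddCommGroup E] [NormedSpace ℝ E] [NormedAddCommGroup F]
  [NormedSpace ℝ F] {ι : Type*} [Fintype ι]

/-- The `κ`-th of several points with mean `a` and deviations from the mean those of `σ N`. -/
noncomputable def groupPoint (a : E) (σ : ℝ) (N : ι → E) (κ : ι) : E :=
  a + σ • (N κ - (Fintype.card ι : ℝ)⁻¹ • ∑ κ', N κ')

@[fun_prop]
theorem continuous_groupPoint (a : E) (σ : ℝ) (κ : ι) :
    Continuous fun N : ι → E => groupPoint a σ N κ := by
  unfold groupPoint; fun_prop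

/-- The mean of the group occurs both in the response and in every candidate, so it cancels up to a
term in `A₀ - B₀`. This term, the mean noise and the contribution of the other noises are collected
in one shift `δ` of the `k`-th noise, whose own coefficient is `1 - 1/g` because it also enters the
average. The shift does not depend on the candidate `κ`, so the nearest neighbours are those of the
model with target `A₀ (N k)` plus shifted independent noise, up to the scaling. -/
theorem residual_decomposition {A₀ B₀ : E →L[ℝ] F} {σ₂ σₑ : ℝ} {a : E} {ē m : F}
    (hm : ē - (A₀ - B₀) a = m) [DecidableEq ι] (k κ : ι)
    (N : ι → E) (ν : ι → F) (y δ : F)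
    (hδ : (σₑ * (1 - (Fintype.card ι : ℝ)⁻¹)) • δ =
      m + σ₂ • (A₀ - B₀) ((Fintype.card ι : ℝ)⁻¹ • ∑ κ', N κ' - N k) -
        σₑ • (Fintype.card ι : ℝ)⁻¹ • ∑ κ' ∈ Finset.univ.erase k, ν κ') :
    B₀ (groupPoint a σ₂ N k) + groupPoint ē σₑ (Function.update ν k y) k
        - A₀ (groupPoint a σ₂ N κ) =
      (σ₂ • A₀) (N k) + (σₑ * (1 - (Fintype.card ι : ℝ)⁻¹)) • (y + δ) - (σ₂ • A₀) (N κ) := by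
  have hsum : ∑ κ', Function.update ν k y κ' = y + ∑ κ' ∈ Finset.univ.erase k, ν κ' := by
    rw [← Finset.add_sum_erase _ _ (Finset.mem_univ k), Function.update_self]
    congr 1
    exact Finset.sum_congr rfl fun κ' h => Function.update_of_ne (Finset.ne_of_mem_erase h) _ _
  rw [smul_add, hδ]
  simp only [groupPoint, hsum, Function.update_self, map_add, map_sub, map_smul, smul_apply,
    sub_apply, ← hm]
  module

end Group

section Core

variable {E F : Type*}
  [NormedAddCommGroup E] [InnerProductSpace ℝ E] [FiniteDimensional ℝ E] [MeasurableSpace E]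
  [BorelSpace E]
  [NormedAddCommGroup F] [InnerProductSpace ℝ F] [FiniteDimensional ℝ F] [MeasurableSpace F]
  [BorelSpace F]

/-- Reciprocal of the probability that the nearest neighbours have a large component. -/
def nnConst (l : ℕ) : ℝ := (2 ^ (l + 1) * 6) ^ 3

theorem one_le_nnConst (l : ℕ) : 1 ≤ nnConst l := by
  unfold nnConst
  have : (1 : ℝ) ≤ 2 ^ (l + 1) := one_le_pow₀ (by norm_num)
  exact one_le_pow₀ (by linarith)

/-- The probability of a favourable assignment. -/
noncomputable def assignProb (l : ℕ) : ℝ :=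
  Real.exp (-(8 * nnConst l * (l + 1) + 8)) / (2 * nnConst l)

theorem assignProb_pos (l : ℕ) : 0 < assignProb l := by
  have := one_le_nnConst l
  unfold assignProb; positivity

set_option maxHeartbeats 2000000 in
/-- Given the group means, the nearest neighbours of a response in its group have, with
probability bounded below, a component in the direction `u` which is at least that of the mean
of the group plus a multiple of the deviation. -/
theorem ofReal_assignProb_le {A₀ B₀ : E →L[ℝ] F} (hA₀ : A₀ ≠ 0) {u : E} (hu : ‖u‖ = 1) {l : ℕ}
    (hl : Module.finrank ℝ F = l) {σ₂ σₑ : ℝ} (hσ₂ : 0 ≤ σ₂) (hσₑ : 0 ≤ σₑ) {a : E} {ē : F}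
    (hm : ‖ē - (A₀ - B₀) a‖ ≤ σₑ) {ι : Type*} [Fintype ι] [DecidableEq ι]
    (hg : 160 * nnConst l * (l + 1) ≤ Fintype.card ι)
    (hΔ : σ₂ * ‖A₀ - B₀‖ ≤ 1 / (8 * nnConst l * (l + 1)) * σₑ) (k : ι) :
    ENNReal.ofReal (assignProb l) ≤
      ((Measure.pi fun _ : ι => stdGaussian E).prod (Measure.pi fun _ : ι => stdGaussian F))
        {p | ∀ κ, (∀ κ', ‖B₀ (groupPoint a σ₂ p.1 k) + groupPoint ē σₑ p.2 k
              - A₀ (groupPoint a σ₂ p.1 κ)‖ ≤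
            ‖B₀ (groupPoint a σ₂ p.1 k) + groupPoint ē σₑ p.2 k
              - A₀ (groupPoint a σ₂ p.1 κ')‖) →
          |⟪u, a⟫| + σ₂ * (1 / (4 * √(l + 1))) ≤ |⟪u, groupPoint a σ₂ p.1 κ⟫|} := by
  set K := nnConst l with hK
  have hK1 : 1 ≤ K := one_le_nnConst l
  have hl0 : (0 : ℝ) ≤ l := Nat.cast_nonneg l
  set g : ℝ := (Fintype.card ι : ℝ) with hgdef
  have hg160 : 160 ≤ g := by nlinarith
  have hgpos : 0 < g := by linarith
  have hq1 : assignProb l ≤ 1 := by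
    rw [assignProb, div_le_one (by linarith)]
    have : Real.exp (-(8 * K * (l + 1) + 8)) ≤ 1 := Real.exp_le_one_iff.2 (by nlinarith)
    linarith
  rcases hσ₂.eq_or_lt with rfl | hσ₂pos
  · -- without deviations all the points agree with the mean
    refine le_trans (ENNReal.ofReal_le_one.2 hq1) (le_of_eq ?_)
    rw [← measure_univ (μ := (Measure.pi fun _ : ι => stdGaussian E).prod
      (Measure.pi fun _ : ι => stdGaussian F))]
    congr 1
    ext p
    simp [groupPoint]
  -- reduce to a direction in which the mean is nonnegative
  wlog hua : 0 ≤ ⟪u, a⟫ generalizing u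
  · have := this (u := -u) (by simpa using hu) (by rw [inner_neg_left]; linarith)
    simpa only [inner_neg_left, abs_neg] using this
  set μ := Measure.pi fun _ : ι => stdGaussian E with hμ
  set μ' := Measure.pi fun _ : ι => stdGaussian F with hμ'
  set ρ : ℝ := 1 - g⁻¹ with hρ
  have hginv : g⁻¹ ≤ 1 / 160 := by rw [one_div]; gcongr
  have hρ2 : 1 / 2 ≤ ρ := by rw [hρ]; linarith
  have hρpos : 0 < ρ := by linarith
  set c : ℝ := 1 / (4 * √(l + 1)) with hc
  have hsq1 : 0 < √((l : ℝ) + 1) := by positivity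
  have hcpos : 0 < c := by positivity
  -- the event for independent noise
  let D' : Set ((ι → E) × F) := {p | ∀ κ,
        (∀ κ', ‖(σ₂ • A₀) (p.1 k) + (σₑ * ρ) • p.2 - (σ₂ • A₀) (p.1 κ)‖ ≤
          ‖(σ₂ • A₀) (p.1 k) + (σₑ * ρ) • p.2 - (σ₂ • A₀) (p.1 κ')‖) →
          1 / 2 ≤ √(l + 1) * ⟪u, p.1 κ⟫}
  have hexk : ∃ κ, κ ≠ k := by
    have h1 : 1 < Fintype.card ι := by
      have : (1 : ℝ) < Fintype.card ι := by linarith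
      exact_mod_cast this
    exact Fintype.exists_ne_of_one_lt_card h1 k
  have hD' : 1 ≤ ENNReal.ofReal K * (μ.prod (stdGaussian F)) D' :=
    one_le_mul_nearest_neighbour (smul_ne_zero hσ₂pos.ne' hA₀) hu hl
      (mul_nonneg hσₑ hρpos.le) k hexk
  have hD'm : MeasurableSet D' := measurableSet_forall_minimizer
    (P := fun κ => {p : (ι → E) × F | 1 / 2 ≤ √(l + 1) * ⟪u, p.1 κ⟫})
    (fun κ => by fun_prop) (fun κ => measurableSet_le measurable_const (by fun_prop))
  set D : Set ((ι → E) × (ι → F)) :=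
        {p | ∀ κ, (∀ κ', ‖B₀ (groupPoint a σ₂ p.1 k) + groupPoint ē σₑ p.2 k
              - A₀ (groupPoint a σ₂ p.1 κ)‖ ≤
            ‖B₀ (groupPoint a σ₂ p.1 k) + groupPoint ē σₑ p.2 k
              - A₀ (groupPoint a σ₂ p.1 κ')‖) →
          |⟪u, a⟫| + σ₂ * c ≤ |⟪u, groupPoint a σ₂ p.1 κ⟫|} with hD
  have hDm : MeasurableSet D := measurableSet_forall_minimizer
    (P := fun κ => {p : (ι → E) × (ι → F) |
      |⟪u, a⟫| + σ₂ * c ≤ |⟪u, groupPoint a σ₂ p.1 κ⟫|})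
    (fun κ => Continuous.measurable (by
      have h1 := (continuous_groupPoint (ι := ι) a σ₂ k).comp
        (continuous_fst (X := ι → E) (Y := ι → F))
      have h2 := (continuous_groupPoint (ι := ι) a σ₂ κ).comp
        (continuous_fst (X := ι → E) (Y := ι → F))
      have h3 := (continuous_groupPoint (ι := ι) ē σₑ k).comp
        (continuous_snd (X := ι → E) (Y := ι → F))
      simp only [Function.comp_def] at h1 h2 h3
      fun_prop))
    (fun κ => measurableSet_le measurable_const (Continuous.measurable (by
      have h2 := (continuous_groupPoint (ι := ι) a σ₂ κ).comp
        (continuous_fst (X := ι → E) (Y := ι → F))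
      simp only [Function.comp_def] at h2
      fun_prop)))
  -- the shift of the noise
  let V : (ι → E) → F := fun N => (σ₂ / σₑ) • (A₀ - B₀) (g⁻¹ • ∑ κ', N κ' - N k)
  let ν' : (ι → F) → F := fun ν => g⁻¹ • ∑ κ' ∈ Finset.univ.erase k, ν κ'
  let δ : (ι → E) → (ι → F) → F := fun N ν =>
    ρ⁻¹ • (σₑ⁻¹ • (ē - (A₀ - B₀) a) + V N - ν' ν)
  have hδ : ∀ N ν, (σₑ * ρ) • δ N ν = (ē - (A₀ - B₀) a) +
      σ₂ • (A₀ - B₀) (g⁻¹ • ∑ κ', N κ' - N k) - σₑ • g⁻¹ • ∑ κ' ∈ Finset.univ.erase k, ν κ' := by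
    intro N ν
    simp only [δ, V, ν']
    rw [smul_smul, mul_assoc, mul_inv_cancel₀ hρpos.ne', mul_one]
    -- For `σₑ = 0` the hypotheses force `A₀ = B₀` and a vanishing mean residual, so the default
    -- value of division by zero in `V` and `δ` does no harm.
    rcases hσₑ.eq_or_lt with h0 | h0
    · rw [← h0] at hm hΔ ⊢
      have e1 : ē - (A₀ - B₀) a = 0 := norm_le_zero_iff.1 hm
      have e2 : A₀ - B₀ = 0 := by
        rw [mul_zero] at hΔ
        exact norm_le_zero_iff.1 (nonpos_of_mul_nonpos_right hΔ hσ₂pos)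
      rw [e1, e2]; simp
    · rw [smul_sub, smul_add, smul_smul, smul_smul, mul_inv_cancel₀ h0.ne', one_smul,
        mul_div_cancel₀ _ h0.ne']
  -- the bad events
  have hVbad : μ {N | 1 / 2 ≤ ‖V N‖} ≤ ENNReal.ofReal (1 / (16 * K)) := by
    have hV : ∀ N : ι → E, V N = ((σ₂ / σₑ) • (A₀ - B₀))
        (∑ κ, (g⁻¹ - if κ = k then 1 else 0) • N κ) := by
      intro N
      simp only [V, smul_apply, sub_smul, Finset.sum_sub_distrib, ite_smul, one_smul, zero_smul,
        Finset.sum_ite_eq', Finset.mem_univ, if_true, Finset.smul_sum]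
    simp only [hV]
    refine (pi_le_norm_map_sum_smul _ _ (by norm_num)).trans (ENNReal.ofReal_le_ofReal ?_)
    have h1 : ‖(σ₂ / σₑ) • (A₀ - B₀)‖ ≤ 1 / (8 * K * (l + 1)) := by
      rw [norm_smul, Real.norm_eq_abs, abs_of_nonneg (by positivity)]
      rcases hσₑ.eq_or_lt with h0 | h0
      · rw [← h0]; simp; positivity
      · rw [div_mul_eq_mul_div, div_le_iff₀ h0]; exact hΔ
    have h2 : ∑ κ, (g⁻¹ - if κ = k then 1 else 0) ^ 2 ≤ (1 : ℝ) := by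
      have e1 : ∀ κ, (g⁻¹ - if κ = k then (1 : ℝ) else 0) ^ 2 =
          g⁻¹ ^ 2 + if κ = k then 1 - 2 * g⁻¹ else 0 := by
        intro κ; split_ifs <;> ring
      simp only [e1, Finset.sum_add_distrib, Finset.sum_const, Finset.card_univ, nsmul_eq_mul,
        Finset.sum_ite_eq', Finset.mem_univ, if_true]
      have : g * g⁻¹ ^ 2 = g⁻¹ := by field_simp
      rw [← hgdef, this]
      have : 0 < g⁻¹ := by positivity
      linarith
    rw [hl]
    calc (l : ℝ) * ‖(σ₂ / σₑ) • (A₀ - B₀)‖ ^ 2 * (∑ κ, (g⁻¹ - if κ = k then 1 else 0) ^ 2) /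
          (1 / 2) ^ 2 ≤ l * (1 / (8 * K * (l + 1))) ^ 2 * 1 / (1 / 2) ^ 2 := by gcongr
      _ ≤ 1 / (16 * K) := by
        rw [div_pow, one_pow]
        rw [mul_one, mul_one_div, div_div, div_le_div_iff₀ (by positivity) (by positivity)]
        nlinarith [mul_nonneg hl0 hl0, mul_nonneg (by linarith : (0 : ℝ) ≤ K - 1) hl0,
          mul_nonneg (mul_nonneg (by linarith : (0 : ℝ) ≤ K) (by linarith : (0 : ℝ) ≤ K - 1))
            (mul_nonneg hl0 hl0), mul_nonneg (mul_nonneg (by linarith : (0 : ℝ) ≤ K)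
            (by linarith : (0 : ℝ) ≤ K - 1)) hl0]
  have hνbad : μ' {ν | 1 / 2 ≤ ‖ν' ν‖} ≤ ENNReal.ofReal (1 / (32 * K)) := by
    have hν : ∀ ν : ι → F, ν' ν = (ContinuousLinearMap.id ℝ F)
        (∑ κ, (if κ = k then 0 else g⁻¹) • ν κ) := by
      intro ν
      simp only [ν', ContinuousLinearMap.id_apply, ite_smul, zero_smul]
      rw [Finset.sum_ite, Finset.sum_const_zero, zero_add, Finset.smul_sum]
      refine Finset.sum_congr ?_ fun _ _ => rfl
      ext κ; simp
    simp only [hν]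
    refine (pi_le_norm_map_sum_smul _ _ (by norm_num)).trans (ENNReal.ofReal_le_ofReal ?_)
    have h2 : ∑ κ, (if κ = k then 0 else g⁻¹) ^ 2 ≤ g⁻¹ := by
      calc ∑ κ, (if κ = k then 0 else g⁻¹) ^ 2 ≤ ∑ _κ : ι, g⁻¹ ^ 2 := by
            refine Finset.sum_le_sum fun κ _ => ?_
            split_ifs
            · rw [zero_pow two_ne_zero]; positivity
            · exact le_rfl
        _ = g⁻¹ := by
            rw [Finset.sum_const, Finset.card_univ, nsmul_eq_mul, ← hgdef]; field_simp
    have h1 : ‖ContinuousLinearMap.id ℝ F‖ ^ 2 ≤ 1 := pow_le_one₀ (norm_nonneg _)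
      ContinuousLinearMap.norm_id_le
    rw [hl]
    calc (l : ℝ) * ‖ContinuousLinearMap.id ℝ F‖ ^ 2 * (∑ κ, (if κ = k then 0 else g⁻¹) ^ 2) /
          (1 / 2) ^ 2 ≤ l * 1 * g⁻¹ / (1 / 2) ^ 2 := by gcongr
      _ ≤ 1 / (32 * K) := by
        rw [mul_one, ← div_eq_mul_inv, div_div, div_le_div_iff₀ (by positivity) (by positivity)]
        nlinarith
  have hubad : μ {N | c ≤ |⟪u, g⁻¹ • ∑ κ, N κ⟫|} ≤ ENNReal.ofReal (1 / (10 * K)) := by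
    have hν : ∀ N : ι → E, |⟪u, g⁻¹ • ∑ κ, N κ⟫| = ‖(innerSL ℝ u) (∑ κ, g⁻¹ • N κ)‖ := by
      intro ν
      rw [Real.norm_eq_abs, innerSL_apply_apply, Finset.smul_sum]
    simp only [hν]
    refine (pi_le_norm_map_sum_smul _ _ hcpos).trans (ENNReal.ofReal_le_ofReal ?_)
    rw [innerSL_apply_norm, hu, Finset.sum_const, Finset.card_univ, nsmul_eq_mul, ← hgdef,
      Module.finrank_self, hc, div_pow, mul_pow, Real.sq_sqrt (by positivity)]
    have e1 : ((1 : ℕ) : ℝ) * 1 ^ 2 * (g * g⁻¹ ^ 2) / (1 ^ 2 / (4 ^ 2 * ((l : ℝ) + 1))) =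
        16 * (l + 1) / g := by push_cast; field_simp; norm_num
    rw [e1, div_le_div_iff₀ hgpos (by positivity)]
    nlinarith
  set R : ℝ := 2 * K * (l + 1) with hR
  have hRpos : 0 < R := by positivity
  have hRbad : stdGaussian F {y | R ≤ ‖y‖} ≤ ENNReal.ofReal (1 / (4 * K)) := by
    have h0 := (measurePreserving_eval (fun _ : Unit => stdGaussian F) ()).measure_preimage
      (s := {y | R ≤ ‖y‖}) (measurableSet_le measurable_const (by fun_prop)).nullMeasurableSet
    rw [← h0]
    have h1 := pi_le_norm_map_sum_smul (ι := Unit) (ContinuousLinearMap.id ℝ F) (fun _ => 1) hRpos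
    simp only [Finset.univ_unique, Finset.sum_singleton, one_smul,
      ContinuousLinearMap.id_apply] at h1
    refine h1.trans (ENNReal.ofReal_le_ofReal ?_)
    have h2 : ‖ContinuousLinearMap.id ℝ F‖ ^ 2 ≤ 1 := pow_le_one₀ (norm_nonneg _)
      ContinuousLinearMap.norm_id_le
    rw [hl]
    calc (l : ℝ) * ‖ContinuousLinearMap.id ℝ F‖ ^ 2 * 1 ^ 2 / R ^ 2 ≤ l * 1 * 1 ^ 2 / R ^ 2 := by
          gcongr
      _ ≤ 1 / (4 * K) := by
        rw [hR, div_le_div_iff₀ (by positivity) (by positivity)]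
        nlinarith [mul_nonneg hl0 hl0, mul_nonneg (by linarith : (0 : ℝ) ≤ K - 1) hl0,
          mul_nonneg (mul_nonneg (by linarith : (0 : ℝ) ≤ K) (by linarith : (0 : ℝ) ≤ K - 1))
            (mul_nonneg hl0 hl0), mul_nonneg (mul_nonneg (by linarith : (0 : ℝ) ≤ K)
            (by linarith : (0 : ℝ) ≤ K - 1)) hl0]
  let H : Set ((ι → E) × (ι → F)) :=
    {p | 1 / 2 ≤ ‖V p.1‖} ∪ {p | c ≤ |⟪u, g⁻¹ • ∑ κ, p.1 κ⟫|} ∪ {p | 1 / 2 ≤ ‖ν' p.2‖}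
  have hHm : MeasurableSet H := by
    refine ((measurableSet_le measurable_const ?_).union
      (measurableSet_le measurable_const (by fun_prop))).union
      (measurableSet_le measurable_const (by fun_prop))
    simp only [V]; fun_prop
  -- Since `1/16 + 1/10 + 1/32 < 1/4`, this event and `R ≤ ‖y‖` together consume at most half of the
  -- probability `1/K` of the model event.
  have hHbad : (μ.prod μ') H ≤ ENNReal.ofReal (1 / (4 * K)) := by
    have p1 : (μ.prod μ') {p | 1 / 2 ≤ ‖V p.1‖} ≤ ENNReal.ofReal (1 / (16 * K)) := by
      refine le_trans (le_of_eq ?_) hVbad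
      have : {p : (ι → E) × (ι → F) | 1 / 2 ≤ ‖V p.1‖} = {N | 1 / 2 ≤ ‖V N‖} ×ˢ Set.univ := by
        ext; simp
      rw [this, Measure.prod_prod, measure_univ, mul_one]
    have p2 : (μ.prod μ') {p | c ≤ |⟪u, g⁻¹ • ∑ κ, p.1 κ⟫|} ≤ ENNReal.ofReal (1 / (10 * K)) := by
      refine le_trans (le_of_eq ?_) hubad
      have : {p : (ι → E) × (ι → F) | c ≤ |⟪u, g⁻¹ • ∑ κ, p.1 κ⟫|} =
          {N | c ≤ |⟪u, g⁻¹ • ∑ κ, N κ⟫|} ×ˢ Set.univ := by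
        ext; simp
      rw [this, Measure.prod_prod, measure_univ, mul_one]
    have p3 : (μ.prod μ') {p | 1 / 2 ≤ ‖ν' p.2‖} ≤ ENNReal.ofReal (1 / (32 * K)) := by
      refine le_trans (le_of_eq ?_) hνbad
      have : {p : (ι → E) × (ι → F) | 1 / 2 ≤ ‖ν' p.2‖} = Set.univ ×ˢ {ν | 1 / 2 ≤ ‖ν' ν‖} := by
        ext; simp
      rw [this, Measure.prod_prod, measure_univ, one_mul]
    refine (measure_union_le _ _).trans ((add_le_add (measure_union_le _ _) p3).trans ?_)
    refine (add_le_add (add_le_add p1 p2) le_rfl).trans ?_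
    rw [← ENNReal.ofReal_add (by positivity) (by positivity),
      ← ENNReal.ofReal_add (by positivity) (by positivity)]
    refine ENNReal.ofReal_le_ofReal ?_
    have : 1 / (16 * K) + 1 / (10 * K) + 1 / (32 * K) = (1 / 16 + 1 / 10 + 1 / 32) * (1 / K) := by
      field_simp
    rw [this]
    have e2 : 1 / (4 * K) = 1 / 4 * (1 / K) := by field_simp
    rw [e2]
    gcongr; norm_num
  -- outside the bad events the shifted noise is comparable to the unshifted one
  let Q : (ι → E) → Set F := fun N => {y | (N, y) ∈ D'} ∩ {y | ‖y‖ ≤ R}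
  have hQm : ∀ N, MeasurableSet (Q N) := fun N =>
    (measurable_prodMk_left hD'm).inter (measurableSet_le (by fun_prop) measurable_const)
  have hcomp : ∀ p : (ι → E) × (ι → F), p ∉ H →
      stdGaussian F (Q p.1) ≤ ENNReal.ofReal (Real.exp (4 * R + 8)) *
        stdGaussian F {y | (p.1, Function.update p.2 k y) ∈ D} := by
    rintro ⟨N, ν⟩ hp
    simp only [H, Set.mem_union, Set.mem_ofPred_eq, not_or, not_le] at hp
    obtain ⟨⟨hV, hN⟩, hν⟩ := hp
    -- The three terms are at most 1, 1/2 and 1/2, and `ρ⁻¹ ≤ 2`. With `‖y‖ ≤ R` the Cameron-Martin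
    -- factor is then at most `exp (4 R + 4²/2)`, the exponential in `assignProb`.
    have hδn : ‖δ N ν‖ ≤ 4 := by
      have e0 : ‖σₑ⁻¹ • (ē - (A₀ - B₀) a)‖ ≤ 1 := by
        rw [norm_smul, norm_inv, Real.norm_eq_abs, abs_of_nonneg hσₑ]
        rcases hσₑ.eq_or_lt with h0 | h0
        · rw [← h0]; simp
        · rw [inv_mul_le_iff₀ h0, mul_one]; exact hm
      have e1 : ‖σₑ⁻¹ • (ē - (A₀ - B₀) a) + V N - ν' ν‖ ≤ 2 := by
        refine (norm_sub_le _ _).trans ?_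
        have := norm_add_le (σₑ⁻¹ • (ē - (A₀ - B₀) a)) (V N)
        linarith
      have e2 : ρ⁻¹ ≤ 2 := by
        rw [inv_le_comm₀ hρpos (by norm_num)]; linarith
      calc ‖δ N ν‖ = ρ⁻¹ * ‖σₑ⁻¹ • (ē - (A₀ - B₀) a) + V N - ν' ν‖ := by
            simp only [δ]; rw [norm_smul, norm_inv, Real.norm_eq_abs, abs_of_pos hρpos]
        _ ≤ 2 * 2 := by gcongr
        _ = 4 := by norm_num
    refine (stdGaussian_le_exp_mul_sub (hQm N) (-δ N ν) (M := 4 * R) ?_).trans ?_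
    · rintro y ⟨-, hy⟩
      have hy : ‖y‖ ≤ R := hy
      calc ⟪-δ N ν, y⟫ ≤ ‖-δ N ν‖ * ‖y‖ := real_inner_le_norm _ _
        _ ≤ 4 * R := by rw [norm_neg]; gcongr
    · refine mul_le_mul' (ENNReal.ofReal_le_ofReal (Real.exp_le_exp.2 ?_)) (measure_mono ?_)
      · rw [norm_neg]
        have := pow_le_pow_left₀ (norm_nonneg _) hδn 2
        linarith
      · rintro y ⟨hyD, -⟩ κ hmin
        simp only [sub_neg_eq_add] at hyD
        simp only at hmin ⊢
        have hdec := fun κ => residual_decomposition (A₀ := A₀) (B₀ := B₀) (σ₂ := σ₂) (σₑ := σₑ)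
          (a := a) (ē := ē) rfl k κ N ν y (δ N ν) (hδ N ν)
        simp only [hdec] at hmin
        have h1 : 1 / 2 ≤ √(l + 1) * ⟪u, N κ⟫ := hyD κ hmin
        have h2 : 2 * c ≤ ⟪u, N κ⟫ := by
          rw [hc]
          have : 2 * (1 / (4 * √((l : ℝ) + 1))) = (1 / 2) / √((l : ℝ) + 1) := by field_simp; norm_num
          rw [this, div_le_iff₀ hsq1]; linarith
        have h3 := (abs_lt.1 hN).2
        have h4 : ⟪u, groupPoint a σ₂ N κ⟫ =
            ⟪u, a⟫ + σ₂ * (⟪u, N κ⟫ - ⟪u, g⁻¹ • ∑ κ', N κ'⟫) := by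
          simp only [groupPoint, inner_add_right, real_inner_smul_right, inner_sub_right, hgdef]
        rw [h4, abs_of_nonneg hua]
        refine le_trans ?_ (le_abs_self _)
        gcongr
        linarith
  -- assemble
  have hpres : MeasurePreserving
      (fun p : ((ι → E) × (ι → F)) × F => (p.1.1, Function.update p.1.2 k p.2))
      ((μ.prod μ').prod (stdGaussian F)) (μ.prod μ') := by
    have h1 := (MeasurePreserving.id μ).prod
      (measurePreserving_pi_update (fun _ : ι => stdGaussian F) k)
    exact h1.comp (measurePreserving_prodAssoc μ μ' (stdGaussian F))
  have hDval : (μ.prod μ') D =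
      ∫⁻ p, stdGaussian F {y | (p.1, Function.update p.2 k y) ∈ D} ∂(μ.prod μ') := by
    rw [← hpres.measure_preimage hDm.nullMeasurableSet,
      Measure.prod_apply (hpres.measurable hDm)]
    rfl
  have hD'val : (μ.prod (stdGaussian F)) D' =
      ∫⁻ p : (ι → E) × (ι → F), stdGaussian F {y | (p.1, y) ∈ D'} ∂(μ.prod μ') := by
    rw [Measure.prod_apply hD'm]
    exact ((measurePreserving_fst (μ := μ) (ν := μ')).lintegral_comp
      (measurable_measure_prodMk_left hD'm)).symm
  have hmain : (μ.prod (stdGaussian F)) D' ≤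
      ENNReal.ofReal (Real.exp (4 * R + 8)) * (μ.prod μ') D + ENNReal.ofReal (1 / (4 * K)) +
        ENNReal.ofReal (1 / (4 * K)) := by
    have hpt : ∀ p : (ι → E) × (ι → F), stdGaussian F {y | (p.1, y) ∈ D'} ≤
        ENNReal.ofReal (Real.exp (4 * R + 8)) *
          stdGaussian F {y | (p.1, Function.update p.2 k y) ∈ D} + ENNReal.ofReal (1 / (4 * K)) +
          H.indicator 1 p := by
      intro p
      by_cases hp : p ∈ H
      · rw [Set.indicator_of_mem hp, Pi.one_apply]
        exact (prob_le_one).trans le_add_self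
      · have h1 : {y | (p.1, y) ∈ D'} ⊆ Q p.1 ∪ {y | R ≤ ‖y‖} := by
          intro y hy
          rcases le_total ‖y‖ R with h | h
          · exact Or.inl ⟨hy, h⟩
          · exact Or.inr h
        refine (measure_mono h1).trans ((measure_union_le _ _).trans ?_)
        exact (add_le_add (hcomp p hp) hRbad).trans le_self_add
    have hDsm : Measurable fun p : (ι → E) × (ι → F) =>
        stdGaussian F {y | (p.1, Function.update p.2 k y) ∈ D} :=
      measurable_measure_prodMk_left (hpres.measurable hDm)
    rw [hD'val]
    refine (lintegral_mono hpt).trans ?_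
    rw [lintegral_add_right _ (measurable_one.indicator hHm),
      lintegral_add_right _ measurable_const, lintegral_const_mul _ hDsm, ← hDval,
      lintegral_const, measure_univ, mul_one, lintegral_indicator_one hHm]
    gcongr
  have hfin : (1 : ℝ≥0∞) ≤ ENNReal.ofReal (K * Real.exp (4 * R + 8)) * (μ.prod μ') D +
      ENNReal.ofReal (1 / 2) := by
    refine hD'.trans ((mul_le_mul_right hmain _).trans (le_of_eq ?_))
    rw [mul_add, mul_add, add_assoc, ← mul_assoc, ← ENNReal.ofReal_mul (by positivity),
      ← ENNReal.ofReal_mul (by positivity), ← ENNReal.ofReal_add (by positivity) (by positivity)]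
    congr 2
    field_simp; norm_num
  have hhalf : ENNReal.ofReal (1 / 2) ≤
      ENNReal.ofReal (K * Real.exp (4 * R + 8)) * (μ.prod μ') D := by
    have h2 : ENNReal.ofReal (1 / 2) + ENNReal.ofReal (1 / 2) ≤
        ENNReal.ofReal (K * Real.exp (4 * R + 8)) * (μ.prod μ') D + ENNReal.ofReal (1 / 2) := by
      refine le_trans (le_of_eq ?_) hfin
      rw [← ENNReal.ofReal_add (by norm_num) (by norm_num)]; norm_num
    exact (ENNReal.add_le_add_iff_right ENNReal.ofReal_ne_top).1 h2
  have hqeq : assignProb l = (K * Real.exp (4 * R + 8))⁻¹ * (1 / 2) := by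
    rw [assignProb, Real.exp_neg, hR]
    have : 8 * nnConst l * ((l : ℝ) + 1) + 8 = 4 * (2 * K * (l + 1)) + 8 := by rw [hK]; ring
    rw [this, ← hK]
    field_simp
  have hKe : 0 < K * Real.exp (4 * R + 8) := by positivity
  rw [hqeq, ENNReal.ofReal_mul (by positivity)]
  calc ENNReal.ofReal (K * Real.exp (4 * R + 8))⁻¹ * ENNReal.ofReal (1 / 2)
      ≤ ENNReal.ofReal (K * Real.exp (4 * R + 8))⁻¹ *
        (ENNReal.ofReal (K * Real.exp (4 * R + 8)) * (μ.prod μ') D) := by gcongr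
    _ = (μ.prod μ') D := by
      rw [← mul_assoc, ← ENNReal.ofReal_mul (by positivity), inv_mul_cancel₀ hKe.ne',
        ENNReal.ofReal_one, one_mul]

end Core

/-! ### Normal equations -/

section NormalEquations

variable {E F : Type*}
  [NormedAddCommGroup E] [InnerProductSpace ℝ E] [FiniteDimensional ℝ E]
  [NormedAddCommGroup F] [InnerProductSpace ℝ F] [FiniteDimensional ℝ F]
  {ι : Type*} [Fintype ι]

/-- The operator norm is at most the Hilbert-Schmidt norm. The loss is a factor depending on the
dimension `l` of the target space only. -/
theorem sq_opNorm_le_sum_sq_norm_adjoint {κ : Type*} [Fintype κ] (D : E →L[ℝ] F)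
    (f : OrthonormalBasis κ ℝ F) : ‖D‖ ^ 2 ≤ ∑ s, ‖D.adjoint (f s)‖ ^ 2 := by
  have h0 : 0 ≤ ∑ s, ‖D.adjoint (f s)‖ ^ 2 := Finset.sum_nonneg fun _ _ => sq_nonneg _
  refine (Real.le_sqrt (norm_nonneg _) h0).1 (D.opNorm_le_bound (Real.sqrt_nonneg _) fun x => ?_)
  rw [← Real.sqrt_sq (norm_nonneg x), ← Real.sqrt_mul h0]
  refine Real.le_sqrt_of_sq_le ?_
  rw [← f.sum_sq_inner_right, Finset.sum_mul]
  refine Finset.sum_le_sum fun s _ => ?_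
  rw [← ContinuousLinearMap.adjoint_inner_left, ← mul_pow]
  exact sq_le_sq' (neg_le_of_abs_le (abs_real_inner_le_norm _ _)) (real_inner_le_norm _ _)

variable {A b : E →L[ℝ] F} {x : ι → E} {z : ι → F}

/-- Pair the normal equations, taken at `v = (A - b)* f`, with `f`. The reference map `b` is
arbitrary. -/
theorem sum_sq_inner_adjoint_eq (h : ∀ v, ∑ i, ⟪x i, v⟫ • A (x i) = ∑ i, ⟪x i, v⟫ • z i) (f : F) :
    ∑ i, ⟪x i, (A - b).adjoint f⟫ ^ 2 =
      ∑ i, ⟪x i, (A - b).adjoint f⟫ * ⟪z i - b (x i), f⟫ := by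
  have h1 := congrArg (fun y => ⟪y, f⟫) (h ((A - b).adjoint f))
  simp only [sum_inner, real_inner_smul_left] at h1
  simp only [inner_sub_left, mul_sub, Finset.sum_sub_distrib, ← h1]
  rw [← Finset.sum_sub_distrib]
  refine Finset.sum_congr rfl fun i _ => ?_
  rw [← mul_sub, ← inner_sub_left, sq]
  congr 1
  rw [ContinuousLinearMap.adjoint_inner_right, sub_apply]

/-- The fitted values of the errors are an orthogonal projection of the errors. -/
theorem sum_sq_norm_map_sub_le (h : ∀ v, ∑ i, ⟪x i, v⟫ • A (x i) = ∑ i, ⟪x i, v⟫ • z i) :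
    ∑ i, ‖(A - b) (x i)‖ ^ 2 ≤ ∑ i, ‖z i - b (x i)‖ ^ 2 := by
  set f := stdOrthonormalBasis ℝ F
  have h1 : ∑ i, ‖(A - b) (x i)‖ ^ 2 = ∑ i, ⟪(A - b) (x i), z i - b (x i)⟫ := by
    calc ∑ i, ‖(A - b) (x i)‖ ^ 2 = ∑ s, ∑ i, ⟪x i, (A - b).adjoint (f s)⟫ ^ 2 := by
          rw [Finset.sum_comm]
          refine Finset.sum_congr rfl fun i _ => ?_
          rw [← f.sum_sq_inner_left]
          simp only [ContinuousLinearMap.adjoint_inner_right]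
      _ = ∑ s, ∑ i, ⟪x i, (A - b).adjoint (f s)⟫ * ⟪z i - b (x i), f s⟫ :=
          Finset.sum_congr rfl fun s _ => sum_sq_inner_adjoint_eq h _
      _ = _ := by
          rw [Finset.sum_comm]
          refine Finset.sum_congr rfl fun i _ => ?_
          rw [← f.sum_inner_mul_inner]
          simp only [ContinuousLinearMap.adjoint_inner_right, real_inner_comm (z i - b (x i))]
  have h2 : ∑ i, ⟪(A - b) (x i), z i - b (x i)⟫ ≤
      ∑ i, (‖(A - b) (x i)‖ ^ 2 + ‖z i - b (x i)‖ ^ 2) / 2 := by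
    refine Finset.sum_le_sum fun i _ => (real_inner_le_norm _ _).trans ?_
    have := two_mul_le_add_sq ‖(A - b) (x i)‖ ‖z i - b (x i)‖
    linarith
  rw [← Finset.sum_div, Finset.sum_add_distrib] at h2
  linarith

/-- No independence between features and errors is required, only a lower bound for the Gram matrix.
It serves the regression after assignment, with the first fit as `b`. -/
theorem sq_opNorm_sub_le (h : ∀ v, ∑ i, ⟪x i, v⟫ • A (x i) = ∑ i, ⟪x i, v⟫ • z i)
    {r : ℝ} (hr : 0 < r) (hgram : ∀ v, r * ‖v‖ ^ 2 ≤ ∑ i, ⟪x i, v⟫ ^ 2) :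
    ‖A - b‖ ^ 2 ≤ (∑ i, ‖z i - b (x i)‖ ^ 2) / r := by
  rw [le_div_iff₀ hr]
  set f := stdOrthonormalBasis ℝ F
  refine le_trans ?_ (sum_sq_norm_map_sub_le (b := b) h)
  calc ‖A - b‖ ^ 2 * r ≤ (∑ s, ‖(A - b).adjoint (f s)‖ ^ 2) * r := by
        gcongr; exact sq_opNorm_le_sum_sq_norm_adjoint _ f
    _ = ∑ s, r * ‖(A - b).adjoint (f s)‖ ^ 2 := by
        rw [Finset.sum_mul]; exact Finset.sum_congr rfl fun _ _ => mul_comm _ _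
    _ ≤ ∑ s, ∑ i, ⟪x i, (A - b).adjoint (f s)⟫ ^ 2 := Finset.sum_le_sum fun s _ => hgram _
    _ = _ := by
        rw [Finset.sum_comm]
        refine Finset.sum_congr rfl fun i _ => ?_
        rw [← f.sum_sq_inner_left]
        simp only [ContinuousLinearMap.adjoint_inner_right]

/-- Unlike the bound by the sum of squared errors, this one keeps the cross terms, whose
cancellations make the error of the first fit small when there are many groups. -/
theorem sq_opNorm_sub_le_sum_cross {κ : Type*} [Fintype κ] (f : OrthonormalBasis κ ℝ F)
    (h : ∀ v, ∑ i, ⟪x i, v⟫ • A (x i) = ∑ i, ⟪x i, v⟫ • z i)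
    {r : ℝ} (hr : 0 < r) (hgram : ∀ v, r * ‖v‖ ^ 2 ≤ ∑ i, ⟪x i, v⟫ ^ 2) :
    ‖A - b‖ ^ 2 ≤ ∑ s, (‖∑ i, ⟪z i - b (x i), f s⟫ • x i‖ / r) ^ 2 := by
  refine (sq_opNorm_le_sum_sq_norm_adjoint _ f).trans (Finset.sum_le_sum fun s _ => ?_)
  refine pow_le_pow_left₀ (norm_nonneg _) ?_ 2
  set w := (A - b).adjoint (f s)
  rw [le_div_iff₀ hr]
  have h1 : r * ‖w‖ ^ 2 ≤ ‖w‖ * ‖∑ i, ⟪z i - b (x i), f s⟫ • x i‖ := by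
    refine (hgram w).trans ?_
    rw [sum_sq_inner_adjoint_eq h]
    refine le_trans (le_of_eq ?_) (real_inner_le_norm w _)
    simp only [inner_sum, real_inner_smul_right]
    exact Finset.sum_congr rfl fun i _ => by rw [mul_comm, real_inner_comm w]
  rcases (norm_nonneg w).eq_or_lt with h0 | h0
  · rw [← h0, zero_mul]; positivity
  · refine le_of_mul_le_mul_left ?_ h0
    linarith [h1]

end NormalEquations

/-! ### Regression as a linear map -/

section Regression

variable {d l : ℕ} {ι : Type*} [Fintype ι]

/-- The linear map `x ↦ Mᵀ x`. -/
noncomputable def transposeMap (M : Matrix (Fin d) (Fin l) ℝ) :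
    EuclideanSpace ℝ (Fin d) →L[ℝ] EuclideanSpace ℝ (Fin l) :=
  (Matrix.toEuclideanLin Mᵀ).toContinuousLinearMap

theorem transposeMap_apply (M : Matrix (Fin d) (Fin l) ℝ) (x : EuclideanSpace ℝ (Fin d)) :
    transposeMap M x = WithLp.toLp 2 (Mᵀ *ᵥ x.ofLp) := rfl

theorem transposeMap_sub (M N : Matrix (Fin d) (Fin l) ℝ) :
    transposeMap (M - N) = transposeMap M - transposeMap N := by
  ext x i; simp [transposeMap_apply, Matrix.sub_mulVec]

theorem norm_transposeMap (M : Matrix (Fin d) (Fin l) ℝ) : ‖transposeMap M‖ = ‖M‖ := by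
  rw [← Matrix.l2_opNorm_conjTranspose M, Matrix.conjTranspose_eq_transpose_of_trivial,
    Matrix.l2_opNorm_def]
  rfl

theorem norm_transposeMap_sub (M N : Matrix (Fin d) (Fin l) ℝ) :
    ‖transposeMap M - transposeMap N‖ = ‖M - N‖ := by
  rw [← transposeMap_sub, norm_transposeMap]

theorem lrWellPosed_of_pos {x : ι → EuclideanSpace ℝ (Fin d)}
    (h : ∀ v, v ≠ 0 → 0 < ∑ i, ⟪x i, v⟫ ^ 2) : LRWellPosed fun i => (x i).ofLp := by
  rw [LRWellPosed, ← Matrix.mulVec_injective_iff_isUnit]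
  refine (injective_iff_map_eq_zero (Matrix.mulVecLin _)).2 fun v hv => ?_
  by_contra hne
  have h1 := h (WithLp.toLp 2 v) (by simpa using hne)
  have hv : (∑ i, Matrix.vecMulVec (x i).ofLp (x i).ofLp) *ᵥ v = 0 := hv
  have h2 : v ⬝ᵥ ((∑ i, Matrix.vecMulVec (x i).ofLp (x i).ofLp) *ᵥ v) =
      ∑ i, ⟪x i, WithLp.toLp 2 v⟫ ^ 2 := by
    rw [Matrix.sum_mulVec, dotProduct_sum]
    refine Finset.sum_congr rfl fun i _ => ?_
    rw [Matrix.vecMulVec_mulVec, EuclideanSpace.inner_eq_star_dotProduct]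
    simp [dotProduct_comm, sq]
  rw [← h2, hv, dotProduct_zero] at h1
  exact lt_irrefl _ h1

/-- The normal equations. -/
theorem sum_inner_smul_LR {x : ι → EuclideanSpace ℝ (Fin d)} {z : ι → EuclideanSpace ℝ (Fin l)}
    (h : LRWellPosed fun i => (x i).ofLp) (v : EuclideanSpace ℝ (Fin d)) :
    ∑ i, ⟪x i, v⟫ • transposeMap (LR (fun i => (x i).ofLp) fun i => (z i).ofLp) (x i) =
      ∑ i, ⟪x i, v⟫ • z i := by
  have h1 : (∑ i, Matrix.vecMulVec (x i).ofLp (x i).ofLp) *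
      LR (fun i => (x i).ofLp) (fun i => (z i).ofLp) =
        ∑ i, Matrix.vecMulVec (x i).ofLp (z i).ofLp := by
    rw [LR, Matrix.mul_nonsing_inv_cancel_left _ _ ((Matrix.isUnit_iff_isUnit_det _).1 h)]
  have h2 := congrArg (fun M : Matrix (Fin d) (Fin l) ℝ => Mᵀ *ᵥ v.ofLp) h1
  simp only [Matrix.transpose_mul, Matrix.transpose_sum, Matrix.transpose_vecMulVec,
    ← Matrix.mulVec_mulVec, Matrix.sum_mulVec, Matrix.vecMulVec_mulVec, Matrix.mulVec_sum] at h2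
  have hin : ∀ i, (x i).ofLp ⬝ᵥ v.ofLp = ⟪x i, v⟫ := fun i => by
    rw [EuclideanSpace.inner_eq_star_dotProduct]; simp [dotProduct_comm]
  refine PiLp.ext fun s => ?_
  have h3 := congrFun h2 s
  simp only [hin] at h3
  simpa [transposeMap_apply, Matrix.mulVec_smul] using h3

end Regression

/-! ### Nets of the sphere -/

/-- Cut the cube into cells by rounding `K u` coordinatewise and keep one point of the sphere from
each cell that it meets; two points of a cell differ by at most `1/K` in each coordinate. -/
theorem exists_sphere_net (d : ℕ) {K : ℕ} (hK : 0 < K) :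
    ∃ T : Finset (EuclideanSpace ℝ (Fin d)), (∀ u ∈ T, ‖u‖ = 1) ∧ T.card ≤ (2 * K + 1) ^ d ∧
      ∀ u : EuclideanSpace ℝ (Fin d), ‖u‖ = 1 → ∃ u' ∈ T, ‖u - u'‖ ≤ √d / K := by
  classical
  have hK' : (0 : ℝ) < K := by exact_mod_cast hK
  let φ : EuclideanSpace ℝ (Fin d) → Fin d → ℤ := fun u i => ⌊K * u i⌋
  let G : Finset (Fin d → ℤ) := Fintype.piFinset fun _ => Finset.Icc (-(K : ℤ)) K
  have hG : ∀ u : EuclideanSpace ℝ (Fin d), ‖u‖ = 1 → φ u ∈ G := by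
    intro u hu
    rw [Fintype.mem_piFinset]
    intro i
    have h1 : |u i| ≤ 1 := by
      rw [← hu, ← Real.norm_eq_abs]; exact PiLp.norm_apply_le u i
    rw [Finset.mem_Icc]
    have h2 := abs_le.1 h1
    constructor
    · refine Int.le_floor.2 ?_
      push_cast; nlinarith
    · have : ((⌊K * u i⌋ : ℤ) : ℝ) ≤ K := (Int.floor_le _).trans (by nlinarith)
      exact_mod_cast this
  let ψ : (Fin d → ℤ) → EuclideanSpace ℝ (Fin d) := fun c =>
    if h : ∃ u, ‖u‖ = 1 ∧ φ u = c then h.choose else 0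
  refine ⟨(G.filter fun c => ∃ u, ‖u‖ = 1 ∧ φ u = c).image ψ, ?_, ?_, ?_⟩
  · intro u hu
    obtain ⟨c, hc, rfl⟩ := Finset.mem_image.1 hu
    have h := (Finset.mem_filter.1 hc).2
    simp only [ψ, dif_pos h]
    exact h.choose_spec.1
  · refine Finset.card_image_le.trans ((Finset.card_filter_le _ _).trans (le_of_eq ?_))
    rw [Fintype.card_piFinset_const, Int.card_Icc]
    congr 1; omega
  · intro u hu
    have h : ∃ v, ‖v‖ = 1 ∧ φ v = φ u := ⟨u, hu, rfl⟩
    refine ⟨ψ (φ u), Finset.mem_image_of_mem _ (Finset.mem_filter.2 ⟨hG u hu, h⟩), ?_⟩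
    simp only [ψ, dif_pos h]
    obtain ⟨-, hv⟩ := h.choose_spec
    set v := h.choose
    rw [EuclideanSpace.norm_eq]
    have hcoord : ∀ i, ‖(u - v) i‖ ^ 2 ≤ (1 / K) ^ 2 := by
      intro i
      have h1 : ⌊K * u i⌋ = ⌊K * v i⌋ := (congrFun hv i).symm
      have h2 := Int.abs_sub_lt_one_of_floor_eq_floor h1
      rw [← mul_sub, abs_mul, abs_of_pos hK'] at h2
      refine pow_le_pow_left₀ (norm_nonneg _) ?_ 2
      rw [Real.norm_eq_abs, le_div_iff₀ hK', mul_comm]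
      exact h2.le
    calc √(∑ i, ‖(u - v) i‖ ^ 2) ≤ √(∑ _i : Fin d, (1 / (K : ℝ)) ^ 2) :=
          Real.sqrt_le_sqrt (Finset.sum_le_sum fun i _ => hcoord i)
      _ = √d / K := by
          rw [Finset.sum_const, Finset.card_univ, Fintype.card_fin, nsmul_eq_mul,
            Real.sqrt_mul (Nat.cast_nonneg d), Real.sqrt_sq (by positivity), mul_one_div]

/-! ### Lower bounds for Gram matrices from a net of directions -/

section Gram

variable {E : Type*} [NormedAddCommGroup E] [InnerProductSpace ℝ E] {ι : Type*} [Fintype ι]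

/-- A family with many large components in each direction of a net has a large Gram matrix. -/
theorem gram_lower_bound_of_net {T : Finset E} {η : ℝ}
    (hT : ∀ u : E, ‖u‖ = 1 → ∃ u' ∈ T, ‖u - u'‖ ≤ η) {x : ι → E} {M s c : ℝ}
    (hx : ∀ i, ‖x i‖ ≤ M) (hη : M * η ≤ s / 2) (hs : 0 ≤ s)
    (hcount : ∀ u ∈ T, c ≤ (Finset.univ.filter fun i => s ≤ |⟪u, x i⟫|).card) (v : E) :
    c * (s / 2) ^ 2 * ‖v‖ ^ 2 ≤ ∑ i, ⟪x i, v⟫ ^ 2 := by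
  rcases eq_or_ne v 0 with rfl | hv
  · simp
  have hv0 : 0 < ‖v‖ := norm_pos_iff.2 hv
  set u := ‖v‖⁻¹ • v with hu
  have hu1 : ‖u‖ = 1 := norm_smul_inv_norm (𝕜 := ℝ) hv
  have hvu : v = ‖v‖ • u := by rw [hu, smul_smul, mul_inv_cancel₀ hv0.ne', one_smul]
  obtain ⟨u', hu'T, hu'⟩ := hT u hu1
  have hbig : ∀ i ∈ Finset.univ.filter (fun i => s ≤ |⟪u', x i⟫|), (s / 2) ^ 2 ≤ ⟪x i, u⟫ ^ 2 := by
    intro i hi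
    have hi := (Finset.mem_filter.1 hi).2
    have h1 : |⟪u - u', x i⟫| ≤ s / 2 := by
      refine (abs_real_inner_le_norm _ _).trans (le_trans ?_ hη)
      rw [mul_comm]
      exact mul_le_mul (hx i) hu' (norm_nonneg _) ((norm_nonneg _).trans (hx i))
    have h2 : s / 2 ≤ |⟪x i, u⟫| := by
      rw [real_inner_comm]
      have : ⟪u', x i⟫ = ⟪u, x i⟫ - ⟪u - u', x i⟫ := by rw [inner_sub_left]; ring
      rw [this] at hi
      have := abs_sub ⟪u, x i⟫ ⟪u - u', x i⟫
      linarith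
    rw [← sq_abs ⟪x i, u⟫]
    exact pow_le_pow_left₀ (by linarith) h2 2
  have hsum : c * (s / 2) ^ 2 ≤ ∑ i, ⟪x i, u⟫ ^ 2 := by
    calc c * (s / 2) ^ 2 ≤ (Finset.univ.filter fun i => s ≤ |⟪u', x i⟫|).card * (s / 2) ^ 2 := by
          gcongr; exact hcount u' hu'T
      _ = ∑ _i ∈ Finset.univ.filter (fun i => s ≤ |⟪u', x i⟫|), (s / 2) ^ 2 := by
          rw [Finset.sum_const, nsmul_eq_mul]
      _ ≤ ∑ i ∈ Finset.univ.filter (fun i => s ≤ |⟪u', x i⟫|), ⟪x i, u⟫ ^ 2 :=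
          Finset.sum_le_sum hbig
      _ ≤ _ := Finset.sum_le_univ_sum_of_nonneg fun _ => sq_nonneg _
  calc c * (s / 2) ^ 2 * ‖v‖ ^ 2 ≤ (∑ i, ⟪x i, u⟫ ^ 2) * ‖v‖ ^ 2 := by gcongr
    _ = ∑ i, ⟪x i, v⟫ ^ 2 := by
        rw [Finset.sum_mul]
        refine Finset.sum_congr rfl fun i _ => ?_
        conv_rhs => rw [hvu, real_inner_smul_right]
        ring

end Gram

/-! ### Sums over the points of a group -/

section GroupSums

variable {E F : Type*} [NormedAddCommGroup E] [InnerProductSpace ℝ E]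
  [NormedAddCommGroup F] [InnerProductSpace ℝ F] {ι : Type*} [Fintype ι]

theorem sum_groupPoint [Nonempty ι] (a : E) (σ : ℝ) (N : ι → E) :
    ∑ κ, groupPoint a σ N κ = (Fintype.card ι : ℝ) • a := by
  have : (Fintype.card ι : ℝ) ≠ 0 := by exact_mod_cast Fintype.card_ne_zero
  simp only [groupPoint, Finset.sum_add_distrib, ← Finset.smul_sum, Finset.sum_sub_distrib,
    Finset.sum_const, Finset.card_univ]
  rw [← Nat.cast_smul_eq_nsmul ℝ, ← Nat.cast_smul_eq_nsmul ℝ, smul_smul, inv_mul_cancel₀ this,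
    one_smul, sub_self, smul_zero, add_zero]

theorem map_groupPoint (L : E →L[ℝ] F) (a : E) (σ : ℝ) (N : ι → E) (κ : ι) :
    L (groupPoint a σ N κ) = groupPoint (L a) σ (fun κ => L (N κ)) κ := by
  simp [groupPoint]

/-- The deviations from the mean sum to zero, so the cross term vanishes, and centering only
decreases the sum of squares. -/
theorem sum_sq_norm_groupPoint_le [Nonempty ι] (a : E) (σ : ℝ) (N : ι → E) :
    ∑ κ, ‖groupPoint a σ N κ‖ ^ 2 ≤ Fintype.card ι * ‖a‖ ^ 2 + σ ^ 2 * ∑ κ, ‖N κ‖ ^ 2 := by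
  have hc : (0 : ℝ) < Fintype.card ι := by exact_mod_cast Fintype.card_pos
  set g : ℝ := (Fintype.card ι : ℝ) with hg
  set S := ∑ κ, N κ with hS
  have h1 : ∀ κ, ‖groupPoint a σ N κ‖ ^ 2 = ‖a‖ ^ 2 + 2 * σ * ⟪a, N κ - g⁻¹ • S⟫ +
      σ ^ 2 * (‖N κ‖ ^ 2 - 2 * g⁻¹ * ⟪N κ, S⟫ + g⁻¹ ^ 2 * ‖S‖ ^ 2) := by
    intro κ
    rw [groupPoint, norm_add_sq_real, real_inner_smul_right, norm_smul, mul_pow, Real.norm_eq_abs,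
      sq_abs, norm_sub_sq_real (N κ), real_inner_smul_right, norm_smul, mul_pow, Real.norm_eq_abs,
      sq_abs]
    ring
  have h2 : ∑ κ, ⟪a, N κ - g⁻¹ • S⟫ = 0 := by
    rw [← inner_sum, Finset.sum_sub_distrib, ← hS, Finset.sum_const, Finset.card_univ,
      ← Nat.cast_smul_eq_nsmul ℝ, ← hg, smul_smul, mul_inv_cancel₀ hc.ne', one_smul, sub_self,
      inner_zero_right]
  have h3 : ∑ κ, ⟪N κ, S⟫ = ‖S‖ ^ 2 := by
    rw [← sum_inner, ← hS, real_inner_self_eq_norm_sq]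
  simp only [h1, Finset.sum_add_distrib, ← Finset.mul_sum, Finset.sum_sub_distrib, h2, h3,
    Finset.sum_const, Finset.card_univ, nsmul_eq_mul, ← hg]
  have h4 : g⁻¹ ^ 2 * (g * ‖S‖ ^ 2) = g⁻¹ * ‖S‖ ^ 2 := by field_simp
  rw [h4]
  have h5 : 0 ≤ σ ^ 2 * (g⁻¹ * ‖S‖ ^ 2) := by positivity
  linarith

end GroupSums

/-! ### Deviation bounds for families of Gaussian vectors -/

/-- The conditional union bound: outside `B` the conditional probability is at most `c`. Passing to
a measurable hull allows `B` to be any set. -/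
theorem prod_apply_le_of_section_le {α β : Type*} [MeasurableSpace α] [MeasurableSpace β]
    (μ : Measure α) (ν : Measure β) [IsProbabilityMeasure μ] [IsProbabilityMeasure ν]
    {S : Set (α × β)} (hS : MeasurableSet S) (B : Set α) (c : ℝ≥0∞)
    (h : ∀ x, x ∉ B → ν {y | (x, y) ∈ S} ≤ c) : (μ.prod ν) S ≤ μ B + c := by
  rw [Measure.prod_apply hS]
  have hpt : ∀ x, ν (Prod.mk x ⁻¹' S) ≤ (toMeasurable μ B).indicator 1 x + c := by
    intro x
    by_cases hx : x ∈ toMeasurable μ B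
    · rw [Set.indicator_of_mem hx, Pi.one_apply]
      exact prob_le_one.trans le_self_add
    · exact (h x fun hB => hx (subset_toMeasurable μ B hB)).trans le_add_self
  refine (lintegral_mono hpt).trans (le_of_eq ?_)
  rw [lintegral_add_right _ measurable_const,
    lintegral_indicator_one (measurableSet_toMeasurable μ B), measure_toMeasurable,
    lintegral_const, measure_univ, mul_one]

theorem pi_exists_card_bad_ge_le {ι β : Type*} [Fintype ι] {α : ι → Type*}
    [∀ i, MeasurableSpace (α i)] (μ : ∀ i, Measure (α i)) [∀ i, IsProbabilityMeasure (μ i)]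
    (T : Finset β) (A : β → ∀ i, Set (α i)) (hA : ∀ u i, MeasurableSet (A u i))
    (hp : ∀ u ∈ T, ∀ i, μ i (A u i) ≤ ENNReal.ofReal (1 / 6000))
    [∀ u (x : ∀ i, α i), DecidablePred fun i => x i ∈ A u i] :
    Measure.pi μ {x | ∃ u ∈ T, (Fintype.card ι : ℝ) / 8 ≤
        ((Finset.univ.filter fun i => x i ∈ A u i).card : ℝ)} ≤
      T.card * ENNReal.ofReal (Real.exp (-(Fintype.card ι : ℝ) / 2)) := by
  let S : β → Set (∀ i, α i) := fun u => {x | (Fintype.card ι : ℝ) / 8 ≤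
        ((Finset.univ.filter fun i => x i ∈ A u i).card : ℝ)}
  have hsub : {x : ∀ i, α i | ∃ u ∈ T, (Fintype.card ι : ℝ) / 8 ≤
        ((Finset.univ.filter fun i => x i ∈ A u i).card : ℝ)} ⊆ ⋃ u ∈ T, S u :=
    fun x ⟨u, hu, hx⟩ => Set.mem_biUnion (s := (T : Set β)) hu hx
  refine (measure_mono hsub).trans ((measure_biUnion_finset_le T S).trans ?_)
  rw [← nsmul_eq_mul]
  refine Finset.sum_le_card_nsmul _ _ _ fun u hu => ?_
  exact pi_card_bad_ge_le μ (A u) (hA u) (hp u hu) _ le_rfl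

section Gaussian

variable {E : Type*} [NormedAddCommGroup E] [InnerProductSpace ℝ E] [FiniteDimensional ℝ E]
  [MeasurableSpace E] [BorelSpace E] {ι : Type*} [Fintype ι]

theorem stdGaussian_abs_inner_ge_le {u : E} (hu : ‖u‖ = 1) {L : ℝ} (hL : 0 ≤ L) :
    stdGaussian E {x | L ≤ |⟪u, x⟫|} ≤ ENNReal.ofReal (2 * Real.exp (-L ^ 2 / 2)) := by
  refine le_trans (le_of_eq ?_) (gaussianReal_abs_ge_le hL)
  rw [← stdGaussian_map_inner_unit hu, Measure.map_apply (by fun_prop)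
    (measurableSet_le measurable_const (by fun_prop))]
  rfl

theorem stdGaussian_abs_add_mul_inner_lt_le {u : E} (hu : ‖u‖ = 1) (s : ℝ) {r t : ℝ} (ht : 0 < t) :
    stdGaussian E {x | |s + t * ⟪u, x⟫| < r} ≤ ENNReal.ofReal (r / t) := by
  refine le_trans (le_of_eq ?_) (gaussianReal_abs_add_mul_lt_le s ht)
  rw [← stdGaussian_map_inner_unit hu, Measure.map_apply (by fun_prop)
    (measurableSet_lt (by fun_prop) measurable_const)]
  rfl

theorem stdGaussian_inner_eq_zero {u : E} (hu : ‖u‖ = 1) (s : ℝ) :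
    stdGaussian E {x | ⟪u, x⟫ = s} = 0 := by
  have : NullSingletonClass (gaussianReal 0 1) := nullSingletonClass_gaussianReal one_ne_zero
  have h : stdGaussian E {x | ⟪u, x⟫ = s} = gaussianReal 0 1 {s} := by
    rw [← stdGaussian_map_inner_unit hu, Measure.map_apply (by fun_prop)
      (measurableSet_singleton s)]
    rfl
  rw [h, measure_singleton]

theorem pi_exists_abs_inner_ge_le {κ : Type*} [Fintype κ] (f : κ → E) (hf : ∀ s, ‖f s‖ = 1) {L : ℝ}
    (hL : 0 ≤ L) :
    (Measure.pi fun _ : ι => stdGaussian E) {a | ∃ i s, L ≤ |⟪f s, a i⟫|} ≤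
      Fintype.card ι * (Fintype.card κ * ENNReal.ofReal (2 * Real.exp (-L ^ 2 / 2))) := by
  have : {a : ι → E | ∃ i s, L ≤ |⟪f s, a i⟫|} = ⋃ i, ⋃ s, {a | L ≤ |⟪f s, a i⟫|} := by
    ext; simp
  rw [this]
  refine (measure_iUnion_fintype_le _ _).trans ?_
  rw [← nsmul_eq_mul]
  refine Finset.sum_le_card_nsmul _ _ _ fun i _ => ?_
  refine (measure_iUnion_fintype_le _ _).trans ?_
  rw [← nsmul_eq_mul]
  refine Finset.sum_le_card_nsmul _ _ _ fun s _ => ?_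
  refine le_trans (le_of_eq ?_) (stdGaussian_abs_inner_ge_le (hf s) hL)
  exact (measurePreserving_eval (fun _ : ι => stdGaussian E) i).measure_preimage
    (s := {x | L ≤ |⟪f s, x⟫|}) (measurableSet_le measurable_const (by fun_prop)).nullMeasurableSet

theorem lintegral_exp_sq_inner_div_four_le {u : E} (hu : ‖u‖ = 1) :
    ∫⁻ x, ENNReal.ofReal (Real.exp (⟪u, x⟫ ^ 2 / 4)) ∂(stdGaussian E) ≤
      ENNReal.ofReal (Real.exp (1 / 2)) := by
  refine le_trans (le_of_eq ?_) lintegral_exp_sq_div_four_gaussianReal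
  rw [← stdGaussian_map_inner_unit hu, lintegral_map (by fun_prop) (by fun_prop)]

theorem lintegral_exp_sum_sq_inner_div_four_le {u : E} (hu : ‖u‖ = 1) :
    ∫⁻ N, ENNReal.ofReal (Real.exp (∑ k, ⟪u, N k⟫ ^ 2 / 4))
        ∂(Measure.pi fun _ : ι => stdGaussian E) ≤
      ENNReal.ofReal (Real.exp (Fintype.card ι / 2)) := by
  refine (lintegral_exp_sum_pi_le _ (fun _ x => ⟪u, x⟫ ^ 2 / 4) (fun _ => by fun_prop)
    (fun _ => 1 / 2) fun _ => lintegral_exp_sq_inner_div_four_le hu).trans (le_of_eq ?_)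
  congr 2
  simp only [Finset.sum_const, Finset.card_univ, nsmul_eq_mul]; ring

/-- A bound for the sum of squares of a component over all members of independent groups. -/
theorem pi_sum_sum_sq_inner_ge_le {κ Ω' : Type*} [Fintype κ] [MeasurableSpace Ω'] {P : Measure Ω'}
    [IsProbabilityMeasure P] {Y : Ω' → κ → E}
    (hY : MeasurePreserving Y P (Measure.pi fun _ : κ => stdGaussian E)) {u : E} (hu : ‖u‖ = 1) :
    (Measure.pi fun _ : ι => P)
        {ω | 4 * (Fintype.card ι * Fintype.card κ : ℝ) ≤ ∑ j, ∑ k, ⟪u, Y (ω j) k⟫ ^ 2} ≤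
      ENNReal.ofReal (Real.exp (-(Fintype.card ι * Fintype.card κ : ℝ) / 2)) := by
  have hmeas : Measurable fun N : κ → E => ∑ k, ⟪u, N k⟫ ^ 2 / 4 :=
    Continuous.measurable (by fun_prop)
  have key := pi_sum_ge_le_exp (fun _ : ι => P) (fun _ ω => ∑ k, ⟪u, Y ω k⟫ ^ 2 / 4)
    (fun _ => hmeas.comp hY.measurable) (fun _ => (Fintype.card κ : ℝ) / 2) (fun _ => ?_)
    (Fintype.card ι * Fintype.card κ : ℝ)
  · refine (measure_mono fun ω hω => ?_).trans (key.trans (le_of_eq ?_))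
    · have hω : 4 * (Fintype.card ι * Fintype.card κ : ℝ) ≤ ∑ j, ∑ k, ⟪u, Y (ω j) k⟫ ^ 2 := hω
      simp only [Set.mem_ofPred_eq, ← Finset.sum_div]
      linarith
    · congr 2
      simp only [Finset.sum_const, Finset.card_univ, nsmul_eq_mul]; ring
  · refine le_trans (le_of_eq ?_) (lintegral_exp_sum_sq_inner_div_four_le (ι := κ) hu)
    exact hY.lintegral_comp (f := fun N => ENNReal.ofReal (Real.exp (∑ k, ⟪u, N k⟫ ^ 2 / 4)))
      (by fun_prop)

theorem pi_sum_sq_inner_ge_le {u : E} (hu : ‖u‖ = 1) :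
    (Measure.pi fun _ : ι => stdGaussian E) {a | 4 * (Fintype.card ι : ℝ) ≤ ∑ j, ⟪u, a j⟫ ^ 2} ≤
      ENNReal.ofReal (Real.exp (-(Fintype.card ι : ℝ) / 2)) := by
  have key := pi_sum_ge_le_exp (fun _ : ι => stdGaussian E) (fun _ x => ⟪u, x⟫ ^ 2 / 4)
    (fun _ => by fun_prop) (fun _ => 1 / 2) (fun _ => lintegral_exp_sq_inner_div_four_le hu)
    (Fintype.card ι : ℝ)
  refine (measure_mono fun ω hω => ?_).trans (key.trans (le_of_eq ?_))
  · have hω : 4 * (Fintype.card ι : ℝ) ≤ ∑ j, ⟪u, ω j⟫ ^ 2 := hω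
    simp only [Set.mem_ofPred_eq, ← Finset.sum_div]
    linarith
  · congr 2
    simp only [Finset.sum_const, Finset.card_univ, nsmul_eq_mul]; ring

theorem lintegral_exp_mul_inner_sub {u : E} (hu : ‖u‖ = 1) (s : ℝ) :
    ∫⁻ x, ENNReal.ofReal (Real.exp (s * ⟪u, x⟫ - s ^ 2 / 2)) ∂(stdGaussian E) = 1 := by
  have h1 : ∫⁻ x, ENNReal.ofReal (Real.exp (s * ⟪u, x⟫ - s ^ 2 / 2)) ∂(stdGaussian E) =
      ∫⁻ y, ENNReal.ofReal (Real.exp (s * y - s ^ 2 / 2)) ∂(gaussianReal 0 1) := by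
    rw [← stdGaussian_map_inner_unit hu, lintegral_map (by fun_prop) (by fun_prop)]
  have hint : Integrable (fun y => Real.exp (s * y)) (gaussianReal 0 1) :=
    integrable_exp_mul_gaussianReal s
  have hm : ∫ y, Real.exp (s * y) ∂(gaussianReal 0 1) = Real.exp (s ^ 2 / 2) := by
    have := congrFun (mgf_fun_id_gaussianReal (μ := 0) (v := 1)) s
    simpa [mgf] using this
  have hsub : ∀ y, Real.exp (s * y - s ^ 2 / 2) = Real.exp (s * y) * Real.exp (-(s ^ 2 / 2)) :=
    fun y => by rw [← Real.exp_add]; rfl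
  simp only [hsub] at h1 ⊢
  rw [h1, ← ofReal_integral_eq_lintegral_ofReal (hint.mul_const _)
    (Filter.Eventually.of_forall fun _ => by positivity), integral_mul_const, hm, ← Real.exp_add]
  simp

/-- Chernoff's bound with the normalized exponentials `exp (s α x - (s α)²/2)`, of mean one, at the
optimal `s² = 2 t / v`; the sign of `s` gives the two tails. -/
theorem pi_abs_sum_mul_inner_ge_le {u : E} (hu : ‖u‖ = 1) {α : ι → ℝ} {v t : ℝ} (hv : 0 < v)
    (ht : 0 ≤ t) (hα : ∑ i, α i ^ 2 ≤ v) :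
    (Measure.pi fun _ : ι => stdGaussian E) {ε | √(2 * v * t) ≤ |∑ i, α i * ⟪u, ε i⟫|} ≤
      2 * ENNReal.ofReal (Real.exp (-t)) := by
  have hone : ∀ s : ℝ, s ^ 2 = 2 * t / v → ∀ ε : ι → E, 2 * t ≤ s * ∑ i, α i * ⟪u, ε i⟫ →
      t ≤ ∑ i, (s * α i * ⟪u, ε i⟫ - (s * α i) ^ 2 / 2) := by
    intro s hs ε h
    rw [Finset.sum_sub_distrib, ← Finset.sum_div]
    simp only [mul_assoc, ← Finset.mul_sum, mul_pow, hs]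
    have : 2 * t / v * ∑ i, α i ^ 2 ≤ 2 * t / v * v := by gcongr
    rw [div_mul_cancel₀ _ hv.ne'] at this
    linarith
  have hprob : ∀ s : ℝ, (Measure.pi fun _ : ι => stdGaussian E)
      {ε | t ≤ ∑ i, (s * α i * ⟪u, ε i⟫ - (s * α i) ^ 2 / 2)} ≤ ENNReal.ofReal (Real.exp (-t)) := by
    intro s
    have := pi_sum_ge_le_exp (fun _ : ι => stdGaussian E)
      (fun i x => s * α i * ⟪u, x⟫ - (s * α i) ^ 2 / 2) (fun _ => by fun_prop) (fun _ => 0)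
      (fun i => by rw [lintegral_exp_mul_inner_sub hu]; simp) t
    simpa using this
  set s := √(2 * t / v) with hs
  have hs2 : s ^ 2 = 2 * t / v := Real.sq_sqrt (by positivity)
  have hss : s * √(2 * v * t) = 2 * t := by
    rw [hs, ← Real.sqrt_mul (by positivity)]
    have : 2 * t / v * (2 * v * t) = (2 * t) ^ 2 := by field_simp
    rw [this, Real.sqrt_sq (by positivity)]
  have hsub : {ε : ι → E | √(2 * v * t) ≤ |∑ i, α i * ⟪u, ε i⟫|} ⊆
      {ε | t ≤ ∑ i, (s * α i * ⟪u, ε i⟫ - (s * α i) ^ 2 / 2)} ∪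
        {ε | t ≤ ∑ i, (-s * α i * ⟪u, ε i⟫ - (-s * α i) ^ 2 / 2)} := by
    intro ε hε
    have hs0 : 0 ≤ s := Real.sqrt_nonneg _
    have hε : √(2 * v * t) ≤ |∑ i, α i * ⟪u, ε i⟫| := hε
    rcases le_abs.1 hε with h | h
    · exact Or.inl (hone s hs2 ε (by rw [← hss]; gcongr))
    · refine Or.inr (hone (-s) (by rw [neg_sq, hs2]) ε ?_)
      rw [neg_mul, ← mul_neg, ← hss]; gcongr
  refine (measure_mono hsub).trans ((measure_union_le _ _).trans ?_)
  rw [two_mul]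
  exact add_le_add (hprob s) (hprob (-s))

/-- Resample one noise with nonzero coefficient: its component along a unit vector would have to
take a single prescribed value. -/
theorem pi_sum_smul_eq_zero [DecidableEq ι] [Nontrivial E] {α : ι → ℝ} (hα : ∃ i, α i ≠ 0)
    (y : ι → E) {c : ℝ} (hc : c ≠ 0) :
    (Measure.pi fun _ : ι => stdGaussian E) {ε | ∑ i, α i • (y i + c • ε i) = 0} = 0 := by
  obtain ⟨i, hi⟩ := hα
  obtain ⟨w, hw⟩ := exists_norm_eq E (zero_le_one)
  have hmeas : MeasurableSet {ε : ι → E | ∑ i, α i • (y i + c • ε i) = 0} :=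
    measurableSet_eq_fun (Continuous.measurable (by fun_prop)) measurable_const
  rw [pi_apply_eq_lintegral_update _ i hmeas]
  have : ∀ ε : ι → E, stdGaussian E {x | Function.update ε i x ∈
      {ε : ι → E | ∑ i, α i • (y i + c • ε i) = 0}} = 0 := by
    intro ε
    set R := ∑ j ∈ Finset.univ.erase i, α j * ⟪w, y j + c • ε j⟫ with hR
    refine measure_mono_null ?_
      (stdGaussian_inner_eq_zero hw ((-R / α i - ⟪w, y i⟫) / c))
    intro x hx
    have hx : ∑ j, α j • (y j + c • Function.update ε i x j) = 0 := hx
    have h1 := congrArg (fun z => ⟪w, z⟫) hx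
    simp only [inner_sum, real_inner_smul_right, inner_zero_right] at h1
    rw [← Finset.add_sum_erase _ _ (Finset.mem_univ i), Function.update_self] at h1
    have h2 : ∑ j ∈ Finset.univ.erase i, α j * ⟪w, y j + c • Function.update ε i x j⟫ = R :=
      Finset.sum_congr rfl fun j hj => by rw [Function.update_of_ne (Finset.ne_of_mem_erase hj)]
    rw [h2, inner_add_right, real_inner_smul_right] at h1
    simp only [Set.mem_ofPred_eq]
    field_simp
    linarith
  simp only [this, lintegral_zero]

end Gaussian

/-! ### The group means -/

section Means

variable {E F : Type*}
  [NormedAddCommGroup E] [InnerProductSpace ℝ E] [FiniteDimensional ℝ E]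
  [NormedAddCommGroup F] [InnerProductSpace ℝ F] [FiniteDimensional ℝ F]
  {ι : Type*} [Fintype ι]

/-- Standardized group means and mean noises for which the regression on the group means is well
conditioned and accurate. -/
structure GoodMeans (T : Finset E) (b : E →L[ℝ] F) (c L t : ℝ) (p : (ι → E) × (ι → F)) : Prop where
  count : ∀ u ∈ T, ((Finset.univ.filter fun j => |⟪u, p.1 j⟫| < 1 / 6000).card : ℝ) ≤
    (Fintype.card ι : ℝ) / 8
  norm_le : ∀ j, ‖p.1 j‖ ≤ √(Module.finrank ℝ E) * L
  sum_sq_noise : ∑ j, ‖p.2 j‖ ^ 2 ≤ 4 * Fintype.card ι * Module.finrank ℝ F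
  cross : ∀ s, ‖∑ j, ⟪p.2 j, stdOrthonormalBasis ℝ F s⟫ • p.1 j‖ ^ 2 ≤
    Module.finrank ℝ E * (8 * Fintype.card ι * t)
  nonzero : c ≠ 0 → ∃ v, ∑ j, ⟪p.1 j, v⟫ • (b (p.1 j) + c • p.2 j) ≠ 0

theorem norm_le_sqrt_finrank_mul {x : E} {L : ℝ} (hL : 0 ≤ L)
    (h : ∀ s, |⟪stdOrthonormalBasis ℝ E s, x⟫| ≤ L) : ‖x‖ ≤ √(Module.finrank ℝ E) * L := by
  refine le_of_sq_le_sq ?_ (by positivity)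
  rw [← (stdOrthonormalBasis ℝ E).sum_sq_inner_right, mul_pow, Real.sq_sqrt (Nat.cast_nonneg _)]
  calc ∑ s, ⟪stdOrthonormalBasis ℝ E s, x⟫ ^ 2 ≤ ∑ _s : Fin (Module.finrank ℝ E), L ^ 2 := by
        refine Finset.sum_le_sum fun s _ => ?_
        rw [← sq_abs]
        exact pow_le_pow_left₀ (abs_nonneg _) (h s) 2
    _ = _ := by simp

variable [MeasurableSpace E] [BorelSpace E] [MeasurableSpace F] [BorelSpace F]

/-- A union bound over five failures. The cross terms are handled conditionally on the features,
which is why sums of squares of the coordinates of the features are controlled as well; the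
vanishing of the response sums in a net direction `v₀` is a null event. -/
theorem prod_not_goodMeans_le [DecidableEq ι] [Nonempty ι] [Nontrivial F] {T : Finset E}
    (hT : ∀ u ∈ T, ‖u‖ = 1) (hTne : T.Nonempty) (b : E →L[ℝ] F) (c : ℝ) {L t : ℝ} (hL : 0 ≤ L)
    (ht : 0 ≤ t) :
    ((Measure.pi fun _ : ι => stdGaussian E).prod (Measure.pi fun _ : ι => stdGaussian F))
        {p | ¬ GoodMeans T b c L t p} ≤
      T.card * ENNReal.ofReal (Real.exp (-(Fintype.card ι : ℝ) / 2)) +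
      Fintype.card ι * (Module.finrank ℝ E * ENNReal.ofReal (2 * Real.exp (-L ^ 2 / 2))) +
      Module.finrank ℝ F * ENNReal.ofReal (Real.exp (-(Fintype.card ι : ℝ) / 2)) +
      (Module.finrank ℝ E * ENNReal.ofReal (Real.exp (-(Fintype.card ι : ℝ) / 2)) +
        Module.finrank ℝ F * (Module.finrank ℝ E * (2 * ENNReal.ofReal (Real.exp (-t))))) := by
  set μ := Measure.pi fun _ : ι => stdGaussian E
  set ν := Measure.pi fun _ : ι => stdGaussian F
  set eE := stdOrthonormalBasis ℝ E
  set eF := stdOrthonormalBasis ℝ F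
  obtain ⟨v₀, hv₀⟩ := hTne
  have hcard : (0 : ℝ) < Fintype.card ι := by exact_mod_cast Fintype.card_pos
  let B₁ : Set (ι → E) := {a | ∃ u ∈ T, (Fintype.card ι : ℝ) / 8 ≤
    ((Finset.univ.filter fun i => a i ∈ {x : E | |⟪u, x⟫| < 1 / 6000}).card : ℝ)}
  let B₂ : Set (ι → E) := {a | ∃ j s, L ≤ |⟪eE s, a j⟫|}
  let B₃ : Set (ι → F) := ⋃ s, {ε | 4 * (Fintype.card ι : ℝ) ≤ ∑ j, ⟪eF s, ε j⟫ ^ 2}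
  let B₄' : Set (ι → E) := ⋃ r, {a | 4 * (Fintype.card ι : ℝ) ≤ ∑ j, ⟪eE r, a j⟫ ^ 2}
  let B₄ : Set ((ι → E) × (ι → F)) := ⋃ s, ⋃ r,
    {p | √(2 * (4 * Fintype.card ι) * t) ≤ |∑ j, ⟪eE r, p.1 j⟫ * ⟪eF s, p.2 j⟫|}
  let B₅ : Set ((ι → E) × (ι → F)) := {p | (∃ i, ⟪p.1 i, v₀⟫ ≠ 0) ∧ c ≠ 0 ∧
    ∑ j, ⟪p.1 j, v₀⟫ • (b (p.1 j) + c • p.2 j) = 0}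
  have h₁ : μ B₁ ≤ T.card * ENNReal.ofReal (Real.exp (-(Fintype.card ι : ℝ) / 2)) := by
    refine pi_exists_card_bad_ge_le (fun _ : ι => stdGaussian E) T
      (fun u _ => {x : E | |⟪u, x⟫| < 1 / 6000})
      (fun u i => measurableSet_lt (by fun_prop) measurable_const) fun u hu i => ?_
    have := stdGaussian_abs_add_mul_inner_lt_le (hT u hu) 0 (r := 1 / 6000) one_pos
    simpa using this
  have h₂ : μ B₂ ≤ Fintype.card ι * (Module.finrank ℝ E *
      ENNReal.ofReal (2 * Real.exp (-L ^ 2 / 2))) := by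
    have := pi_exists_abs_inner_ge_le (ι := ι) eE eE.orthonormal.1 hL
    rwa [Fintype.card_fin] at this
  have h₃ : ν B₃ ≤ Module.finrank ℝ F *
      ENNReal.ofReal (Real.exp (-(Fintype.card ι : ℝ) / 2)) := by
    refine (measure_iUnion_fintype_le _ _).trans ?_
    refine (Finset.sum_le_card_nsmul _ _ _ fun s _ =>
      pi_sum_sq_inner_ge_le (eF.orthonormal.1 s)).trans (le_of_eq ?_)
    simp [nsmul_eq_mul]
  have h₄' : μ B₄' ≤ Module.finrank ℝ E *
      ENNReal.ofReal (Real.exp (-(Fintype.card ι : ℝ) / 2)) := by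
    refine (measure_iUnion_fintype_le _ _).trans ?_
    refine (Finset.sum_le_card_nsmul _ _ _ fun s _ =>
      pi_sum_sq_inner_ge_le (eE.orthonormal.1 s)).trans (le_of_eq ?_)
    simp [nsmul_eq_mul]
  have h₄ : (μ.prod ν) B₄ ≤ Module.finrank ℝ E *
      ENNReal.ofReal (Real.exp (-(Fintype.card ι : ℝ) / 2)) +
        Module.finrank ℝ F * (Module.finrank ℝ E * (2 * ENNReal.ofReal (Real.exp (-t)))) := by
    have hm : MeasurableSet B₄ := MeasurableSet.iUnion fun s => MeasurableSet.iUnion fun r =>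
      measurableSet_le measurable_const (Continuous.measurable (by fun_prop))
    refine (prod_apply_le_of_section_le μ ν hm B₄' _ fun a ha => ?_).trans
      (add_le_add h₄' le_rfl)
    simp only [B₄', Set.mem_iUnion, not_exists] at ha
    have hsec : {ε | (a, ε) ∈ B₄} = ⋃ s, ⋃ r, {ε : ι → F |
        √(2 * (4 * Fintype.card ι) * t) ≤ |∑ j, ⟪eE r, a j⟫ * ⟪eF s, ε j⟫|} := by
      ext ε; simp [B₄]
    rw [hsec]
    refine (measure_iUnion_fintype_le _ _).trans ?_
    refine (Finset.sum_le_card_nsmul _ _ (Module.finrank ℝ E * (2 * ENNReal.ofReal (Real.exp (-t))))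
      fun s _ => ?_).trans (le_of_eq (by simp [nsmul_eq_mul]))
    refine (measure_iUnion_fintype_le _ _).trans ?_
    refine (Finset.sum_le_card_nsmul _ _ (2 * ENNReal.ofReal (Real.exp (-t)))
      fun r _ => ?_).trans (le_of_eq (by simp [nsmul_eq_mul]))
    refine pi_abs_sum_mul_inner_ge_le (eF.orthonormal.1 s) (by positivity) ht ?_
    have := ha r
    simp only [Set.mem_ofPred_eq, not_le] at this
    exact this.le
  have h₅ : (μ.prod ν) B₅ = 0 := by
    have hm₀ : MeasurableSet {p : (ι → E) × (ι → F) | ∃ i, ⟪p.1 i, v₀⟫ ≠ 0} := by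
      have : {p : (ι → E) × (ι → F) | ∃ i, ⟪p.1 i, v₀⟫ ≠ 0} = ⋃ i, {p | ⟪p.1 i, v₀⟫ = 0}ᶜ := by
        ext; simp
      rw [this]
      exact MeasurableSet.iUnion fun i =>
        (measurableSet_eq_fun (Continuous.measurable (by fun_prop)) measurable_const).compl
    have hm : MeasurableSet B₅ := hm₀.inter (MeasurableSet.inter (MeasurableSet.const _)
      (measurableSet_eq_fun (Continuous.measurable (by fun_prop)) measurable_const))
    have := prod_apply_le_of_section_le μ ν hm ∅ 0 fun a _ => ?_
    · simpa using this
    · refine le_of_eq ?_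
      by_cases h : (∃ i, ⟪a i, v₀⟫ ≠ 0) ∧ c ≠ 0
      · refine measure_mono_null (fun ε hε => ?_)
          (pi_sum_smul_eq_zero h.1 (fun j => b (a j)) h.2)
        exact hε.2.2
      · have : {ε | (a, ε) ∈ B₅} = ∅ := by
          ext ε
          simp only [Set.mem_empty_iff_false, iff_false]
          exact fun hε => h ⟨hε.1, hε.2.1⟩
        rw [this, measure_empty]
  have hsub : {p : (ι → E) × (ι → F) | ¬ GoodMeans T b c L t p} ⊆
      (B₁ ×ˢ Set.univ ∪ B₂ ×ˢ Set.univ ∪ Set.univ ×ˢ B₃ ∪ B₄) ∪ B₅ := by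
    intro p hp
    by_contra hcon
    refine hp ?_
    simp only [Set.mem_union, Set.mem_prod, Set.mem_univ, and_true, true_and, not_or] at hcon
    obtain ⟨⟨⟨⟨n₁, n₂⟩, n₃⟩, n₄⟩, n₅⟩ := hcon
    have q₁ : ∀ u ∈ T, ((Finset.univ.filter fun j => |⟪u, p.1 j⟫| < 1 / 6000).card : ℝ) <
        (Fintype.card ι : ℝ) / 8 := by
      intro u hu
      by_contra h
      exact n₁ ⟨u, hu, not_lt.1 h⟩
    have q₂ : ∀ j s, |⟪eE s, p.1 j⟫| ≤ L := fun j s => by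
      by_contra h
      exact n₂ ⟨j, s, (not_le.1 h).le⟩
    have q₃ : ∀ s, ∑ j, ⟪eF s, p.2 j⟫ ^ 2 ≤ 4 * (Fintype.card ι : ℝ) := fun s => by
      by_contra h
      exact n₃ (Set.mem_iUnion.2 ⟨s, (not_le.1 h).le⟩)
    have q₄ : ∀ s r, |∑ j, ⟪eE r, p.1 j⟫ * ⟪eF s, p.2 j⟫| ≤
        √(2 * (4 * Fintype.card ι) * t) := fun s r => by
      by_contra h
      exact n₄ (Set.mem_iUnion.2 ⟨s, Set.mem_iUnion.2 ⟨r, (not_le.1 h).le⟩⟩)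
    refine ⟨fun u hu => (q₁ u hu).le, fun j => norm_le_sqrt_finrank_mul hL (q₂ j), ?_, ?_, ?_⟩
    · calc ∑ j, ‖p.2 j‖ ^ 2 = ∑ s, ∑ j, ⟪eF s, p.2 j⟫ ^ 2 := by
            rw [Finset.sum_comm]
            exact Finset.sum_congr rfl fun j _ => (eF.sum_sq_inner_right _).symm
        _ ≤ ∑ _s : Fin (Module.finrank ℝ F), 4 * (Fintype.card ι : ℝ) :=
            Finset.sum_le_sum fun s _ => q₃ s
        _ = _ := by simp; ring
    · intro s
      calc ‖∑ j, ⟪p.2 j, eF s⟫ • p.1 j‖ ^ 2 =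
            ∑ r, (∑ j, ⟪eE r, p.1 j⟫ * ⟪eF s, p.2 j⟫) ^ 2 := by
            rw [← eE.sum_sq_inner_right]
            refine Finset.sum_congr rfl fun r _ => ?_
            simp only [inner_sum, real_inner_smul_right]
            congr 1
            exact Finset.sum_congr rfl fun j _ => by rw [mul_comm, real_inner_comm (eF s)]
        _ ≤ ∑ _r : Fin (Module.finrank ℝ E), 8 * Fintype.card ι * t := by
            refine Finset.sum_le_sum fun r _ => ?_
            rw [← sq_abs]
            have := pow_le_pow_left₀ (abs_nonneg _) (q₄ s r) 2
            rw [Real.sq_sqrt (by positivity)] at this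
            linarith
        _ = _ := by simp
    -- If all the features were orthogonal to `v₀`, every group would count as having a small
    -- component along `v₀`, against the bound of one eighth. So the null event `B₅` is the only
    -- obstruction.
    · intro hc
      refine ⟨v₀, fun h0 => n₅ ⟨?_, hc, h0⟩⟩
      by_contra hall
      push Not at hall
      have h1 := q₁ v₀ hv₀
      have h2 : (Finset.univ.filter fun j => |⟪v₀, p.1 j⟫| < 1 / 6000) = Finset.univ := by
        refine Finset.filter_true_of_mem fun j _ => ?_
        rw [real_inner_comm, hall j]; norm_num
      rw [h2, Finset.card_univ] at h1
      linarith
  refine (measure_mono hsub).trans ((measure_union_le _ _).trans ?_)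
  rw [h₅, add_zero]
  refine (measure_union_le _ _).trans (add_le_add ?_ h₄)
  refine (measure_union_le _ _).trans (add_le_add ((measure_union_le _ _).trans
    (add_le_add ?_ ?_)) ?_)
  · rw [Measure.prod_prod, measure_univ, mul_one]; exact h₁
  · rw [Measure.prod_prod, measure_univ, mul_one]; exact h₂
  · rw [Measure.prod_prod, measure_univ, one_mul]; exact h₃

end Means

/-! ### Conditioning and accuracy of the regression on the group means -/

section MeansConsequences

variable {E F : Type*}
  [NormedAddCommGroup E] [InnerProductSpace ℝ E]
  [NormedAddCommGroup F] [InnerProductSpace ℝ F] [FiniteDimensional ℝ F]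
  {ι : Type*} [Fintype ι] {T : Finset E} {b : E →L[ℝ] F} {c L t η : ℝ} {p : (ι → E) × (ι → F)}

/-- The lower bound for the normalized Gram matrix of the group means. -/
noncomputable def gramConst : ℝ := 7 / 8 * (1 / 6000 / 2) ^ 2

theorem gramConst_pos : 0 < gramConst := by unfold gramConst; positivity

theorem GoodMeans.gram (h : GoodMeans T b c L t p)
    (hT : ∀ u : E, ‖u‖ = 1 → ∃ u' ∈ T, ‖u - u'‖ ≤ η)
    (hη : √(Module.finrank ℝ E) * L * η ≤ 1 / 6000 / 2) (v : E) :
    Fintype.card ι * gramConst * ‖v‖ ^ 2 ≤ ∑ i, ⟪p.1 i, v⟫ ^ 2 := by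
  have := gram_lower_bound_of_net (c := 7 / 8 * Fintype.card ι) hT h.norm_le hη (by norm_num)
    (fun u hu => ?_) v
  · refine le_trans (le_of_eq ?_) this
    rw [gramConst]; ring
  · have h1 := h.count u hu
    have h2 := Finset.card_filter_add_card_filter_not (s := (Finset.univ : Finset ι))
      (fun i => |⟪u, p.1 i⟫| < 1 / 6000)
    simp only [not_lt, Finset.card_univ] at h2
    have h3 : ((Finset.univ.filter fun j => |⟪u, p.1 j⟫| < 1 / 6000).card : ℝ) +
      ((Finset.univ.filter fun j => 1 / 6000 ≤ |⟪u, p.1 j⟫|).card : ℝ) = Fintype.card ι := by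
      exact_mod_cast h2
    linarith

variable {A : E →L[ℝ] F} {r r' : ℝ}

/-- If the fit vanished, the normal equations would make all the cross sums of features and
responses vanish. A nonzero fit is what excludes ties between nearest neighbours. -/
theorem GoodMeans.map_ne_zero (h : GoodMeans T b (r' / r) L t p) (hr : 0 < r) (hr' : r' ≠ 0)
    (hA : ∀ v, ∑ i, ⟪r • p.1 i, v⟫ • A (r • p.1 i) =
      ∑ i, ⟪r • p.1 i, v⟫ • (b (r • p.1 i) + r' • p.2 i)) : A ≠ 0 := by
  rintro rfl
  obtain ⟨v, hv⟩ := h.nonzero (div_ne_zero hr' hr.ne')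
  refine hv ?_
  have h1 := hA v
  simp only [zero_apply, smul_zero, Finset.sum_const_zero] at h1
  have h2 : ∑ i, ⟪r • p.1 i, v⟫ • (b (r • p.1 i) + r' • p.2 i) =
      (r ^ 2) • ∑ i, ⟪p.1 i, v⟫ • (b (p.1 i) + (r' / r) • p.2 i) := by
    rw [Finset.smul_sum]
    refine Finset.sum_congr rfl fun i _ => ?_
    have h3 : r' = r * (r' / r) := by field_simp
    conv_lhs => rw [h3]
    rw [real_inner_smul_left, map_smul]
    generalize r' / r = q
    module
  rw [h2] at h1
  exact (smul_eq_zero.1 h1.symm).resolve_left (by positivity)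

variable [FiniteDimensional ℝ E]

/-- Each cross term has squared norm at most of order `d m t`, against the squared Gram bound of
order `m²`; scaling features by `r` and noise by `r'` leaves the ratio `(r' / r)²`. -/
theorem GoodMeans.sq_norm_sub_le [Nonempty ι] (h : GoodMeans T b c L t p) (hr : 0 < r)
    (hgram : ∀ v, Fintype.card ι * gramConst * ‖v‖ ^ 2 ≤ ∑ i, ⟪p.1 i, v⟫ ^ 2)
    (hA : ∀ v, ∑ i, ⟪r • p.1 i, v⟫ • A (r • p.1 i) =
      ∑ i, ⟪r • p.1 i, v⟫ • (b (r • p.1 i) + r' • p.2 i)) :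
    ‖A - b‖ ^ 2 ≤ 8 * Module.finrank ℝ F * Module.finrank ℝ E * t /
      (gramConst ^ 2 * Fintype.card ι) * (r' / r) ^ 2 := by
  have hcard : (0 : ℝ) < Fintype.card ι := by exact_mod_cast Fintype.card_pos
  have hg := gramConst_pos
  refine (sq_opNorm_sub_le_sum_cross (b := b) (stdOrthonormalBasis ℝ F) hA
    (r := r ^ 2 * (Fintype.card ι * gramConst)) (by positivity) fun v => ?_).trans ?_
  · simp only [real_inner_smul_left, mul_pow, ← Finset.mul_sum]
    rw [mul_assoc]
    gcongr
    exact hgram v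
  · calc _ ≤ ∑ _s : Fin (Module.finrank ℝ F), (r' / r) ^ 2 *
          (Module.finrank ℝ E * (8 * Fintype.card ι * t)) / (Fintype.card ι * gramConst) ^ 2 := by
          refine Finset.sum_le_sum fun s _ => ?_
          have e1 : ∑ i, ⟪b (r • p.1 i) + r' • p.2 i - b (r • p.1 i), stdOrthonormalBasis ℝ F s⟫ •
              r • p.1 i = (r' * r) • ∑ i, ⟪p.2 i, stdOrthonormalBasis ℝ F s⟫ • p.1 i := by
            rw [Finset.smul_sum]
            refine Finset.sum_congr rfl fun i _ => ?_
            rw [add_sub_cancel_left, real_inner_smul_left, smul_smul, smul_smul]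
            congr 1; ring
          rw [e1, norm_smul, div_pow, mul_pow, Real.norm_eq_abs, sq_abs]
          have e2 : (r' * r) ^ 2 * ‖∑ i, ⟪p.2 i, stdOrthonormalBasis ℝ F s⟫ • p.1 i‖ ^ 2 /
              (r ^ 2 * (Fintype.card ι * gramConst)) ^ 2 =
              (r' / r) ^ 2 * ‖∑ i, ⟪p.2 i, stdOrthonormalBasis ℝ F s⟫ • p.1 i‖ ^ 2 /
                (Fintype.card ι * gramConst) ^ 2 := by
            field_simp
          rw [e2]
          gcongr
          exact h.cross s
      _ = _ := by
          rw [Finset.sum_const, Finset.card_univ, Fintype.card_fin, nsmul_eq_mul]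
          field_simp

theorem GoodMeans.sum_sq_norm_map_sub_le (h : GoodMeans T b c L t p)
    (hA : ∀ v, ∑ i, ⟪r • p.1 i, v⟫ • A (r • p.1 i) =
      ∑ i, ⟪r • p.1 i, v⟫ • (b (r • p.1 i) + r' • p.2 i)) :
    ∑ i, ‖(A - b) (r • p.1 i)‖ ^ 2 ≤ r' ^ 2 * (4 * Fintype.card ι * Module.finrank ℝ F) := by
  refine (_root_.sum_sq_norm_map_sub_le (b := b) hA).trans ?_
  simp only [add_sub_cancel_left, norm_smul, mul_pow, Real.norm_eq_abs, sq_abs, ← Finset.mul_sum]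
  gcongr
  exact h.sum_sq_noise

end MeansConsequences

/-! ### The deviations within the groups -/

section AssignedFar

variable {E F : Type*} [NormedAddCommGroup E] [InnerProductSpace ℝ E]
  [NormedAddCommGroup F] [InnerProductSpace ℝ F] {κ : Type*}

/-- Every nearest neighbour of the `k`-th response has a component at least `s` along `u`. -/
def AssignedFar (A b : E →L[ℝ] F) (x : κ → E) (e : κ → F) (u : E) (s : ℝ) (k : κ) : Prop :=
  ∀ k', (∀ k'', ‖b (x k) + e k - A (x k')‖ ≤ ‖b (x k) + e k - A (x k'')‖) → s ≤ |⟪u, x k'⟫|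

theorem AssignedFar.mono {A b : E →L[ℝ] F} {x : κ → E} {e : κ → F} {u : E} {s s' : ℝ} {k : κ}
    (h : AssignedFar A b x e u s k) (hs : s' ≤ s) : AssignedFar A b x e u s' k :=
  fun k' hk' => hs.trans (h k' hk')

variable [FiniteDimensional ℝ E] [MeasurableSpace E]
  [BorelSpace E] [FiniteDimensional ℝ F] [MeasurableSpace F] [BorelSpace F]

theorem measurableSet_assignedFar {Ω : Type*} [MeasurableSpace Ω] [Finite κ]
    {A : Ω → E →L[ℝ] F} (hA : Measurable A) (b : E →L[ℝ] F) {x : Ω → κ → E} (hx : Measurable x)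
    {e : Ω → κ → F} (he : Measurable e) (u : E) (s : ℝ) (k : κ) :
    MeasurableSet {ω | AssignedFar (A ω) b (x ω) (e ω) u s k} := by
  have hxk : ∀ k, Measurable fun ω => x ω k := fun k => (measurable_pi_apply k).comp hx
  have hek : ∀ k, Measurable fun ω => e ω k := fun k => (measurable_pi_apply k).comp he
  have hAx : ∀ k, Measurable fun ω => A ω (x ω k) := fun k =>
    ContinuousLinearMap.measurable_apply₂.comp (hA.prodMk (hxk k))
  refine measurableSet_forall_minimizer
    (r := fun k' ω => ‖b (x ω k) + e ω k - A ω (x ω k')‖)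
    (P := fun k' => {ω | s ≤ |⟪u, x ω k'⟫|}) (fun k' => ?_) fun k' => ?_
  · exact (((b.continuous.measurable.comp (hxk k)).add (hek k)).sub (hAx k')).norm
  · have := hxk k'
    exact measurableSet_le measurable_const (by fun_prop)

end AssignedFar

section Deviations

variable {E F : Type*}
  [NormedAddCommGroup E] [InnerProductSpace ℝ E] [FiniteDimensional ℝ E] [MeasurableSpace E]
  [BorelSpace E]
  [NormedAddCommGroup F] [InnerProductSpace ℝ F] [FiniteDimensional ℝ F] [MeasurableSpace F]
  [BorelSpace F]
  {ι κ : Type*} [Fintype ι] [Fintype κ]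

variable (E F ι κ) in
/-- The law of the standardized deviations and noises of all the groups. -/
noncomputable abbrev deviationLaw : Measure (ι → (κ → E) × (κ → F)) :=
  Measure.pi fun _ : ι =>
    (Measure.pi fun _ : κ => stdGaussian E).prod (Measure.pi fun _ : κ => stdGaussian F)

open Classical in
/-- Most responses are assigned to features with a large component along `u`. -/
theorem deviationLaw_card_assignedFar_lt_le [Nonempty κ] {A b : E →L[ℝ] F} (hA : A ≠ 0) {u : E}
    (hu : ‖u‖ = 1) {l : ℕ} (hl : Module.finrank ℝ F = l) {σ₂ σₑ : ℝ} (hσ₂ : 0 ≤ σ₂)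
    (hσₑ : 0 ≤ σₑ) (a : ι → E) (ē : ι → F)
    (hκ : 160 * nnConst l * (l + 1) ≤ Fintype.card κ)
    (hΔ : σ₂ * ‖A - b‖ ≤ 1 / (8 * nnConst l * (l + 1)) * σₑ) (J : Finset ι) {s : ℝ}
    (hJ : ∀ j ∈ J, ‖ē j - (A - b) (a j)‖ ≤ σₑ)
    (hs : ∀ j ∈ J, s ≤ |⟪u, a j⟫| + σ₂ * (1 / (4 * √(l + 1)))) :
    deviationLaw E F ι κ {ω | ((Finset.univ.filter fun q : ι × κ =>
        AssignedFar A b (groupPoint (a q.1) σ₂ (ω q.1).1) (groupPoint (ē q.1) σₑ (ω q.1).2) u s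
          q.2).card : ℝ) < assignProb l * J.card / 4 * Fintype.card κ} ≤
      ENNReal.ofReal (Real.exp (-(assignProb l * J.card / 4))) := by
  have hcard : (0 : ℝ) < Fintype.card κ := by exact_mod_cast Fintype.card_pos
  let D : ι → κ → Set ((κ → E) × (κ → F)) := fun j k =>
    {p | AssignedFar A b (groupPoint (a j) σ₂ p.1) (groupPoint (ē j) σₑ p.2) u s k}
  have hD : ∀ j k, MeasurableSet (D j k) := fun j k => by
    refine measurableSet_assignedFar measurable_const b
      (x := fun p : (κ → E) × (κ → F) => groupPoint (a j) σ₂ p.1)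
      (e := fun p : (κ → E) × (κ → F) => groupPoint (ē j) σₑ p.2) ?_ ?_ u s k
    · exact measurable_pi_lambda _ fun k =>
        (continuous_groupPoint (a j) σ₂ k).measurable.comp measurable_fst
    · exact measurable_pi_lambda _ fun k =>
        (continuous_groupPoint (ē j) σₑ k).measurable.comp measurable_snd
  -- Assignments within a group are dependent. The proportions of favourable responses per group are
  -- independent with values in `[0,1]`, so the Chernoff bound is applied to them.
  let f : ι → (κ → E) × (κ → F) → ℝ := fun j p =>
    (Fintype.card κ : ℝ)⁻¹ * ∑ k, (D j k).indicator (fun _ => 1) p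
  have hind0 : ∀ j k p, 0 ≤ (D j k).indicator (fun _ => (1 : ℝ)) p := fun j k p =>
    Set.indicator_nonneg (fun _ _ => zero_le_one) p
  have hind1 : ∀ j k p, (D j k).indicator (fun _ => (1 : ℝ)) p ≤ 1 := fun j k p =>
    Set.indicator_le_self' (fun _ _ => zero_le_one) p
  have key := pi_sum_le_le_exp (fun _ : ι => (Measure.pi fun _ : κ => stdGaussian E).prod
      (Measure.pi fun _ : κ => stdGaussian F)) f
    (fun j => (Finset.measurable_sum _ fun k _ =>
      measurable_const.indicator (hD j k)).const_mul _)
    (fun j p => mul_nonneg (by positivity) (Finset.sum_nonneg fun k _ => hind0 j k p))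
    (fun j p => by
      rw [inv_mul_le_iff₀ hcard, mul_one]
      refine (Finset.sum_le_sum fun k _ => hind1 j k p).trans (le_of_eq ?_)
      simp)
    J (assignProb l) (fun j hj => ?_)
  · refine (measure_mono fun ω hω => ?_).trans key
    have hω : ((Finset.univ.filter fun q : ι × κ =>
        AssignedFar A b (groupPoint (a q.1) σ₂ (ω q.1).1) (groupPoint (ē q.1) σₑ (ω q.1).2) u s
          q.2).card : ℝ) < assignProb l * J.card / 4 * Fintype.card κ := hω
    have hcount : ((Finset.univ.filter fun q : ι × κ =>
        AssignedFar A b (groupPoint (a q.1) σ₂ (ω q.1).1) (groupPoint (ē q.1) σₑ (ω q.1).2) u s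
          q.2).card : ℝ) = ∑ j, ∑ k, (D j k).indicator (fun _ => (1 : ℝ)) (ω j) := by
      rw [Finset.card_filter, Nat.cast_sum, Fintype.sum_prod_type]
      refine Finset.sum_congr rfl fun j _ => Finset.sum_congr rfl fun k _ => ?_
      simp [D, Set.indicator_apply]
    rw [hcount] at hω
    simp only [Set.mem_ofPred_eq, f, ← Finset.mul_sum]
    rw [inv_mul_le_iff₀ hcard]
    linarith
  · have hint : ∀ k, Integrable (fun p => (D j k).indicator (fun _ => (1 : ℝ)) p)
        ((Measure.pi fun _ : κ => stdGaussian E).prod (Measure.pi fun _ : κ => stdGaussian F)) :=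
      fun k => (integrable_const _).indicator (hD j k)
    simp only [f]
    rw [integral_const_mul, integral_finsetSum _ fun k _ => hint k, le_inv_mul_iff₀ hcard]
    have hk : ∀ k, assignProb l ≤ ∫ p, (D j k).indicator (fun _ => (1 : ℝ)) p
        ∂((Measure.pi fun _ : κ => stdGaussian E).prod
          (Measure.pi fun _ : κ => stdGaussian F)) := by
      intro k
      rw [integral_indicator_const _ (hD j k), smul_eq_mul, mul_one]
      refine (ENNReal.ofReal_le_iff_le_toReal (measure_ne_top _ _)).1 ?_
      refine (ofReal_assignProb_le hA hu hl hσ₂ hσₑ (hJ j hj) hκ hΔ k).trans (measure_mono ?_)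
      intro p hp
      exact AssignedFar.mono hp (hs j hj)
    calc (Fintype.card κ : ℝ) * assignProb l = ∑ _k : κ, assignProb l := by simp
      _ ≤ _ := Finset.sum_le_sum fun k _ => hk k

/-- Standardized deviations and noises which are not exceptionally large, also after applying
the linear map `D`. -/
structure GoodDeviations (D : E →L[ℝ] F) (L : ℝ) (ω : ι → (κ → E) × (κ → F)) : Prop where
  norm_le : ∀ j k, ‖(ω j).1 k‖ ≤ √(Module.finrank ℝ E) * L
  sum_sq_map : ∑ j, ∑ k, ‖D ((ω j).1 k)‖ ^ 2 ≤
    4 * (Fintype.card ι * Fintype.card κ) * (Module.finrank ℝ F * ‖D‖ ^ 2)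
  sum_sq_noise : ∑ j, ∑ k, ‖(ω j).2 k‖ ^ 2 ≤
    4 * (Fintype.card ι * Fintype.card κ) * Module.finrank ℝ F

/-- Here `D` is fixed, so `‖D x‖²` splits into the squares of `⟪D* f, x⟫` for a basis `f` of the
target space. One chi-square bound for each of these few directions avoids a factor of the dimension
of `E`. -/
theorem deviationLaw_not_goodDeviations_le (D : E →L[ℝ] F) {L : ℝ} (hL : 0 ≤ L) :
    deviationLaw E F ι κ {ω | ¬ GoodDeviations D L ω} ≤
      Fintype.card ι * (Fintype.card κ *
        (Module.finrank ℝ E * ENNReal.ofReal (2 * Real.exp (-L ^ 2 / 2)))) +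
      Module.finrank ℝ F *
        ENNReal.ofReal (Real.exp (-(Fintype.card ι * Fintype.card κ : ℝ) / 2)) +
      Module.finrank ℝ F *
        ENNReal.ofReal (Real.exp (-(Fintype.card ι * Fintype.card κ : ℝ) / 2)) := by
  set μ := Measure.pi fun _ : κ => stdGaussian E
  set ν := Measure.pi fun _ : κ => stdGaussian F
  set eE := stdOrthonormalBasis ℝ E
  set eF := stdOrthonormalBasis ℝ F
  have hfst : MeasurePreserving (Prod.fst : (κ → E) × (κ → F) → κ → E) (μ.prod ν) μ :=
    measurePreserving_fst
  have hsnd : MeasurePreserving (Prod.snd : (κ → E) × (κ → F) → κ → F) (μ.prod ν) ν :=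
    measurePreserving_snd
  let w : Fin (Module.finrank ℝ F) → E := fun s => D.adjoint (eF s)
  let B₁ : Set (ι → (κ → E) × (κ → F)) := ⋃ j, {ω | ∃ k s, L ≤ |⟪eE s, (ω j).1 k⟫|}
  -- The inequality is strict so that the event is empty when `w s = 0`.
  let B₂ : Set (ι → (κ → E) × (κ → F)) := ⋃ s, {ω |
    4 * (Fintype.card ι * Fintype.card κ : ℝ) * ‖w s‖ ^ 2 < ∑ j, ∑ k, ⟪w s, (ω j).1 k⟫ ^ 2}
  let B₃ : Set (ι → (κ → E) × (κ → F)) := ⋃ s, {ω |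
    4 * (Fintype.card ι * Fintype.card κ : ℝ) ≤ ∑ j, ∑ k, ⟪eF s, (ω j).2 k⟫ ^ 2}
  have h₁ : deviationLaw E F ι κ B₁ ≤ Fintype.card ι * (Fintype.card κ *
        (Module.finrank ℝ E * ENNReal.ofReal (2 * Real.exp (-L ^ 2 / 2)))) := by
    refine (measure_iUnion_fintype_le _ _).trans ?_
    refine (Finset.sum_le_card_nsmul _ _ _ fun j _ => ?_).trans
      (le_of_eq (by rw [nsmul_eq_mul, Finset.card_univ]))
    have hm : MeasurableSet {N : κ → E | ∃ k s, L ≤ |⟪eE s, N k⟫|} := by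
      have : {N : κ → E | ∃ k s, L ≤ |⟪eE s, N k⟫|} = ⋃ k, ⋃ s, {N | L ≤ |⟪eE s, N k⟫|} := by
        ext; simp
      rw [this]
      exact MeasurableSet.iUnion fun k => MeasurableSet.iUnion fun s =>
        measurableSet_le measurable_const (by fun_prop)
    have h := (hfst.comp (measurePreserving_eval (fun _ : ι => μ.prod ν) j)).measure_preimage
      hm.nullMeasurableSet
    refine (le_of_eq h).trans ?_
    have := pi_exists_abs_inner_ge_le (ι := κ) eE eE.orthonormal.1 hL
    rwa [Fintype.card_fin] at this
  have h₂ : deviationLaw E F ι κ B₂ ≤ Module.finrank ℝ F *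
        ENNReal.ofReal (Real.exp (-(Fintype.card ι * Fintype.card κ : ℝ) / 2)) := by
    refine (measure_iUnion_fintype_le _ _).trans ?_
    refine (Finset.sum_le_card_nsmul _ _
      (ENNReal.ofReal (Real.exp (-(Fintype.card ι * Fintype.card κ : ℝ) / 2)))
      fun s _ => ?_).trans (le_of_eq (by simp [nsmul_eq_mul]))
    rcases eq_or_ne (w s) 0 with h0 | h0
    · simp [h0]
    have hw : 0 < ‖w s‖ := norm_pos_iff.2 h0
    refine (measure_mono fun ω hω => ?_).trans (pi_sum_sum_sq_inner_ge_le (ι := ι) hfst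
      (u := ‖w s‖⁻¹ • w s) (norm_smul_inv_norm (𝕜 := ℝ) h0))
    have hω : 4 * (Fintype.card ι * Fintype.card κ : ℝ) * ‖w s‖ ^ 2 <
      ∑ j, ∑ k, ⟪w s, (ω j).1 k⟫ ^ 2 := hω
    simp only [Set.mem_ofPred_eq, real_inner_smul_left, mul_pow, ← Finset.mul_sum]
    rw [inv_pow, le_inv_mul_iff₀ (by positivity)]
    linarith
  have h₃ : deviationLaw E F ι κ B₃ ≤ Module.finrank ℝ F *
        ENNReal.ofReal (Real.exp (-(Fintype.card ι * Fintype.card κ : ℝ) / 2)) := by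
    refine (measure_iUnion_fintype_le _ _).trans ?_
    refine (Finset.sum_le_card_nsmul _ _
      (ENNReal.ofReal (Real.exp (-(Fintype.card ι * Fintype.card κ : ℝ) / 2)))
      fun s _ => ?_).trans (le_of_eq (by simp [nsmul_eq_mul]))
    exact pi_sum_sum_sq_inner_ge_le (ι := ι) hsnd (eF.orthonormal.1 s)
  have hsub : {ω : ι → (κ → E) × (κ → F) | ¬ GoodDeviations D L ω} ⊆ B₁ ∪ B₂ ∪ B₃ := by
    intro ω hω
    by_contra hcon
    refine hω ?_
    simp only [Set.mem_union, not_or] at hcon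
    obtain ⟨⟨n₁, n₂⟩, n₃⟩ := hcon
    have q₁ : ∀ j k s, |⟪eE s, (ω j).1 k⟫| ≤ L := fun j k s => by
      by_contra h
      exact n₁ (Set.mem_iUnion.2 ⟨j, k, s, (not_le.1 h).le⟩)
    have q₂ : ∀ s, ∑ j, ∑ k, ⟪w s, (ω j).1 k⟫ ^ 2 ≤
        4 * (Fintype.card ι * Fintype.card κ : ℝ) * ‖w s‖ ^ 2 := fun s => by
      by_contra h
      exact n₂ (Set.mem_iUnion.2 ⟨s, not_le.1 h⟩)
    have q₃ : ∀ s, ∑ j, ∑ k, ⟪eF s, (ω j).2 k⟫ ^ 2 ≤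
        4 * (Fintype.card ι * Fintype.card κ : ℝ) := fun s => by
      by_contra h
      exact n₃ (Set.mem_iUnion.2 ⟨s, (not_le.1 h).le⟩)
    have hw : ∀ s, ‖w s‖ ^ 2 ≤ ‖D‖ ^ 2 := fun s => by
      have := D.adjoint.le_opNorm (eF s)
      rw [eF.orthonormal.1 s, mul_one, LinearIsometryEquiv.norm_map] at this
      exact pow_le_pow_left₀ (norm_nonneg _) this 2
    have hswap : ∀ h : Fin (Module.finrank ℝ F) → ι → κ → ℝ,
        ∑ j, ∑ k, ∑ s, h s j k = ∑ s, ∑ j, ∑ k, h s j k := by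
      intro h
      rw [Finset.sum_comm]
      refine (Finset.sum_congr rfl fun j _ => Finset.sum_comm).trans ?_
      rw [Finset.sum_comm]
      refine Finset.sum_congr rfl fun s _ => Finset.sum_comm
    refine ⟨fun j k => norm_le_sqrt_finrank_mul hL (q₁ j k), ?_, ?_⟩
    · calc ∑ j, ∑ k, ‖D ((ω j).1 k)‖ ^ 2 = ∑ j, ∑ k, ∑ s, ⟪w s, (ω j).1 k⟫ ^ 2 := by
            refine Finset.sum_congr rfl fun j _ => Finset.sum_congr rfl fun k _ => ?_
            rw [← eF.sum_sq_inner_right]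
            simp only [w, ContinuousLinearMap.adjoint_inner_left]
        _ = ∑ s, ∑ j, ∑ k, ⟪w s, (ω j).1 k⟫ ^ 2 := hswap _
        _ ≤ ∑ _s : Fin (Module.finrank ℝ F),
              4 * (Fintype.card ι * Fintype.card κ : ℝ) * ‖D‖ ^ 2 :=
            Finset.sum_le_sum fun s _ => (q₂ s).trans (mul_le_mul_of_nonneg_left (hw s) (by positivity))
        _ = _ := by simp; ring
    · calc ∑ j, ∑ k, ‖(ω j).2 k‖ ^ 2 = ∑ j, ∑ k, ∑ s, ⟪eF s, (ω j).2 k⟫ ^ 2 := by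
            refine Finset.sum_congr rfl fun j _ => Finset.sum_congr rfl fun k _ => ?_
            rw [← eF.sum_sq_inner_right]
        _ = ∑ s, ∑ j, ∑ k, ⟪eF s, (ω j).2 k⟫ ^ 2 := hswap _
        _ ≤ ∑ _s : Fin (Module.finrank ℝ F), 4 * (Fintype.card ι * Fintype.card κ : ℝ) :=
            Finset.sum_le_sum fun s _ => q₃ s
        _ = _ := by simp; ring
  refine (measure_mono hsub).trans ((measure_union_le _ _).trans (add_le_add ?_ h₃))
  exact (measure_union_le _ _).trans (add_le_add h₁ h₂)

end Deviations

/-! ### Regression on the assigned features -/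

section Assigned

variable {E F : Type*}
  [NormedAddCommGroup E] [InnerProductSpace ℝ E]
  [NormedAddCommGroup F] [InnerProductSpace ℝ F]
  {ι κ : Type*} [Fintype ι] [Fintype κ]
  {A b : E →L[ℝ] F} {x : ι → κ → E} {e : ι → κ → F} {π : ι → Equiv.Perm κ} {a : ι → κ → κ}

open Classical in
theorem gram_assigned_of_far {T : Finset E} {η M s θ : ℝ}
    (hT : ∀ u : E, ‖u‖ = 1 → ∃ u' ∈ T, ‖u - u'‖ ≤ η)
    (hx : ∀ j k, ‖x j k‖ ≤ M) (hη : M * η ≤ s / 2) (hs : 0 ≤ s)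
    (hfar : ∀ u ∈ T, θ ≤ ((Finset.univ.filter fun q : ι × κ =>
      AssignedFar A b (x q.1) (e q.1) u s q.2).card : ℝ))
    (ha : ∀ j i k, ‖b (x j (π j i)) + e j (π j i) - A (x j (a j i))‖ ≤
      ‖b (x j (π j i)) + e j (π j i) - A (x j k)‖) (v : E) :
    θ * (s / 2) ^ 2 * ‖v‖ ^ 2 ≤ ∑ q : ι × κ, ⟪x q.1 (a q.1 q.2), v⟫ ^ 2 := by
  refine gram_lower_bound_of_net (x := fun q : ι × κ => x q.1 (a q.1 q.2)) hT
    (fun q => hx _ _) hη hs (fun u hu => (hfar u hu).trans ?_) v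
  have : (Finset.univ.filter fun q : ι × κ => AssignedFar A b (x q.1) (e q.1) u s q.2).card ≤
      (Finset.univ.filter fun q : ι × κ => s ≤ |⟪u, x q.1 (a q.1 q.2)⟫|).card := by
    refine Finset.card_le_card_of_injOn (fun q => (q.1, (π q.1).symm q.2)) ?_ ?_
    · rintro ⟨j, k⟩ hq
      have hq : AssignedFar A b (x j) (e j) u s k := (Finset.mem_filter.1 hq).2
      refine Finset.mem_coe.2 (Finset.mem_filter.2 ⟨Finset.mem_univ _, ?_⟩)
      refine hq _ fun k'' => ?_
      have := ha j ((π j).symm k) k''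
      rwa [Equiv.apply_symm_apply] at this
    · rintro ⟨j, k⟩ - ⟨j', k'⟩ - h
      simp only [Prod.mk.injEq] at h
      obtain ⟨rfl, h⟩ := h
      rw [(π j).symm.injective h]
  exact_mod_cast this

/-- The chosen feature does at least as well as the true partner of the response, whose residual is
the noise minus the effect of the fitting error. -/
theorem sum_sq_residual_le
    (ha : ∀ j i k, ‖b (x j (π j i)) + e j (π j i) - A (x j (a j i))‖ ≤
      ‖b (x j (π j i)) + e j (π j i) - A (x j k)‖) :
    ∑ q : ι × κ, ‖b (x q.1 (π q.1 q.2)) + e q.1 (π q.1 q.2) - A (x q.1 (a q.1 q.2))‖ ^ 2 ≤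
      ∑ j, ∑ k, ‖e j k - (A - b) (x j k)‖ ^ 2 := by
  rw [Fintype.sum_prod_type]
  refine Finset.sum_le_sum fun j _ => ?_
  rw [← Equiv.sum_comp (π j) fun k => ‖e j k - (A - b) (x j k)‖ ^ 2]
  refine Finset.sum_le_sum fun i _ => ?_
  refine pow_le_pow_left₀ (norm_nonneg _) ((ha j i (π j i)).trans (le_of_eq ?_)) 2
  congr 1
  rw [sub_apply]; abel

end Assigned

/-! ### Samples as families of vectors -/

section Sample

variable {m g d l : ℕ}

/-- The regression on the group sums, as a linear map. -/
noncomputable def groupFit {ι κ : Type*} [Fintype ι] [Fintype κ]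
    (b : EuclideanSpace ℝ (Fin d) →L[ℝ] EuclideanSpace ℝ (Fin l))
    (D : (ι → κ → EuclideanSpace ℝ (Fin d)) × (ι → κ → EuclideanSpace ℝ (Fin l))) :
    EuclideanSpace ℝ (Fin d) →L[ℝ] EuclideanSpace ℝ (Fin l) :=
  transposeMap (LR (fun j => (∑ k, D.1 j k).ofLp) fun j => (∑ k, (b (D.1 j k) + D.2 j k)).ofLp)

variable {B : Matrix (Fin d) (Fin l) ℝ} {x : Fin m → Fin g → EuclideanSpace ℝ (Fin d)}
  {e : Fin m → Fin g → EuclideanSpace ℝ (Fin l)} {X : Fin m → Matrix (Fin g) (Fin d) ℝ}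
  {Z N : Fin m → Matrix (Fin g) (Fin l) ℝ} {π : Fin m → Equiv.Perm (Fin g)}

theorem groupSums_eq_ofLp (hX : ∀ j k, X j k = (x j k).ofLp) (j : Fin m) :
    groupSums X j = (∑ k, x j k).ofLp := by
  ext i
  simp [groupSums, Matrix.vecMul, dotProduct, hX]

theorem responses_row (hX : ∀ j k, X j k = (x j k).ofLp) (hN : ∀ j k, N j k = (e j k).ofLp)
    (j : Fin m) (i : Fin g) :
    responses π X B N j i = (transposeMap B (x j (π j i)) + e j (π j i)).ofLp := by
  ext s
  rw [responses, Equiv.Perm.permMatrix, PEquiv.toMatrix_toPEquiv_mul]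
  simp only [Matrix.submatrix_apply, Matrix.add_apply, id, Matrix.mul_apply]
  simp [transposeMap_apply, Matrix.mulVec, dotProduct, hN, ← hX, mul_comm]

/-- Summing over a group removes the permutation, however it was selected. -/
theorem transposeMap_estNoAS (hX : ∀ j k, X j k = (x j k).ofLp)
    (hN : ∀ j k, N j k = (e j k).ofLp) (hZ : Z = responses π X B N) :
    transposeMap (estNoAS X Z) = groupFit (transposeMap B) (x, e) := by
  rw [estNoAS, groupFit]
  congr 2
  · exact funext (groupSums_eq_ofLp hX)
  · funext j
    rw [hZ, groupSums_eq_ofLp (x := fun j i => transposeMap B (x j (π j i)) + e j (π j i))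
      (fun j k => responses_row hX hN j k)]
    congr 1
    exact Equiv.sum_comp (π j) fun k => transposeMap B (x j k) + e j k

open Classical in
/-- On a good sample the regression with assignment is well posed and accurate. -/
theorem estAS_of_good (hX : ∀ j k, X j k = (x j k).ofLp)
    (hN : ∀ j k, N j k = (e j k).ofLp) (hZ : Z = responses π X B N)
    {assign : Fin m → Fin g → Fin g} (hassign : IsAssignment X Z (estNoAS X Z) assign)
    {T : Finset (EuclideanSpace ℝ (Fin d))} {η M s θ Q : ℝ}
    (hT : ∀ u : EuclideanSpace ℝ (Fin d), ‖u‖ = 1 → ∃ u' ∈ T, ‖u - u'‖ ≤ η)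
    (hx : ∀ j k, ‖x j k‖ ≤ M) (hη : M * η ≤ s / 2) (hs : 0 < s) (hθ : 0 < θ)
    (hfar : ∀ u ∈ T, θ ≤ ((Finset.univ.filter fun q : Fin m × Fin g =>
      AssignedFar (groupFit (transposeMap B) (x, e)) (transposeMap B) (x q.1) (e q.1) u s
        q.2).card : ℝ))
    (hQ : ∑ j, ∑ k, ‖e j k - (groupFit (transposeMap B) (x, e) - transposeMap B) (x j k)‖ ^ 2 ≤
      Q) :
    LRWellPosed (assigned X assign) ∧
      ‖estAS X Z assign - estNoAS X Z‖ ^ 2 ≤ Q / (θ * (s / 2) ^ 2) := by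
  have hA := transposeMap_estNoAS hX hN hZ
  set A := groupFit (transposeMap B) (x, e) with hAdef
  have hr : 0 < θ * (s / 2) ^ 2 := by positivity
  have hz : ∀ j i, Z j i = (transposeMap B (x j (π j i)) + e j (π j i)).ofLp := fun j i => by
    rw [hZ]; exact responses_row hX hN j i
  have hres : ∀ j i k, WithLp.toLp 2 (Z j i - (estNoAS X Z)ᵀ *ᵥ X j k) =
      transposeMap B (x j (π j i)) + e j (π j i) - A (x j k) := fun j i k => by
    rw [← hA, transposeMap_apply (estNoAS X Z), ← hX, hz, WithLp.toLp_sub, WithLp.toLp_ofLp]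
  have ha : ∀ j i k, ‖transposeMap B (x j (π j i)) + e j (π j i) - A (x j (assign j i))‖ ≤
      ‖transposeMap B (x j (π j i)) + e j (π j i) - A (x j k)‖ := fun j i k => by
    rw [← hres, ← hres]; exact hassign j i k
  have hgram := gram_assigned_of_far hT hx hη hs.le hfar ha
  have hass : assigned X assign = fun q : Fin m × Fin g => (x q.1 (assign q.1 q.2)).ofLp :=
    funext fun q => hX _ _
  have hwp : LRWellPosed fun q : Fin m × Fin g => (x q.1 (assign q.1 q.2)).ofLp :=
    lrWellPosed_of_pos fun v hv => by
      have := norm_pos_iff.2 hv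
      exact lt_of_lt_of_le (by positivity) (hgram v)
  refine ⟨hass ▸ hwp, ?_⟩
  rw [← norm_transposeMap_sub, hA]
  have hAS : transposeMap (estAS X Z assign) =
      transposeMap (LR (fun q : Fin m × Fin g => (x q.1 (assign q.1 q.2)).ofLp) fun q =>
        (transposeMap B (x q.1 (π q.1 q.2)) + e q.1 (π q.1 q.2)).ofLp) := by
    rw [estAS, hass]
    congr 2
    exact funext fun q => hz _ _
  rw [hAS]
  refine (sq_opNorm_sub_le (sum_inner_smul_LR hwp) hr hgram).trans ?_
  gcongr
  exact (sum_sq_residual_le ha).trans hQ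

end Sample

/-! ### Measurability -/

section Measurability

variable {d l : ℕ} {Ω ι : Type*} [MeasurableSpace Ω] [Fintype ι]

theorem measurable_transposeMap {M : Ω → Matrix (Fin d) (Fin l) ℝ}
    (hM : ∀ i j, Measurable fun ω => M ω i j) : Measurable fun ω => transposeMap (M ω) := by
  have h : ∀ ω, transposeMap (M ω) =
      ∑ i, ∑ j, M ω i j • transposeMap (Matrix.single i j (1 : ℝ)) := by
    intro ω
    ext v s
    conv_lhs => rw [Matrix.matrix_eq_sum_single (M ω)]
    simp only [transposeMap_apply, sum_apply, smul_apply, Matrix.transpose_sum, Matrix.sum_mulVec]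
    simp only [WithLp.ofLp_sum, Finset.sum_apply, PiLp.smul_apply, smul_eq_mul]
    refine Finset.sum_congr rfl fun i _ => Finset.sum_congr rfl fun j _ => ?_
    simp only [Matrix.transpose_single, Matrix.single_mulVec]
    by_cases hs : s = j
    · subst hs; simp
    · simp [Function.update_of_ne hs]
  simp only [h]
  exact Finset.measurable_sum _ fun i _ => Finset.measurable_sum _ fun j _ =>
    (hM i j).smul_const _

/-- The inverse is the adjugate times the inverse of the determinant, with value zero for singular
matrices, so the entries are measurable without an invertibility assumption. -/
theorem measurable_transposeMap_LR {x : Ω → ι → EuclideanSpace ℝ (Fin d)} (hx : Measurable x)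
    {z : Ω → ι → EuclideanSpace ℝ (Fin l)} (hz : Measurable z) :
    Measurable fun ω => transposeMap (LR (fun i => (x ω i).ofLp) fun i => (z ω i).ofLp) := by
  have hxe : ∀ i a, Measurable fun ω => (x ω i) a := fun i a =>
    (measurable_pi_apply a).comp ((PiLp.continuous_ofLp 2 _).measurable.comp
      ((measurable_pi_apply i).comp hx))
  have hze : ∀ i a, Measurable fun ω => (z ω i) a := fun i a =>
    (measurable_pi_apply a).comp ((PiLp.continuous_ofLp 2 _).measurable.comp
      ((measurable_pi_apply i).comp hz))
  let G : (ι → EuclideanSpace ℝ (Fin d)) → Matrix (Fin d) (Fin d) ℝ := fun y =>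
    ∑ i, Matrix.vecMulVec (y i).ofLp (y i).ofLp
  have hG : Continuous G := by
    refine continuous_finsetSum _ fun i _ => ?_
    exact Continuous.matrix_vecMulVec (by fun_prop) (by fun_prop)
  have hdet : Measurable fun ω => (G (x ω)).det := hG.matrix_det.measurable.comp hx
  have hadj : ∀ a c, Measurable fun ω => (G (x ω)).adjugate a c := fun a c =>
    (hG.matrix_adjugate.matrix_elem a c).measurable.comp hx
  have hinv : ∀ a c, Measurable fun ω => (G (x ω))⁻¹ a c := fun a c => by
    simp only [Matrix.inv_def, Ring.inverse_eq_inv', Matrix.smul_apply, smul_eq_mul]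
    exact hdet.inv.mul (hadj a c)
  refine measurable_transposeMap fun a s => ?_
  have : ∀ ω, LR (fun i => (x ω i).ofLp) (fun i => (z ω i).ofLp) a s =
      ∑ c, (G (x ω))⁻¹ a c * ∑ i, x ω i c * z ω i s := by
    intro ω
    simp only [LR, G, Matrix.mul_apply, Matrix.sum_apply, Matrix.vecMulVec_apply]
  simp only [this]
  exact Finset.measurable_sum _ fun c _ => (hinv a c).mul
    (Finset.measurable_sum _ fun i _ => (hxe i c).mul (hze i s))

theorem measurable_groupFit {κ : Type*} [Fintype κ]
    (b : EuclideanSpace ℝ (Fin d) →L[ℝ] EuclideanSpace ℝ (Fin l)) :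
    Measurable (groupFit b (ι := ι) (κ := κ)) :=
  measurable_transposeMap_LR
    (x := fun D : (ι → κ → EuclideanSpace ℝ (Fin d)) × (ι → κ → EuclideanSpace ℝ (Fin l)) =>
      fun j => ∑ k, D.1 j k)
    (z := fun D => fun j => ∑ k, (b (D.1 j k) + D.2 j k))
    (Continuous.measurable (by fun_prop)) (Continuous.measurable (by fun_prop))

open Classical in
theorem measurableSet_forall_le_card {β : Type*} (T : Finset β) {q : Type*} [Fintype q]
    {P : β → q → Ω → Prop} (hP : ∀ u i, MeasurableSet {ω | P u i ω}) (θ : ℝ) :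
    MeasurableSet {ω | ∀ u ∈ T, θ ≤ ((Finset.univ.filter fun i => P u i ω).card : ℝ)} := by
  have : {ω | ∀ u ∈ T, θ ≤ ((Finset.univ.filter fun i => P u i ω).card : ℝ)} =
      ⋂ u ∈ T, {ω | θ ≤ ∑ i, ({ω | P u i ω}).indicator (fun _ => (1 : ℝ)) ω} := by
    ext ω
    simp only [Set.mem_iInter, Set.mem_ofPred_eq, Finset.card_filter, Nat.cast_sum,
      Set.indicator_apply, Nat.cast_ite, Nat.cast_one, Nat.cast_zero]
  rw [this]
  exact MeasurableSet.biInter (Finset.countable_toSet T) fun u _ =>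
    measurableSet_le measurable_const (Finset.measurable_sum _ fun i _ =>
      measurable_const.indicator (hP u i))

theorem measurableSet_lrWellPosed {x : Ω → ι → EuclideanSpace ℝ (Fin d)} (hx : Measurable x) :
    MeasurableSet {ω | LRWellPosed fun i => (x ω i).ofLp} := by
  let G : (ι → EuclideanSpace ℝ (Fin d)) → Matrix (Fin d) (Fin d) ℝ := fun y =>
    ∑ i, Matrix.vecMulVec (y i).ofLp (y i).ofLp
  have hG : Continuous G := by
    refine continuous_finsetSum _ fun i _ => ?_
    exact Continuous.matrix_vecMulVec (by fun_prop) (by fun_prop)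
  have hdet : Measurable fun ω => (G (x ω)).det := hG.matrix_det.measurable.comp hx
  have : {ω | LRWellPosed fun i => (x ω i).ofLp} = {ω | (G (x ω)).det = 0}ᶜ := by
    ext ω
    simp only [LRWellPosed, Set.mem_ofPred_eq, Set.mem_compl_iff, Matrix.isUnit_iff_isUnit_det,
      isUnit_iff_ne_zero, G, ne_eq]
  rw [this]
  exact (measurableSet_eq_fun hdet measurable_const).compl

end Measurability

/-! ### Good samples -/

section GroupData

variable {E F : Type*} [NormedAddCommGroup E] [NormedSpace ℝ E] [NormedAddCommGroup F]
  [NormedSpace ℝ F] {ι κ : Type*} [Fintype κ]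

/-- Features and noises with prescribed standardized group means and deviations. -/
noncomputable def groupData (τ σ₂ τ' σₑ : ℝ)
    (q : ((ι → E) × (ι → F)) × (ι → (κ → E) × (κ → F))) : (ι → κ → E) × (ι → κ → F) :=
  (fun j => groupPoint (τ • q.1.1 j) σ₂ (q.2 j).1, fun j => groupPoint (τ' • q.1.2 j) σₑ (q.2 j).2)

theorem norm_groupPoint_le (a : E) {σ B : ℝ} (hσ : 0 ≤ σ) {N : κ → E} (hN : ∀ k, ‖N k‖ ≤ B)
    (k : κ) : ‖groupPoint a σ N k‖ ≤ ‖a‖ + σ * (2 * B) := by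
  have hc : (0 : ℝ) < Fintype.card κ := by exact_mod_cast Fintype.card_pos_iff.2 ⟨k⟩
  have h1 : ‖(Fintype.card κ : ℝ)⁻¹ • ∑ k', N k'‖ ≤ B := by
    rw [norm_smul, norm_inv, Real.norm_eq_abs, abs_of_pos hc, inv_mul_le_iff₀ hc]
    refine (norm_sum_le _ _).trans ((Finset.sum_le_sum fun k' _ => hN k').trans (le_of_eq ?_))
    simp
  refine (norm_add_le _ _).trans ?_
  rw [norm_smul, Real.norm_eq_abs, abs_of_nonneg hσ]
  gcongr
  refine (norm_sub_le _ _).trans ?_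
  have := hN k
  linarith

end GroupData

/-! ### Mean square errors with respect to the first fit -/

section Errors

variable {E F : Type*}
  [NormedAddCommGroup E] [InnerProductSpace ℝ E] [FiniteDimensional ℝ E]
  [NormedAddCommGroup F] [InnerProductSpace ℝ F] [FiniteDimensional ℝ F]
  {ι κ : Type*} [Fintype ι] [Fintype κ] [Nonempty κ]
  {T : Finset E} {b A : E →L[ℝ] F} {c L t τ σ₂ τ' σₑ σₓ : ℝ}
  {p : (ι → E) × (ι → F)} {ω : ι → (κ → E) × (κ → F)}

/-- The fitting errors at the group sums are a projection of the noise sums. Their size is thus free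
of the dimension `d`; dividing by the group size gives the same for the means. -/
theorem GoodMeans.sum_sq_map_smul_le (h : GoodMeans T b c L t p)
    (hA : ∀ v, ∑ i, ⟪((Fintype.card κ : ℝ) * τ) • p.1 i, v⟫ • A (((Fintype.card κ : ℝ) * τ) • p.1 i) =
      ∑ i, ⟪((Fintype.card κ : ℝ) * τ) • p.1 i, v⟫ •
        (b (((Fintype.card κ : ℝ) * τ) • p.1 i) + ((Fintype.card κ : ℝ) * τ') • p.2 i)) :
    ∑ j, ‖(A - b) (τ • p.1 j)‖ ^ 2 ≤ τ' ^ 2 * (4 * Fintype.card ι * Module.finrank ℝ F) := by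
  have hc : (0 : ℝ) < Fintype.card κ := by exact_mod_cast Fintype.card_pos
  have h1 := h.sum_sq_norm_map_sub_le hA
  have h2 : ∑ i, ‖(A - b) (((Fintype.card κ : ℝ) * τ) • p.1 i)‖ ^ 2 =
      (Fintype.card κ : ℝ) ^ 2 * ∑ j, ‖(A - b) (τ • p.1 j)‖ ^ 2 := by
    rw [Finset.mul_sum]
    refine Finset.sum_congr rfl fun i _ => ?_
    rw [mul_smul, map_smul, norm_smul, mul_pow, Real.norm_eq_abs, sq_abs]
  rw [h2, mul_pow, mul_assoc] at h1
  exact le_of_mul_le_mul_left h1 (by positivity)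

/-- The mean square error of the responses with respect to the fitted map. -/
theorem sum_sq_error_le (h : GoodMeans T b c L t p)
    (hA : ∀ v, ∑ i, ⟪((Fintype.card κ : ℝ) * τ) • p.1 i, v⟫ • A (((Fintype.card κ : ℝ) * τ) • p.1 i) =
      ∑ i, ⟪((Fintype.card κ : ℝ) * τ) • p.1 i, v⟫ •
        (b (((Fintype.card κ : ℝ) * τ) • p.1 i) + ((Fintype.card κ : ℝ) * τ') • p.2 i))
    (hω : GoodDeviations (A - b) L ω) (hτ' : Fintype.card κ * τ' ^ 2 = σₑ ^ 2)
    (hσ₂ : σ₂ ^ 2 ≤ σₓ ^ 2) :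
    ∑ j, ∑ k, ‖groupPoint (τ' • p.2 j) σₑ (ω j).2 k -
        (A - b) (groupPoint (τ • p.1 j) σ₂ (ω j).1 k)‖ ^ 2 ≤
      24 * (Fintype.card ι * Fintype.card κ) * Module.finrank ℝ F *
        (σₑ ^ 2 + σₓ ^ 2 * ‖A - b‖ ^ 2) := by
  have hc : (1 : ℝ) ≤ Fintype.card κ := by exact_mod_cast Fintype.card_pos
  set m : ℝ := (Fintype.card ι : ℝ)
  set g : ℝ := (Fintype.card κ : ℝ)
  set l : ℝ := (Module.finrank ℝ F : ℝ)
  have hm0 : 0 ≤ m := Nat.cast_nonneg _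
  have hl0 : 0 ≤ l := Nat.cast_nonneg _
  have h1 : ∑ j, ∑ k, ‖groupPoint (τ' • p.2 j) σₑ (ω j).2 k‖ ^ 2 ≤ 8 * (m * g) * l * σₑ ^ 2 := by
    calc ∑ j, ∑ k, ‖groupPoint (τ' • p.2 j) σₑ (ω j).2 k‖ ^ 2
        ≤ ∑ j, (g * ‖τ' • p.2 j‖ ^ 2 + σₑ ^ 2 * ∑ k, ‖(ω j).2 k‖ ^ 2) :=
          Finset.sum_le_sum fun j _ => sum_sq_norm_groupPoint_le _ _ _
      _ = g * τ' ^ 2 * ∑ j, ‖p.2 j‖ ^ 2 + σₑ ^ 2 * ∑ j, ∑ k, ‖(ω j).2 k‖ ^ 2 := by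
          rw [Finset.sum_add_distrib, ← Finset.mul_sum, ← Finset.mul_sum]
          simp only [norm_smul, mul_pow, Real.norm_eq_abs, sq_abs, ← Finset.mul_sum]
          ring
      _ ≤ σₑ ^ 2 * (4 * m * l) + σₑ ^ 2 * (4 * (m * g) * l) := by
          rw [hτ']
          gcongr
          · exact h.sum_sq_noise
          · exact hω.sum_sq_noise
      _ ≤ 8 * (m * g) * l * σₑ ^ 2 := by
          have : 0 ≤ σₑ ^ 2 * (m * l) * (g - 1) := by
            have := sub_nonneg.2 hc
            positivity
          nlinarith
  have h2 : ∑ j, ∑ k, ‖(A - b) (groupPoint (τ • p.1 j) σ₂ (ω j).1 k)‖ ^ 2 ≤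
      4 * (m * g) * l * (σₑ ^ 2 + σₓ ^ 2 * ‖A - b‖ ^ 2) := by
    calc ∑ j, ∑ k, ‖(A - b) (groupPoint (τ • p.1 j) σ₂ (ω j).1 k)‖ ^ 2
        ≤ ∑ j, (g * ‖(A - b) (τ • p.1 j)‖ ^ 2 + σ₂ ^ 2 * ∑ k, ‖(A - b) ((ω j).1 k)‖ ^ 2) := by
          refine Finset.sum_le_sum fun j _ => ?_
          simp only [map_groupPoint (A - b)]
          exact sum_sq_norm_groupPoint_le _ _ _
      _ = g * ∑ j, ‖(A - b) (τ • p.1 j)‖ ^ 2 + σ₂ ^ 2 * ∑ j, ∑ k, ‖(A - b) ((ω j).1 k)‖ ^ 2 := by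
          rw [Finset.sum_add_distrib, ← Finset.mul_sum, ← Finset.mul_sum]
      _ ≤ g * (τ' ^ 2 * (4 * m * l)) + σₓ ^ 2 * (4 * (m * g) * (l * ‖A - b‖ ^ 2)) := by
          gcongr
          · exact h.sum_sq_map_smul_le hA
          · exact hω.sum_sq_map
      _ = σₑ ^ 2 * (4 * m * l) + σₓ ^ 2 * (4 * (m * g) * (l * ‖A - b‖ ^ 2)) := by
          rw [← hτ']; ring
      _ ≤ 4 * (m * g) * l * (σₑ ^ 2 + σₓ ^ 2 * ‖A - b‖ ^ 2) := by
          have : 0 ≤ σₑ ^ 2 * (m * l) * (g - 1) := by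
            have := sub_nonneg.2 hc
            positivity
          nlinarith
  calc ∑ j, ∑ k, ‖groupPoint (τ' • p.2 j) σₑ (ω j).2 k -
        (A - b) (groupPoint (τ • p.1 j) σ₂ (ω j).1 k)‖ ^ 2
      ≤ ∑ j, ∑ k, (2 * ‖groupPoint (τ' • p.2 j) σₑ (ω j).2 k‖ ^ 2 +
          2 * ‖(A - b) (groupPoint (τ • p.1 j) σ₂ (ω j).1 k)‖ ^ 2) := by
        refine Finset.sum_le_sum fun j _ => Finset.sum_le_sum fun k _ => ?_
        have h3 := pow_le_pow_left₀ (norm_nonneg _)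
          (norm_sub_le (groupPoint (τ' • p.2 j) σₑ (ω j).2 k)
            ((A - b) (groupPoint (τ • p.1 j) σ₂ (ω j).1 k))) 2
        have h4 := add_sq_le (a := ‖groupPoint (τ' • p.2 j) σₑ (ω j).2 k‖)
          (b := ‖(A - b) (groupPoint (τ • p.1 j) σ₂ (ω j).1 k)‖)
        linarith
    _ = 2 * ∑ j, ∑ k, ‖groupPoint (τ' • p.2 j) σₑ (ω j).2 k‖ ^ 2 +
          2 * ∑ j, ∑ k, ‖(A - b) (groupPoint (τ • p.1 j) σ₂ (ω j).1 k)‖ ^ 2 := by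
        simp only [Finset.sum_add_distrib, ← Finset.mul_sum]
    _ ≤ _ := by
        have : 0 ≤ (m * g) * l * (σₓ ^ 2 * ‖A - b‖ ^ 2) := by
          have : 0 ≤ g := by linarith
          positivity
        nlinarith

open Classical in
/-- In most groups the mean noise after fitting is at most of the size of a single noise. -/
theorem three_quarters_card_le (h : GoodMeans T b c L t p)
    (hA : ∀ v, ∑ i, ⟪((Fintype.card κ : ℝ) * τ) • p.1 i, v⟫ • A (((Fintype.card κ : ℝ) * τ) • p.1 i) =
      ∑ i, ⟪((Fintype.card κ : ℝ) * τ) • p.1 i, v⟫ •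
        (b (((Fintype.card κ : ℝ) * τ) • p.1 i) + ((Fintype.card κ : ℝ) * τ') • p.2 i))
    (hτ' : Fintype.card κ * τ' ^ 2 = σₑ ^ 2) (hσₑ : 0 ≤ σₑ)
    (hg : 128 * (Module.finrank ℝ F : ℝ) ≤ Fintype.card κ) {u : E} (hu : u ∈ T) :
    3 / 4 * (Fintype.card ι : ℝ) ≤ ((Finset.univ.filter fun j =>
      ‖τ' • p.2 j - (A - b) (τ • p.1 j)‖ ≤ σₑ ∧ 1 / 6000 ≤ |⟪u, p.1 j⟫|).card : ℝ) := by
  have hc : (0 : ℝ) < Fintype.card κ := by exact_mod_cast Fintype.card_pos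
  have hsum : ∑ j, ‖τ' • p.2 j - (A - b) (τ • p.1 j)‖ ^ 2 ≤
      τ' ^ 2 * (16 * Fintype.card ι * Module.finrank ℝ F) := by
    calc ∑ j, ‖τ' • p.2 j - (A - b) (τ • p.1 j)‖ ^ 2
        ≤ ∑ j, (2 * ‖τ' • p.2 j‖ ^ 2 + 2 * ‖(A - b) (τ • p.1 j)‖ ^ 2) := by
          refine Finset.sum_le_sum fun j _ => ?_
          have h3 := pow_le_pow_left₀ (norm_nonneg _)
            (norm_sub_le (τ' • p.2 j) ((A - b) (τ • p.1 j))) 2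
          have h4 := add_sq_le (a := ‖τ' • p.2 j‖) (b := ‖(A - b) (τ • p.1 j)‖)
          linarith
      _ = 2 * (τ' ^ 2 * ∑ j, ‖p.2 j‖ ^ 2) + 2 * ∑ j, ‖(A - b) (τ • p.1 j)‖ ^ 2 := by
          simp only [Finset.sum_add_distrib, ← Finset.mul_sum, norm_smul, mul_pow,
            Real.norm_eq_abs, sq_abs]
      _ ≤ 2 * (τ' ^ 2 * (4 * Fintype.card ι * Module.finrank ℝ F)) +
          2 * (τ' ^ 2 * (4 * Fintype.card ι * Module.finrank ℝ F)) := by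
          gcongr
          · exact h.sum_sq_noise
          · exact h.sum_sq_map_smul_le hA
      _ = _ := by ring
  have hbad : ((Finset.univ.filter fun j => σₑ < ‖τ' • p.2 j - (A - b) (τ • p.1 j)‖).card : ℝ) ≤
      (Fintype.card ι : ℝ) / 8 := by
    rcases hσₑ.eq_or_lt with h0 | h0
    · have hτ0 : τ' ^ 2 = 0 := by
        rw [← h0, zero_pow two_ne_zero] at hτ'
        exact (mul_eq_zero.1 hτ').resolve_left hc.ne'
      rw [hτ0, zero_mul] at hsum
      have hz := (Finset.sum_eq_zero_iff_of_nonneg fun j _ => sq_nonneg _).1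
        (le_antisymm hsum (Finset.sum_nonneg fun j _ => sq_nonneg _))
      have : (Finset.univ.filter fun j => σₑ < ‖τ' • p.2 j - (A - b) (τ • p.1 j)‖) = ∅ := by
        refine Finset.filter_false_of_mem fun j _ => ?_
        rw [← h0, pow_eq_zero_iff two_ne_zero |>.1 (hz j (Finset.mem_univ j))]
        exact lt_irrefl _
      rw [this]; simp; positivity
    · have h1 : ((Finset.univ.filter fun j =>
          σₑ < ‖τ' • p.2 j - (A - b) (τ • p.1 j)‖).card : ℝ) * σₑ ^ 2 ≤
          ∑ j, ‖τ' • p.2 j - (A - b) (τ • p.1 j)‖ ^ 2 := by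
        rw [← nsmul_eq_mul, ← Finset.sum_const]
        refine (Finset.sum_le_sum fun j hj => ?_).trans
          (Finset.sum_le_univ_sum_of_nonneg fun j => sq_nonneg _)
        exact pow_le_pow_left₀ h0.le (Finset.mem_filter.1 hj).2.le 2
      -- As `τ'² = σₑ²/g`, the condition `g ≥ 128 l = 8 * 16 l` is what makes at most one eighth of
      -- the groups exceptional.
      have h2 : τ' ^ 2 * (16 * Fintype.card ι * Module.finrank ℝ F) ≤
          Fintype.card ι / 8 * σₑ ^ 2 := by
        rw [← hτ']
        have h3 : 0 ≤ τ' ^ 2 * (Fintype.card ι : ℝ) := by positivity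
        nlinarith
      exact le_of_mul_le_mul_right ((h1.trans hsum).trans h2) (by positivity)
  have hcount := h.count u hu
  have hcompl := Finset.card_filter_add_card_filter_not (s := (Finset.univ : Finset ι))
    (fun j => ‖τ' • p.2 j - (A - b) (τ • p.1 j)‖ ≤ σₑ ∧ 1 / 6000 ≤ |⟪u, p.1 j⟫|)
  have hsub : (Finset.univ.filter fun j =>
      ¬ (‖τ' • p.2 j - (A - b) (τ • p.1 j)‖ ≤ σₑ ∧ 1 / 6000 ≤ |⟪u, p.1 j⟫|)) ⊆
      (Finset.univ.filter fun j => σₑ < ‖τ' • p.2 j - (A - b) (τ • p.1 j)‖) ∪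
        Finset.univ.filter fun j => |⟪u, p.1 j⟫| < 1 / 6000 := by
    intro j hj
    have hj := (Finset.mem_filter.1 hj).2
    rw [not_and_or, not_le, not_le] at hj
    simpa using hj
  have hle := (Finset.card_le_card hsub).trans (Finset.card_union_le _ _)
  have hle' : ((Finset.univ.filter fun j =>
      ¬ (‖τ' • p.2 j - (A - b) (τ • p.1 j)‖ ≤ σₑ ∧ 1 / 6000 ≤ |⟪u, p.1 j⟫|)).card : ℝ) ≤
      ((Finset.univ.filter fun j => σₑ < ‖τ' • p.2 j - (A - b) (τ • p.1 j)‖).card : ℝ) +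
        ((Finset.univ.filter fun j => |⟪u, p.1 j⟫| < 1 / 6000).card : ℝ) := by
    exact_mod_cast hle
  have hcompl' : ((Finset.univ.filter fun j =>
      ‖τ' • p.2 j - (A - b) (τ • p.1 j)‖ ≤ σₑ ∧ 1 / 6000 ≤ |⟪u, p.1 j⟫|).card : ℝ) +
      ((Finset.univ.filter fun j =>
      ¬ (‖τ' • p.2 j - (A - b) (τ • p.1 j)‖ ≤ σₑ ∧ 1 / 6000 ≤ |⟪u, p.1 j⟫|)).card : ℝ) =
      Fintype.card ι := by
    exact_mod_cast hcompl
  linarith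

end Errors

/-- The least number of samples in a large group. -/
noncomputable def largeGroup (l : ℕ) : ℝ := 160 * nnConst l * (l + 1)

theorem one_le_largeGroup (l : ℕ) : 1 ≤ largeGroup l := by
  have h1 := one_le_nnConst l
  have h2 : (0 : ℝ) ≤ l := Nat.cast_nonneg l
  unfold largeGroup; nlinarith

/-- The relative size of the components of the assigned features. -/
noncomputable def farConst (l : ℕ) : ℝ :=
  min (1 / (6000 * largeGroup l ^ 2)) (min (1 / 6000) (1 / (4 * √(l + 1))))

theorem farConst_pos (l : ℕ) : 0 < farConst l := by
  have := one_le_largeGroup l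
  unfold farConst
  exact lt_min (by positivity) (lt_min (by norm_num) (by positivity))

theorem assignProb_le_one (l : ℕ) : assignProb l ≤ 1 := by
  have h1 := one_le_nnConst l
  have h2 : (0 : ℝ) ≤ l := Nat.cast_nonneg l
  rw [assignProb, div_le_one (by linarith)]
  have : Real.exp (-(8 * nnConst l * (l + 1) + 8)) ≤ 1 :=
    Real.exp_le_one_iff.2 (by nlinarith)
  linarith

theorem sum_groupData_fst {d l : ℕ} {ι κ : Type*} [Fintype κ] [Nonempty κ] (τ σ₂ τ' σₑ : ℝ)
    (p : (ι → EuclideanSpace ℝ (Fin d)) × (ι → EuclideanSpace ℝ (Fin l))) (ω : ι → (κ → EuclideanSpace ℝ (Fin d)) × (κ → EuclideanSpace ℝ (Fin l))) (j : ι) :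
    ∑ k, (groupData τ σ₂ τ' σₑ (p, ω)).1 j k = ((Fintype.card κ : ℝ) * τ) • p.1 j := by
  simp only [groupData, sum_groupPoint, smul_smul]

section GoodData

variable {d l : ℕ} {ι κ : Type*} [Fintype ι] [Fintype κ]

/-- Samples on which both regressions are well posed and accurate, apart from the size of the
assigned features. -/
structure RegularData (b : EuclideanSpace ℝ (Fin d) →L[ℝ] EuclideanSpace ℝ (Fin l)) (R M Q q : ℝ) (D : (ι → κ → EuclideanSpace ℝ (Fin d)) × (ι → κ → EuclideanSpace ℝ (Fin l))) : Prop where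
  wellPosed : LRWellPosed fun j => (∑ k, D.1 j k).ofLp
  fit : ‖groupFit b D - b‖ ^ 2 ≤ R
  norm_le : ∀ j k, ‖D.1 j k‖ ≤ M
  error : ∑ j, ∑ k, ‖D.2 j k - (groupFit b D - b) (D.1 j k)‖ ^ 2 ≤
    Q * (q + ‖groupFit b D - b‖ ^ 2)

open Classical in
/-- Samples for which many responses are assigned to features with large components. -/
def FarData (b : EuclideanSpace ℝ (Fin d) →L[ℝ] EuclideanSpace ℝ (Fin l)) (T : Finset (EuclideanSpace ℝ (Fin d))) (s θ : ℝ) (D : (ι → κ → EuclideanSpace ℝ (Fin d)) × (ι → κ → EuclideanSpace ℝ (Fin l))) : Prop :=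
  ∀ u ∈ T, θ ≤ ((Finset.univ.filter fun q : ι × κ =>
    AssignedFar (groupFit b D) b (D.1 q.1) (D.2 q.1) u s q.2).card : ℝ)

theorem measurableSet_regularData (b : EuclideanSpace ℝ (Fin d) →L[ℝ] EuclideanSpace ℝ (Fin l)) (R M Q q : ℝ) :
    MeasurableSet {D : (ι → κ → EuclideanSpace ℝ (Fin d)) × (ι → κ → EuclideanSpace ℝ (Fin l)) | RegularData b R M Q q D} := by
  have hfit : Measurable (groupFit b (ι := ι) (κ := κ)) := measurable_groupFit b
  have hfit' : Measurable fun D : (ι → κ → EuclideanSpace ℝ (Fin d)) × (ι → κ → EuclideanSpace ℝ (Fin l)) => groupFit b D - b :=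
    hfit.sub_const b
  have hx : ∀ j k, Measurable fun D : (ι → κ → EuclideanSpace ℝ (Fin d)) × (ι → κ → EuclideanSpace ℝ (Fin l)) => D.1 j k := fun j k =>
    Continuous.measurable (by fun_prop)
  have he : ∀ j k, Measurable fun D : (ι → κ → EuclideanSpace ℝ (Fin d)) × (ι → κ → EuclideanSpace ℝ (Fin l)) => D.2 j k := fun j k =>
    Continuous.measurable (by fun_prop)
  have h1 := measurableSet_lrWellPosed
    (x := fun D : (ι → κ → EuclideanSpace ℝ (Fin d)) × (ι → κ → EuclideanSpace ℝ (Fin l)) => fun j => ∑ k, D.1 j k)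
    (Continuous.measurable (by fun_prop))
  have h2 : MeasurableSet {D : (ι → κ → EuclideanSpace ℝ (Fin d)) × (ι → κ → EuclideanSpace ℝ (Fin l)) | ‖groupFit b D - b‖ ^ 2 ≤ R} :=
    measurableSet_le (hfit'.norm.pow_const 2) measurable_const
  have h3 : MeasurableSet {D : (ι → κ → EuclideanSpace ℝ (Fin d)) × (ι → κ → EuclideanSpace ℝ (Fin l)) | ∀ j k, ‖D.1 j k‖ ≤ M} := by
    have : {D : (ι → κ → EuclideanSpace ℝ (Fin d)) × (ι → κ → EuclideanSpace ℝ (Fin l)) | ∀ j k, ‖D.1 j k‖ ≤ M} =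
        ⋂ j, ⋂ k, {D | ‖D.1 j k‖ ≤ M} := by ext; simp
    rw [this]
    exact MeasurableSet.iInter fun j => MeasurableSet.iInter fun k =>
      measurableSet_le (hx j k).norm measurable_const
  have h4 : MeasurableSet {D : (ι → κ → EuclideanSpace ℝ (Fin d)) × (ι → κ → EuclideanSpace ℝ (Fin l)) |
      ∑ j, ∑ k, ‖D.2 j k - (groupFit b D - b) (D.1 j k)‖ ^ 2 ≤
        Q * (q + ‖groupFit b D - b‖ ^ 2)} := by
    refine measurableSet_le (Finset.measurable_sum _ fun j _ => Finset.measurable_sum _ fun k _ => ?_)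
      (((hfit'.norm.pow_const 2).const_add q).const_mul Q)
    exact ((he j k).sub (ContinuousLinearMap.measurable_apply₂.comp
      (hfit'.prodMk (hx j k)))).norm.pow_const 2
  have : {D : (ι → κ → EuclideanSpace ℝ (Fin d)) × (ι → κ → EuclideanSpace ℝ (Fin l)) | RegularData b R M Q q D} =
      ({D | LRWellPosed fun j => (∑ k, D.1 j k).ofLp} ∩ {D | ‖groupFit b D - b‖ ^ 2 ≤ R}) ∩
      ({D | ∀ j k, ‖D.1 j k‖ ≤ M} ∩ {D | ∑ j, ∑ k, ‖D.2 j k - (groupFit b D - b) (D.1 j k)‖ ^ 2 ≤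
        Q * (q + ‖groupFit b D - b‖ ^ 2)}) := by
    ext D
    exact ⟨fun h => ⟨⟨h.1, h.2⟩, h.3, h.4⟩, fun h => ⟨h.1.1, h.1.2, h.2.1, h.2.2⟩⟩
  rw [this]
  exact (h1.inter h2).inter (h3.inter h4)

theorem measurableSet_farData (b : EuclideanSpace ℝ (Fin d) →L[ℝ] EuclideanSpace ℝ (Fin l)) (T : Finset (EuclideanSpace ℝ (Fin d))) (s θ : ℝ) :
    MeasurableSet {D : (ι → κ → EuclideanSpace ℝ (Fin d)) × (ι → κ → EuclideanSpace ℝ (Fin l)) | FarData b T s θ D} := by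
  refine measurableSet_forall_le_card T (fun u q => ?_) θ
  exact measurableSet_assignedFar (measurable_groupFit b) b
    (x := fun D : (ι → κ → EuclideanSpace ℝ (Fin d)) × (ι → κ → EuclideanSpace ℝ (Fin l)) => D.1 q.1)
    (e := fun D : (ι → κ → EuclideanSpace ℝ (Fin d)) × (ι → κ → EuclideanSpace ℝ (Fin l)) => D.2 q.1)
    (Continuous.measurable (by fun_prop)) (Continuous.measurable (by fun_prop)) u s q.2

/-- The regression on the group sums depends on the group means only. -/
theorem groupFit_groupData [Nonempty κ] (b : EuclideanSpace ℝ (Fin d) →L[ℝ] EuclideanSpace ℝ (Fin l)) (τ σ₂ τ' σₑ : ℝ)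
    (p : (ι → EuclideanSpace ℝ (Fin d)) × (ι → EuclideanSpace ℝ (Fin l))) (ω : ι → (κ → EuclideanSpace ℝ (Fin d)) × (κ → EuclideanSpace ℝ (Fin l))) :
    groupFit b (groupData τ σ₂ τ' σₑ (p, ω)) =
      transposeMap (LR (fun j => (((Fintype.card κ : ℝ) * τ) • p.1 j).ofLp)
        fun j => (b (((Fintype.card κ : ℝ) * τ) • p.1 j) +
          ((Fintype.card κ : ℝ) * τ') • p.2 j).ofLp) := by
  simp only [groupFit, groupData, Finset.sum_add_distrib, ← map_sum, sum_groupPoint, smul_smul]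

variable {T : Finset (EuclideanSpace ℝ (Fin d))} {η : ℝ} {b : EuclideanSpace ℝ (Fin d) →L[ℝ] EuclideanSpace ℝ (Fin l)} {c L t τ σ₂ τ' σₑ σₓ : ℝ}
  {p : (ι → EuclideanSpace ℝ (Fin d)) × (ι → EuclideanSpace ℝ (Fin l))} {ω : ι → (κ → EuclideanSpace ℝ (Fin d)) × (κ → EuclideanSpace ℝ (Fin l))}

theorem GoodMeans.lrWellPosed [Nonempty ι] [Nonempty κ] (h : GoodMeans T b c L t p) (hτ : 0 < τ)
    (hT : ∀ u : EuclideanSpace ℝ (Fin d), ‖u‖ = 1 → ∃ u' ∈ T, ‖u - u'‖ ≤ η)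
    (hη : √d * L * η ≤ 1 / 6000 / 2) :
    LRWellPosed fun j => (((Fintype.card κ : ℝ) * τ) • p.1 j).ofLp := by
  have hc : (0 : ℝ) < Fintype.card κ := by exact_mod_cast Fintype.card_pos
  have hm : (0 : ℝ) < Fintype.card ι := by exact_mod_cast Fintype.card_pos
  refine lrWellPosed_of_pos fun v hv => ?_
  have h1 := h.gram hT (by rw [finrank_euclideanSpace_fin]; exact hη) v
  simp only [real_inner_smul_left, mul_pow, ← Finset.mul_sum]
  have h2 := gramConst_pos
  have h3 := norm_pos_iff.2 hv
  have h4 : 0 < ∑ i, ⟪p.1 i, v⟫ ^ 2 := lt_of_lt_of_le (by positivity) h1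
  positivity

theorem GoodMeans.normalEquations [Nonempty ι] [Nonempty κ] (h : GoodMeans T b c L t p)
    (hτ : 0 < τ) (hT : ∀ u : EuclideanSpace ℝ (Fin d), ‖u‖ = 1 → ∃ u' ∈ T, ‖u - u'‖ ≤ η)
    (hη : √d * L * η ≤ 1 / 6000 / 2) (v : EuclideanSpace ℝ (Fin d)) :
    ∑ i, ⟪((Fintype.card κ : ℝ) * τ) • p.1 i, v⟫ • groupFit b (groupData τ σ₂ τ' σₑ (p, ω))
        (((Fintype.card κ : ℝ) * τ) • p.1 i) =
      ∑ i, ⟪((Fintype.card κ : ℝ) * τ) • p.1 i, v⟫ •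
        (b (((Fintype.card κ : ℝ) * τ) • p.1 i) + ((Fintype.card κ : ℝ) * τ') • p.2 i) := by
  rw [groupFit_groupData]
  exact sum_inner_smul_LR (h.lrWellPosed hτ hT hη) v

theorem GoodMeans.sq_norm_groupFit_sub_le [Nonempty ι] [Nonempty κ] (h : GoodMeans T b c L t p)
    (hτ : 0 < τ) (hT : ∀ u : EuclideanSpace ℝ (Fin d), ‖u‖ = 1 → ∃ u' ∈ T, ‖u - u'‖ ≤ η)
    (hη : √d * L * η ≤ 1 / 6000 / 2) (hτ' : Fintype.card κ * τ' ^ 2 = σₑ ^ 2) :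
    ‖groupFit b (groupData τ σ₂ τ' σₑ (p, ω)) - b‖ ^ 2 ≤
      8 * l * d * t / (gramConst ^ 2 * Fintype.card ι) * (σₑ ^ 2 / (Fintype.card κ * τ ^ 2)) := by
  have hc : (0 : ℝ) < Fintype.card κ := by exact_mod_cast Fintype.card_pos
  have h1 := h.sq_norm_sub_le (r := (Fintype.card κ : ℝ) * τ) (by positivity)
    (h.gram hT (by rw [finrank_euclideanSpace_fin]; exact hη))
    (h.normalEquations (κ := κ) (σ₂ := σ₂) (τ' := τ') (σₑ := σₑ) (ω := ω) hτ hT hη)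
  rw [finrank_euclideanSpace_fin, finrank_euclideanSpace_fin] at h1
  refine h1.trans (le_of_eq ?_)
  congr 1
  rw [← hτ']
  field_simp

theorem regularData_of_good [Nonempty ι] [Nonempty κ] (h : GoodMeans T b c L t p) (hL : 0 ≤ L)
    (hτ : 0 < τ) (hσ₂ : 0 ≤ σ₂) (hT : ∀ u : EuclideanSpace ℝ (Fin d), ‖u‖ = 1 → ∃ u' ∈ T, ‖u - u'‖ ≤ η)
    (hη : √d * L * η ≤ 1 / 6000 / 2) (hτ' : Fintype.card κ * τ' ^ 2 = σₑ ^ 2)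
    (hτσ : τ ≤ σₓ) (hσ₂σ : σ₂ ≤ σₓ) (hσₓ : 0 < σₓ)
    (hω : GoodDeviations (groupFit b (groupData τ σ₂ τ' σₑ (p, ω)) - b) L ω) :
    RegularData b
      (8 * l * d * t / (gramConst ^ 2 * Fintype.card ι) * (σₑ ^ 2 / (Fintype.card κ * τ ^ 2)))
      (3 * σₓ * (√d * L)) (24 * (Fintype.card ι * Fintype.card κ) * l * σₓ ^ 2)
      (σₑ ^ 2 / σₓ ^ 2) (groupData τ σ₂ τ' σₑ (p, ω)) := by
  refine ⟨?_, h.sq_norm_groupFit_sub_le hτ hT hη hτ', fun j k => ?_, ?_⟩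
  · simp only [sum_groupData_fst]
    exact h.lrWellPosed hτ hT hη
  · have h1 := h.norm_le j
    have h2 := hω.norm_le j
    rw [finrank_euclideanSpace_fin] at h1 h2
    refine (norm_groupPoint_le (τ • p.1 j) hσ₂ h2 k).trans ?_
    rw [norm_smul, Real.norm_eq_abs, abs_of_pos hτ]
    have hB : 0 ≤ √d * L := by positivity
    have e1 : τ * ‖p.1 j‖ ≤ σₓ * (√d * L) := mul_le_mul hτσ h1 (norm_nonneg _) hσₓ.le
    have e2 : σ₂ * (2 * (√d * L)) ≤ σₓ * (2 * (√d * L)) := by gcongr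
    linarith
  · have h1 := sum_sq_error_le (κ := κ) (σ₂ := σ₂) (σₓ := σₓ) h (h.normalEquations hτ hT hη) hω hτ'
      (by gcongr)
    rw [finrank_euclideanSpace_fin] at h1
    refine h1.trans (le_of_eq ?_)
    field_simp

open Classical in
-- When every member of a group has a large component, any assignment within it is favourable; `7/8`
-- of the groups are of this kind.
theorem farData_of_forall_far {s θ : ℝ} {D : (ι → κ → EuclideanSpace ℝ (Fin d)) × (ι → κ → EuclideanSpace ℝ (Fin l))}
    (h : ∀ u ∈ T, ((Finset.univ.filter fun j => ∃ k, |⟪u, D.1 j k⟫| < s).card : ℝ) <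
      (Fintype.card ι : ℝ) / 8)
    (hθ : θ ≤ 7 / 8 * (Fintype.card ι * Fintype.card κ)) : FarData b T s θ D := by
  intro u hu
  have hcompl := Finset.card_filter_add_card_filter_not (s := (Finset.univ : Finset ι))
    (fun j => ∃ k, |⟪u, D.1 j k⟫| < s)
  have hcompl' : ((Finset.univ.filter fun j => ∃ k, |⟪u, D.1 j k⟫| < s).card : ℝ) +
      ((Finset.univ.filter fun j => ¬ ∃ k, |⟪u, D.1 j k⟫| < s).card : ℝ) = Fintype.card ι := by
    exact_mod_cast hcompl
  have hsub : (Finset.univ.filter fun j => ¬ ∃ k, |⟪u, D.1 j k⟫| < s) ×ˢ (Finset.univ : Finset κ) ⊆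
      Finset.univ.filter fun q : ι × κ =>
        AssignedFar (groupFit b D) b (D.1 q.1) (D.2 q.1) u s q.2 := by
    rintro ⟨j, k⟩ hq
    have hq := (Finset.mem_filter.1 (Finset.mem_product.1 hq).1).2
    refine Finset.mem_filter.2 ⟨Finset.mem_univ _, fun k' _ => ?_⟩
    push Not at hq
    exact hq k'
  have hle := Finset.card_le_card hsub
  rw [Finset.card_product, Finset.card_univ] at hle
  have hle' : ((Finset.univ.filter fun j => ¬ ∃ k, |⟪u, D.1 j k⟫| < s).card : ℝ) *
      Fintype.card κ ≤ ((Finset.univ.filter fun q : ι × κ =>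
        AssignedFar (groupFit b D) b (D.1 q.1) (D.2 q.1) u s q.2).card : ℝ) := by
    exact_mod_cast hle
  have h1 := h u hu
  have h2 : (0 : ℝ) ≤ Fintype.card κ := Nat.cast_nonneg _
  nlinarith

end GoodData

theorem measurable_groupData {E F : Type*}
    [NormedAddCommGroup E] [InnerProductSpace ℝ E] [FiniteDimensional ℝ E] [MeasurableSpace E]
    [BorelSpace E] [NormedAddCommGroup F] [InnerProductSpace ℝ F] [FiniteDimensional ℝ F]
    [MeasurableSpace F] [BorelSpace F] {ι κ : Type*} [Fintype κ] (τ σ₂ τ' σₑ : ℝ) :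
    Measurable (groupData (E := E) (F := F) (ι := ι) (κ := κ) τ σ₂ τ' σₑ) := by
  refine Measurable.prodMk (measurable_pi_lambda _ fun j => measurable_pi_lambda _ fun k => ?_)
    (measurable_pi_lambda _ fun j => measurable_pi_lambda _ fun k => ?_)
  · unfold groupPoint; fun_prop
  · unfold groupPoint; fun_prop

/-! ### Probability of good data -/

section GoodDataProbability

variable {d l : ℕ} {ι κ : Type*} [Fintype ι] [Fintype κ]

variable (d l ι) in
/-- The law of the standardized group means of the features and the noise. -/
noncomputable abbrev meanLaw :
    Measure ((ι → EuclideanSpace ℝ (Fin d)) × (ι → EuclideanSpace ℝ (Fin l))) :=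
  (Measure.pi fun _ : ι => stdGaussian (EuclideanSpace ℝ (Fin d))).prod
    (Measure.pi fun _ : ι => stdGaussian (EuclideanSpace ℝ (Fin l)))

variable (d l ι κ) in
/-- The law of the standardized group means and deviations. -/
noncomputable abbrev sampleLaw :=
  (meanLaw d l ι).prod (deviationLaw (EuclideanSpace ℝ (Fin d)) (EuclideanSpace ℝ (Fin l)) ι κ)

variable {T : Finset (EuclideanSpace ℝ (Fin d))} {η : ℝ}
  {b : EuclideanSpace ℝ (Fin d) →L[ℝ] EuclideanSpace ℝ (Fin l)} {L t τ σ₂ τ' σₑ σₓ s θ : ℝ}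

/-- Conditionally on good means the fit is a fixed map, so the deviations have to be controlled for
one map only. Evaluating the fit at zero deviations names this map. -/
theorem sampleLaw_not_regularData_le [Nonempty ι] [Nonempty κ] (hL : 0 ≤ L)
    (hτ : 0 < τ) (hσ₂ : 0 ≤ σ₂)
    (hT : ∀ u : EuclideanSpace ℝ (Fin d), ‖u‖ = 1 → ∃ u' ∈ T, ‖u - u'‖ ≤ η)
    (hη : √d * L * η ≤ 1 / 6000 / 2) (hτ' : Fintype.card κ * τ' ^ 2 = σₑ ^ 2)
    (hτσ : τ ≤ σₓ) (hσ₂σ : σ₂ ≤ σₓ) (hσₓ : 0 < σₓ) (c : ℝ) :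
    sampleLaw d l ι κ {q | ¬ RegularData b
      (8 * l * d * t / (gramConst ^ 2 * Fintype.card ι) * (σₑ ^ 2 / (Fintype.card κ * τ ^ 2)))
      (3 * σₓ * (√d * L)) (24 * (Fintype.card ι * Fintype.card κ) * l * σₓ ^ 2)
      (σₑ ^ 2 / σₓ ^ 2) (groupData τ σ₂ τ' σₑ q)} ≤
      meanLaw d l ι {p | ¬ GoodMeans T b c L t p} +
      (Fintype.card ι * (Fintype.card κ * (d * ENNReal.ofReal (2 * Real.exp (-L ^ 2 / 2)))) +
      l * ENNReal.ofReal (Real.exp (-(Fintype.card ι * Fintype.card κ : ℝ) / 2)) +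
      l * ENNReal.ofReal (Real.exp (-(Fintype.card ι * Fintype.card κ : ℝ) / 2))) := by
  refine prod_apply_le_of_section_le _ _ ?_ _ _ fun p hp => ?_
  · exact ((measurableSet_regularData b _ _ _ _).preimage
      (measurable_groupData τ σ₂ τ' σₑ)).compl
  · have hp : GoodMeans T b c L t p := not_not.1 hp
    have h := deviationLaw_not_goodDeviations_le (ι := ι) (κ := κ)
      (groupFit b (groupData τ σ₂ τ' σₑ (p, fun _ => (0 : (κ → EuclideanSpace ℝ (Fin d)) ×
        (κ → EuclideanSpace ℝ (Fin l))))) - b) hL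
    rw [finrank_euclideanSpace_fin, finrank_euclideanSpace_fin] at h
    refine (measure_mono fun ω hω hgood => ?_).trans h
    refine hω (regularData_of_good hp hL hτ hσ₂ hT hη hτ' hτσ hσ₂σ hσₓ ?_)
    rwa [groupFit_groupData] at hgood ⊢

/-- Here the deviations are frozen and the means are random. All members of a group share the mean,
and each has a component below `s` with probability at most `s/τ`; the group size is small enough
for a union bound over the members, uniformly in the deviations. -/
theorem sampleLaw_not_farData_le_of_small [Nonempty κ] (hT : ∀ u ∈ T, ‖u‖ = 1) (hτ : 0 < τ)
    (hs : Fintype.card κ * (s / τ) ≤ 1 / 6000)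
    (hθ : θ ≤ 7 / 8 * (Fintype.card ι * Fintype.card κ)) :
    sampleLaw d l ι κ {q | ¬ FarData b T s θ (groupData τ σ₂ τ' σₑ q)} ≤
      T.card * ENNReal.ofReal (Real.exp (-(Fintype.card ι : ℝ) / 2)) := by
  classical
  set S := {q : ((ι → EuclideanSpace ℝ (Fin d)) × (ι → EuclideanSpace ℝ (Fin l))) ×
    (ι → (κ → EuclideanSpace ℝ (Fin d)) × (κ → EuclideanSpace ℝ (Fin l))) |
    ¬ FarData b T s θ (groupData τ σ₂ τ' σₑ q)} with hS
  have hSm : MeasurableSet S := ((measurableSet_farData b T s θ).preimage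
    (measurable_groupData τ σ₂ τ' σₑ)).compl
  have hswap : sampleLaw d l ι κ S =
      ((deviationLaw (EuclideanSpace ℝ (Fin d)) (EuclideanSpace ℝ (Fin l)) ι κ).prod
        (meanLaw d l ι)) (Prod.swap ⁻¹' S) :=
    (Measure.measurePreserving_swap.measure_preimage hSm.nullMeasurableSet).symm
  rw [hswap]
  refine (prod_apply_le_of_section_le _ _ (hSm.preimage measurable_swap) ∅
    (T.card * ENNReal.ofReal (Real.exp (-(Fintype.card ι : ℝ) / 2))) fun ω _ => ?_).trans
      (by rw [measure_empty, zero_add])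
  let w : EuclideanSpace ℝ (Fin d) → ι → κ → ℝ := fun u j k =>
    ⟪u, groupPoint 0 σ₂ (ω j).1 k⟫
  let Bad : EuclideanSpace ℝ (Fin d) → ι → Set (EuclideanSpace ℝ (Fin d)) := fun u j =>
    ⋃ k, {x | |w u j k + τ * ⟪u, x⟫| < s}
  have hBadm : ∀ u j, MeasurableSet (Bad u j) := fun u j => MeasurableSet.iUnion fun k =>
    measurableSet_lt (by fun_prop) measurable_const
  have hBad : ∀ u ∈ T, ∀ j, stdGaussian (EuclideanSpace ℝ (Fin d)) (Bad u j) ≤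
      ENNReal.ofReal (1 / 6000) := by
    intro u hu j
    refine (measure_iUnion_fintype_le _ _).trans ?_
    refine (Finset.sum_le_card_nsmul _ _ (ENNReal.ofReal (s / τ)) fun k _ =>
      stdGaussian_abs_add_mul_inner_lt_le (hT u hu) _ hτ).trans ?_
    rw [nsmul_eq_mul, Finset.card_univ, ← ENNReal.ofReal_natCast,
      ← ENNReal.ofReal_mul (Nat.cast_nonneg _)]
    exact ENNReal.ofReal_le_ofReal hs
  have key := pi_exists_card_bad_ge_le (fun _ : ι => stdGaussian (EuclideanSpace ℝ (Fin d))) T Bad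
    hBadm hBad
  have hsub : {p | (ω, p) ∈ Prod.swap ⁻¹' S} ⊆ {a : ι → EuclideanSpace ℝ (Fin d) | ∃ u ∈ T,
      (Fintype.card ι : ℝ) / 8 ≤ ((Finset.univ.filter fun i => a i ∈ Bad u i).card : ℝ)} ×ˢ
        (Set.univ : Set (ι → EuclideanSpace ℝ (Fin l))) := by
    rintro ⟨a, ε⟩ hp
    refine ⟨?_, Set.mem_univ _⟩
    by_contra hcon
    refine hp (farData_of_forall_far (fun u hu => ?_) hθ)
    have h1 : ((Finset.univ.filter fun i => a i ∈ Bad u i).card : ℝ) < (Fintype.card ι : ℝ) / 8 := by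
      by_contra h
      exact hcon ⟨u, hu, not_lt.1 h⟩
    refine lt_of_le_of_lt (le_of_eq ?_) h1
    congr 2
    refine Finset.filter_congr fun j _ => ?_
    simp only [Bad, Set.mem_iUnion, Set.mem_ofPred_eq]
    refine exists_congr fun k => ?_
    have : ⟪u, (groupData τ σ₂ τ' σₑ ((a, ε), ω)).1 j k⟫ = w u j k + τ * ⟪u, a j⟫ := by
      simp only [groupData, w, groupPoint, inner_add_right, real_inner_smul_right, zero_add]
      ring
    rw [Prod.swap_prod_mk, this]
  refine (measure_mono hsub).trans ?_
  rw [Measure.prod_prod, measure_univ, mul_one]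
  exact key

/-- Here the means, hence the fit, are frozen. The accuracy of the fit makes its effect on the
deviations small compared with the noise; three quarters of the groups have a mean residual of at
most `σₑ` and a mean not nearly orthogonal to `u`, and there the nearest neighbour argument applies.
-/
theorem sampleLaw_not_farData_le_of_large [Nonempty ι] [Nonempty κ] (hT1 : ∀ u ∈ T, ‖u‖ = 1)
    (hb : ‖b‖ = 1) (hτ : 0 < τ) (hσ₂ : 0 ≤ σ₂) (hσₑ : 0 ≤ σₑ)
    (hT : ∀ u : EuclideanSpace ℝ (Fin d), ‖u‖ = 1 → ∃ u' ∈ T, ‖u - u'‖ ≤ η)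
    (hη : √d * L * η ≤ 1 / 6000 / 2) (hτ' : Fintype.card κ * τ' ^ 2 = σₑ ^ 2)
    (hκ : largeGroup l ≤ Fintype.card κ) (hσ₂τ : σ₂ ^ 2 ≤ Fintype.card κ * τ ^ 2)
    (hfit : 8 * l * d * t / (gramConst ^ 2 * Fintype.card ι) ≤
      (1 / (8 * nnConst l * (l + 1))) ^ 2)
    (hs : s ≤ τ * (1 / 6000) + σ₂ * (1 / (4 * √(l + 1))))
    (hθ : θ ≤ 3 / 16 * assignProb l * (Fintype.card ι * Fintype.card κ)) :
    sampleLaw d l ι κ {q | ¬ FarData b T s θ (groupData τ σ₂ τ' σₑ q)} ≤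
      meanLaw d l ι {p | ¬ GoodMeans T b ((Fintype.card κ * τ') / (Fintype.card κ * τ)) L t p} +
      T.card * ENNReal.ofReal (Real.exp (-(3 / 16 * assignProb l * Fintype.card ι))) := by
  classical
  have hc : (0 : ℝ) < Fintype.card κ := by exact_mod_cast Fintype.card_pos
  have hq := assignProb_pos l
  have hK := one_le_nnConst l
  have hl0 : (0 : ℝ) ≤ l := Nat.cast_nonneg l
  refine prod_apply_le_of_section_le _ _ ?_ _ _ fun p hp => ?_
  · exact ((measurableSet_farData b T s θ).preimage
      (measurable_groupData τ σ₂ τ' σₑ)).compl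
  have hp : GoodMeans T b ((Fintype.card κ * τ') / (Fintype.card κ * τ)) L t p := not_not.1 hp
  set A := groupFit b (groupData τ σ₂ τ' σₑ (p, fun _ => (0 : (κ → EuclideanSpace ℝ (Fin d)) ×
        (κ → EuclideanSpace ℝ (Fin l))))) with hA
  have hAω : ∀ ω, groupFit b (groupData τ σ₂ τ' σₑ (p, ω)) = A := fun ω => by
    exact (groupFit_groupData b τ σ₂ τ' σₑ p ω).trans (groupFit_groupData b τ σ₂ τ' σₑ p _).symm
  have hnormal := hp.normalEquations (κ := κ) (σ₂ := σ₂) (τ' := τ') (σₑ := σₑ) hτ hT hη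
    (ω := fun _ => 0)
  have hfitA : ‖A - b‖ ^ 2 ≤ 8 * l * d * t / (gramConst ^ 2 * Fintype.card ι) *
      (σₑ ^ 2 / (Fintype.card κ * τ ^ 2)) := hp.sq_norm_groupFit_sub_le hτ hT hη hτ'
  have hA0 : A ≠ 0 := by
    -- Without noise the fit is exact and `b` has norm one; with noise the fit is nonzero for good
    -- means.
    rcases hσₑ.eq_or_lt with h0 | h0
    · intro hA0
      rw [← h0, hA0, zero_sub, norm_neg, hb] at hfitA
      norm_num at hfitA
    · refine hp.map_ne_zero (r := Fintype.card κ * τ) (r' := Fintype.card κ * τ') (by positivity)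
        (mul_ne_zero hc.ne' ?_) hnormal
      rintro rfl
      rw [zero_pow two_ne_zero, mul_zero] at hτ'
      exact (pow_pos h0 2).ne hτ'
  have hΔ : σ₂ * ‖A - b‖ ≤ 1 / (8 * nnConst l * (l + 1)) * σₑ := by
    refine le_of_sq_le_sq ?_ (by positivity)
    rw [mul_pow, mul_pow]
    calc σ₂ ^ 2 * ‖A - b‖ ^ 2 ≤ (Fintype.card κ * τ ^ 2) *
          ((1 / (8 * nnConst l * (l + 1))) ^ 2 * (σₑ ^ 2 / (Fintype.card κ * τ ^ 2))) := by
          gcongr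
          exact hfitA.trans (by gcongr)
      _ = _ := by field_simp
  let J : EuclideanSpace ℝ (Fin d) → Finset ι := fun u => Finset.univ.filter fun j =>
    ‖τ' • p.2 j - (A - b) (τ • p.1 j)‖ ≤ σₑ ∧ 1 / 6000 ≤ |⟪u, p.1 j⟫|
  have hJ : ∀ u ∈ T, 3 / 4 * (Fintype.card ι : ℝ) ≤ (J u).card := fun u hu => by
    refine three_quarters_card_le hp hnormal hτ' hσₑ ?_ hu
    rw [finrank_euclideanSpace_fin]
    refine le_trans ?_ hκ
    unfold largeGroup
    nlinarith
  let W : EuclideanSpace ℝ (Fin d) →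
      Set (ι → (κ → EuclideanSpace ℝ (Fin d)) × (κ → EuclideanSpace ℝ (Fin l))) := fun u =>
    {ω | ((Finset.univ.filter fun q : ι × κ =>
        AssignedFar A b (groupPoint (τ • p.1 q.1) σ₂ (ω q.1).1)
          (groupPoint (τ' • p.2 q.1) σₑ (ω q.1).2) u s q.2).card : ℝ) <
            assignProb l * (J u).card / 4 * Fintype.card κ}
  have hW : ∀ u ∈ T, deviationLaw (EuclideanSpace ℝ (Fin d)) (EuclideanSpace ℝ (Fin l)) ι κ (W u) ≤
      ENNReal.ofReal (Real.exp (-(3 / 16 * assignProb l * Fintype.card ι))) := by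
    intro u hu
    refine (deviationLaw_card_assignedFar_lt_le hA0 (hT1 u hu) finrank_euclideanSpace_fin hσ₂ hσₑ
      (fun j => τ • p.1 j) (fun j => τ' • p.2 j) hκ hΔ (J u)
      (fun j hj => (Finset.mem_filter.1 hj).2.1) fun j hj => ?_).trans ?_
    · have h1 := (Finset.mem_filter.1 hj).2.2
      refine hs.trans ?_
      rw [real_inner_smul_right, abs_mul, abs_of_pos hτ]
      gcongr
    · refine ENNReal.ofReal_le_ofReal (Real.exp_le_exp.2 ?_)
      have := mul_le_mul_of_nonneg_left (hJ u hu) hq.le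
      linarith
  have hsub : {ω | (p, ω) ∈ {q | ¬ FarData b T s θ (groupData τ σ₂ τ' σₑ q)}} ⊆ ⋃ u ∈ T, W u := by
    intro ω hω
    by_contra hcon
    refine hω fun u hu => ?_
    have hnot : ω ∉ W u := fun h => hcon (Set.mem_biUnion (s := (T : Set _)) hu h)
    rw [hAω]
    by_contra hlt
    refine hnot (lt_of_lt_of_le (not_le.1 hlt) (hθ.trans ?_))
    have := mul_le_mul_of_nonneg_left (hJ u hu) (mul_nonneg hq.le hc.le)
    linarith
  refine (measure_mono hsub).trans ((measure_biUnion_finset_le T W).trans ?_)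
  rw [← nsmul_eq_mul]
  exact Finset.sum_le_card_nsmul _ _ _ hW

end GoodDataProbability

/-! ### The two group sizes combined -/

section GoodSamples

variable {d l : ℕ} {ι κ : Type*} [Fintype ι] [Fintype κ]
  {T : Finset (EuclideanSpace ℝ (Fin d))} {η : ℝ}
  {b : EuclideanSpace ℝ (Fin d) →L[ℝ] EuclideanSpace ℝ (Fin l)} {L t τ σ₂ τ' σₑ σₓ : ℝ}

/-- The means fail with probability at most `5 δ`, the deviations `3 δ`; the assigned features cost
at most a further `5 δ + δ`, in the case of large groups. For small groups `σₓ ≤ g τ` makes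
`farConst l * σₓ` small relative to `τ`; for large ones `σₓ ≤ τ + σ₂` splits it into the parts due
to the mean and to the deviations. -/
theorem sampleLaw_not_good_le [Nonempty ι] [Nonempty κ] (hl : 1 ≤ l) (hT1 : ∀ u ∈ T, ‖u‖ = 1)
    (hTne : T.Nonempty) (hT : ∀ u : EuclideanSpace ℝ (Fin d), ‖u‖ = 1 → ∃ u' ∈ T, ‖u - u'‖ ≤ η)
    (hb : ‖b‖ = 1) (hL : 0 ≤ L) (ht : 0 ≤ t) (hη : √d * L * η ≤ 1 / 6000 / 2)
    (hτ : 0 < τ) (hσ₂ : 0 ≤ σ₂) (hσₑ : 0 ≤ σₑ) (hσₓ : 0 < σₓ)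
    (hτ' : Fintype.card κ * τ' ^ 2 = σₑ ^ 2) (hτσ : τ ≤ σₓ) (hσ₂σ : σ₂ ≤ σₓ)
    (hσₓκ : σₓ ≤ Fintype.card κ * τ) (hσₓτ : σₓ ≤ τ + σ₂)
    (hσ₂τ : σ₂ ^ 2 ≤ Fintype.card κ * τ ^ 2)
    (hfit : 8 * l * d * t / (gramConst ^ 2 * Fintype.card ι) ≤
      (1 / (8 * nnConst l * (l + 1))) ^ 2) {δ : ℝ≥0∞}
    (h1 : T.card * ENNReal.ofReal (Real.exp (-(3 / 16 * assignProb l * Fintype.card ι))) ≤ δ)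
    (h2 : Fintype.card ι * (Fintype.card κ * (d * ENNReal.ofReal (2 * Real.exp (-L ^ 2 / 2)))) ≤ δ)
    (h3 : l * ENNReal.ofReal (Real.exp (-(Fintype.card ι : ℝ) / 2)) ≤ δ)
    (h4 : d * ENNReal.ofReal (Real.exp (-(Fintype.card ι : ℝ) / 2)) ≤ δ)
    (h5 : l * (d * (2 * ENNReal.ofReal (Real.exp (-t)))) ≤ δ) :
    sampleLaw d l ι κ {q | ¬ (RegularData b
      (8 * l * d * t / (gramConst ^ 2 * Fintype.card ι) * (σₑ ^ 2 / (Fintype.card κ * τ ^ 2)))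
      (3 * σₓ * (√d * L)) (24 * (Fintype.card ι * Fintype.card κ) * l * σₓ ^ 2)
      (σₑ ^ 2 / σₓ ^ 2) (groupData τ σ₂ τ' σₑ q) ∧
      FarData b T (farConst l * σₓ) (3 / 16 * assignProb l * (Fintype.card ι * Fintype.card κ))
        (groupData τ σ₂ τ' σₑ q))} ≤ 14 * δ := by
  classical
  have hg : (1 : ℝ) ≤ Fintype.card κ := by exact_mod_cast Fintype.card_pos
  have hm : (1 : ℝ) ≤ Fintype.card ι := by exact_mod_cast Fintype.card_pos
  have hq := assignProb_pos l
  have hq1 := assignProb_le_one l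
  have hf := farConst_pos l
  have : Nonempty (Fin l) := ⟨⟨0, hl⟩⟩
  have : Nontrivial (EuclideanSpace ℝ (Fin l)) := inferInstance
  have h1' : T.card * ENNReal.ofReal (Real.exp (-(Fintype.card ι : ℝ) / 2)) ≤ δ := by
    refine le_trans ?_ h1
    gcongr
    nlinarith
  have hmeans : ∀ c, meanLaw d l ι {p | ¬ GoodMeans T b c L t p} ≤ 5 * δ := by
    intro c
    have h := prod_not_goodMeans_le (ι := ι) hT1 hTne b c hL ht
    rw [finrank_euclideanSpace_fin, finrank_euclideanSpace_fin] at h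
    refine h.trans ?_
    have h2' : Fintype.card ι * (d * ENNReal.ofReal (2 * Real.exp (-L ^ 2 / 2))) ≤ δ := by
      refine le_trans ?_ h2
      have hκ1 : (1 : ℝ≥0∞) ≤ Fintype.card κ :=
        Nat.one_le_cast.2 (Nat.succ_le_of_lt (Fintype.card_pos (α := κ)))
      exact mul_le_mul' le_rfl ((one_mul _).ge.trans (mul_le_mul' hκ1 le_rfl))
    calc _ ≤ δ + δ + δ + (δ + δ) := by gcongr
      _ = 5 * δ := by ring
  have hreg := sampleLaw_not_regularData_le (ι := ι) (κ := κ) (b := b) (t := t) hL hτ hσ₂ hT hη hτ'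
    hτσ hσ₂σ hσₓ 0
  have h3' : l * ENNReal.ofReal (Real.exp (-(Fintype.card ι * Fintype.card κ : ℝ) / 2)) ≤ δ := by
    refine le_trans ?_ h3
    gcongr
    nlinarith
  have hreg' := hreg.trans (show _ ≤ 8 * δ from
    calc _ ≤ 5 * δ + (δ + δ + δ) := by gcongr; exact hmeans 0
      _ = 8 * δ := by ring)
  have hfar : sampleLaw d l ι κ {q | ¬ FarData b T (farConst l * σₓ)
      (3 / 16 * assignProb l * (Fintype.card ι * Fintype.card κ)) (groupData τ σ₂ τ' σₑ q)} ≤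
      6 * δ := by
    rcases le_total (largeGroup l) (Fintype.card κ) with hκ | hκ
    · refine (sampleLaw_not_farData_le_of_large hT1 hb hτ hσ₂ hσₑ hT hη hτ' hκ hσ₂τ hfit ?_
        le_rfl).trans ?_
      · calc farConst l * σₓ ≤ farConst l * τ + farConst l * σ₂ := by
              rw [← mul_add]; gcongr
          _ ≤ τ * (1 / 6000) + σ₂ * (1 / (4 * √(l + 1))) := by
              rw [mul_comm _ τ, mul_comm _ σ₂]
              gcongr
              · exact (min_le_right _ _).trans (min_le_left _ _)
              · exact (min_le_right _ _).trans (min_le_right _ _)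
      · calc _ ≤ 5 * δ + δ := by gcongr; exact hmeans _
          _ = 6 * δ := by ring
    · refine (sampleLaw_not_farData_le_of_small hT1 hτ ?_ ?_).trans (h1'.trans ?_)
      · have hG := one_le_largeGroup l
        calc (Fintype.card κ : ℝ) * (farConst l * σₓ / τ)
            ≤ Fintype.card κ * (farConst l * (Fintype.card κ * τ) / τ) := by gcongr
          _ = Fintype.card κ ^ 2 * farConst l := by field_simp
          _ ≤ largeGroup l ^ 2 * (1 / (6000 * largeGroup l ^ 2)) := by
              gcongr
              exact min_le_left _ _
          _ = 1 / 6000 := by field_simp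
      · have : (0 : ℝ) ≤ Fintype.card ι * Fintype.card κ := by positivity
        gcongr
        linarith
      · exact le_mul_of_one_le_left zero_le (by norm_num)
  have hsub : {q : ((ι → EuclideanSpace ℝ (Fin d)) × (ι → EuclideanSpace ℝ (Fin l))) ×
      (ι → (κ → EuclideanSpace ℝ (Fin d)) × (κ → EuclideanSpace ℝ (Fin l))) | ¬ (RegularData b
      (8 * l * d * t / (gramConst ^ 2 * Fintype.card ι) * (σₑ ^ 2 / (Fintype.card κ * τ ^ 2)))
      (3 * σₓ * (√d * L)) (24 * (Fintype.card ι * Fintype.card κ) * l * σₓ ^ 2)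
      (σₑ ^ 2 / σₓ ^ 2) (groupData τ σ₂ τ' σₑ q) ∧
      FarData b T (farConst l * σₓ) (3 / 16 * assignProb l * (Fintype.card ι * Fintype.card κ))
        (groupData τ σ₂ τ' σₑ q))} ⊆ _ ∪ _ := fun q hq => not_and_or.1 hq
  calc _ ≤ 8 * δ + 6 * δ := (measure_mono hsub).trans ((measure_union_le _ _).trans
        (add_le_add hreg' hfar))
    _ = 14 * δ := by ring

end GoodSamples

/-! ### The law of the data -/

section DiagonalMap

variable {E : Type*} [NormedAddCommGroup E] [InnerProductSpace ℝ E] {κ : Type*}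

variable (E κ) in
/-- Coordinates of the map adding a common vector to all components. -/
noncomputable def diagonalMap : E →L[ℝ] PiLp 2 fun _ : κ => E :=
  (PiLp.continuousLinearEquiv 2 ℝ fun _ : κ => E).symm.toContinuousLinearMap ∘L
    ContinuousLinearMap.pi fun _ => ContinuousLinearMap.id ℝ E

theorem diagonalMap_apply (x : E) (k : κ) : diagonalMap E κ x k = x := rfl

theorem inner_diagonalMap [Fintype κ] (x : E) (t : PiLp 2 fun _ : κ => E) :
    ⟪diagonalMap E κ x, t⟫ = ⟪x, ∑ k, t k⟫ := by
  rw [PiLp.inner_apply, inner_sum]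
  rfl

end DiagonalMap

section GroupLaw

variable {E : Type*} [NormedAddCommGroup E] [InnerProductSpace ℝ E] [FiniteDimensional ℝ E]
  [MeasurableSpace E] [BorelSpace E] {κ : Type*} [Fintype κ]

theorem map_toLp_pi_stdGaussian :
    (Measure.pi fun _ : κ => stdGaussian E).map (WithLp.toLp 2) =
      stdGaussian (PiLp 2 fun _ : κ => E) := by
  refine Measure.ext_of_charFun (funext fun t => ?_)
  rw [charFun_pi]
  simp_rw [charFun_stdGaussian]
  rw [← Complex.exp_sum, ← Complex.ofReal_pow ‖t‖, PiLp.norm_sq_eq_of_L2]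
  simp [Finset.sum_div, neg_div]

/-- Independent centers and deviations, expressed through the mean and the centered deviations. -/
theorem map_group_eq [Nonempty κ] {σ₁ σ₂ τ : ℝ}
    (hτ : τ ^ 2 = σ₁ ^ 2 + σ₂ ^ 2 / Fintype.card κ) :
    ((stdGaussian E).prod (Measure.pi fun _ : κ => stdGaussian E)).map
        (fun p k => σ₁ • p.1 + σ₂ • p.2 k) =
      ((stdGaussian E).prod (Measure.pi fun _ : κ => stdGaussian E)).map
        (fun p => groupPoint (τ • p.1) σ₂ p.2) := by
  have hc : (0 : ℝ) < Fintype.card κ := by exact_mod_cast Fintype.card_pos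
  set c : ℝ := (Fintype.card κ : ℝ) with hcdef
  have hγ : MeasurePreserving (WithLp.toLp 2 : (κ → E) → _)
      (Measure.pi fun _ : κ => stdGaussian E) (stdGaussian (PiLp 2 fun _ : κ => E)) :=
    ⟨by fun_prop, map_toLp_pi_stdGaussian⟩
  have hmap : ∀ (A : E →L[ℝ] PiLp 2 fun _ : κ => E)
      (B : (PiLp 2 fun _ : κ => E) →L[ℝ] PiLp 2 fun _ : κ => E),
      ((stdGaussian E).prod (Measure.pi fun _ : κ => stdGaussian E)).map
        (fun p => (A p.1 + B (WithLp.toLp 2 p.2)).ofLp) =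
      (((stdGaussian E).prod (stdGaussian (PiLp 2 fun _ : κ => E))).map
        (fun p => A p.1 + B p.2)).map WithLp.ofLp := by
    intro A B
    have h := (MeasurePreserving.id (stdGaussian E)).prod hγ
    rw [← h.map_eq, Measure.map_map (by fun_prop) h.measurable,
      Measure.map_map (by fun_prop) (Measurable.comp (by fun_prop) h.measurable)]
    rfl
  let D := diagonalMap E κ
  let I := ContinuousLinearMap.id ℝ (PiLp 2 fun _ : κ => E)
  let S : (PiLp 2 fun _ : κ => E) →L[ℝ] E := ∑ k, PiLp.proj 2 (fun _ : κ => E) k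
  have hS : ∀ t, S t = ∑ k, t k := fun t => by simp [S]
  have hD : ∀ x t, ⟪D x, t⟫ = ⟪x, S t⟫ := fun x t => by rw [hS]; exact inner_diagonalMap x t
  have hSD : ∀ x, S (D x) = c • x := fun x => by
    rw [hS]; simp [D, diagonalMap_apply, hcdef, Nat.cast_smul_eq_nsmul]
  have key : ((stdGaussian E).prod (stdGaussian (PiLp 2 fun _ : κ => E))).map
      (fun p => (σ₁ • D) p.1 + (σ₂ • I) p.2) =
    ((stdGaussian E).prod (stdGaussian (PiLp 2 fun _ : κ => E))).map
      (fun p => (τ • D) p.1 + (σ₂ • (I - c⁻¹ • (D ∘L S))) p.2) := by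
    -- With `S t` the sum of the components, the forms are `σ₁²‖S t‖² + σ₂²‖t‖²` and `τ²‖S t‖² +
    -- σ₂²(‖t‖² - ‖S t‖²/g)`; they agree by the choice of `τ`.
    refine Measure.ext_of_charFun (funext fun t => ?_)
    rw [charFun_stdGaussian_map_add _ _ (fun t => σ₁ • S t) (fun t => σ₂ • t)
      (fun x t => by simp [real_inner_smul_left, real_inner_smul_right, hD])
      (fun x t => by simp [I, real_inner_smul_left, real_inner_smul_right]),
      charFun_stdGaussian_map_add _ _ (fun t => τ • S t) (fun t => σ₂ • (t - c⁻¹ • D (S t)))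
      (fun x t => by simp [real_inner_smul_left, real_inner_smul_right, hD])
      (fun x t => by
        have : ⟪x, D (S t)⟫ = ⟪S x, S t⟫ := by
          rw [real_inner_comm, hD, real_inner_comm]
        simp [real_inner_smul_left, real_inner_smul_right, inner_sub_left, inner_sub_right, hD,
          this, I])]
    congr 4
    have h1 : ‖D (S t)‖ ^ 2 = c * ‖S t‖ ^ 2 := by
      rw [← real_inner_self_eq_norm_sq, hD, hSD, real_inner_smul_right, real_inner_self_eq_norm_sq]
    have h2 : ⟪t, D (S t)⟫ = ‖S t‖ ^ 2 := by
      rw [real_inner_comm, hD, real_inner_self_eq_norm_sq]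
    simp only [norm_smul, mul_pow, Real.norm_eq_abs, sq_abs]
    rw [norm_sub_sq_real, norm_smul, mul_pow, real_inner_smul_right, h1, h2, hτ, Real.norm_eq_abs,
      sq_abs]
    field_simp
    ring
  have e1 := hmap (σ₁ • D) (σ₂ • I)
  have e2 := hmap (τ • D) (σ₂ • (I - c⁻¹ • (D ∘L S)))
  rw [key, ← e2] at e1
  refine Eq.trans ?_ (e1.trans ?_)
  · rfl
  · congr 1
    ext p k
    simp only [groupPoint]
    simp [hS, I, D, diagonalMap_apply, hcdef]

end GroupLaw

/-! ### Rearrangement of product measures -/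

section Rearrangement

theorem measurePreserving_prodProdProdComm {α β γ δ : Type*} [MeasurableSpace α]
    [MeasurableSpace β] [MeasurableSpace γ] [MeasurableSpace δ] (μa : Measure α) (μb : Measure β)
    (μc : Measure γ) (μd : Measure δ) [SFinite μa] [SFinite μb] [SFinite μc] [SFinite μd] :
    MeasurePreserving (fun q : (α × β) × γ × δ => ((q.1.1, q.2.1), (q.1.2, q.2.2)))
      ((μa.prod μb).prod (μc.prod μd)) ((μa.prod μc).prod (μb.prod μd)) := by
  have h1 := measurePreserving_prodAssoc μa μb (μc.prod μd)
  have h2 := (MeasurePreserving.id μa).prod (measurePreserving_prodAssoc μb μc μd).symm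
  have h3 := (MeasurePreserving.id μa).prod
    ((Measure.measurePreserving_swap (μ := μb) (ν := μc)).prod (MeasurePreserving.id μd))
  have h4 := (MeasurePreserving.id μa).prod (measurePreserving_prodAssoc μc μb μd)
  have h5 := (measurePreserving_prodAssoc μa μc (μb.prod μd)).symm
  exact h5.comp (h4.comp (h3.comp (h2.comp h1)))

variable {X : Type*} [MeasurableSpace X] {ι κ : Type*} [Fintype ι] [Fintype κ]

theorem measurePreserving_curry (ν : Measure X) [IsProbabilityMeasure ν] :
    MeasurePreserving (fun (f : ι × κ → X) i k => f (i, k)) (Measure.pi fun _ => ν)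
      (Measure.pi fun _ => Measure.pi fun _ => ν) := by
  have h := Measure.infinitePi_map_curry (fun (_ : ι) (_ : κ) => ν)
  simp only [Measure.infinitePi_eq_pi] at h
  exact ⟨by fun_prop, h⟩

end Rearrangement

/-! ### Equality of the two descriptions of the data -/

section SampleLaw

variable {d l : ℕ} {ι κ : Type*} [Fintype ι] [Fintype κ]

/-- The data with prescribed standardized centers, deviations and noises. -/
noncomputable def centerData (σ₁ σ₂ σₑ : ℝ)
    (q : (ι → EuclideanSpace ℝ (Fin d)) × (ι → κ → EuclideanSpace ℝ (Fin d)) ×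
      (ι → κ → EuclideanSpace ℝ (Fin l))) :
    (ι → κ → EuclideanSpace ℝ (Fin d)) × (ι → κ → EuclideanSpace ℝ (Fin l)) :=
  (fun j k => σ₁ • q.1 j + σ₂ • q.2.1 j k, fun j k => σₑ • q.2.2 j k)

/-- Group by group this is the decomposition into mean and centered deviations; the noise is the
case without a center, `σ₁ = 0`. -/
theorem sampleLaw_map_groupData [Nonempty κ] {σ₁ σ₂ σₑ τ τ' : ℝ}
    (hτ : τ ^ 2 = σ₁ ^ 2 + σ₂ ^ 2 / Fintype.card κ) (hτ' : τ' ^ 2 = σₑ ^ 2 / Fintype.card κ) :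
    (sampleLaw d l ι κ).map (groupData τ σ₂ τ' σₑ) =
      ((Measure.pi fun _ : ι => stdGaussian (EuclideanSpace ℝ (Fin d))).prod
        ((Measure.pi fun _ : ι => Measure.pi fun _ : κ => stdGaussian (EuclideanSpace ℝ (Fin d))).prod
        (Measure.pi fun _ : ι => Measure.pi fun _ : κ =>
          stdGaussian (EuclideanSpace ℝ (Fin l))))).map (centerData σ₁ σ₂ σₑ) := by
  set γE := stdGaussian (EuclideanSpace ℝ (Fin d))
  set γF := stdGaussian (EuclideanSpace ℝ (Fin l))
  set νx := (γE.prod (Measure.pi fun _ : κ => γE)).map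
        (fun p k => σ₁ • p.1 + σ₂ • p.2 k) with hνx
  set νe := (Measure.pi fun _ : κ => γF).map (fun p k => σₑ • p k) with hνe
  have : IsProbabilityMeasure νx := Measure.isProbabilityMeasure_map (by fun_prop)
  have hem : Measurable fun (p : κ → EuclideanSpace ℝ (Fin l)) k => σₑ • p k := by fun_prop
  have : IsProbabilityMeasure νe := Measure.isProbabilityMeasure_map hem.aemeasurable
  have hνe' : (γF.prod (Measure.pi fun _ : κ => γF)).map (fun p => groupPoint (τ' • p.1) σₑ p.2) =
      νe := by
    rw [← map_group_eq (σ₁ := 0) (by rw [hτ']; ring)]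
    have h2 : MeasurePreserving (Prod.snd : EuclideanSpace ℝ (Fin l) × _ → _)
      (γF.prod (Measure.pi fun _ : κ => γF)) (Measure.pi fun _ : κ => γF) := measurePreserving_snd
    simp only [zero_smul, zero_add]
    conv_rhs => rw [hνe, ← h2.map_eq, Measure.map_map hem measurable_snd]
    rfl
  have hx₁ : MeasurePreserving (fun (p : _ × (κ → EuclideanSpace ℝ (Fin d))) k =>
      σ₁ • p.1 + σ₂ • p.2 k) (γE.prod (Measure.pi fun _ : κ => γE)) νx := ⟨by fun_prop, rfl⟩
  have hx₂ : MeasurePreserving (fun (p : _ × (κ → EuclideanSpace ℝ (Fin d))) =>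
      groupPoint (τ • p.1) σ₂ p.2) (γE.prod (Measure.pi fun _ : κ => γE)) νx :=
    ⟨by unfold groupPoint; fun_prop, (map_group_eq hτ).symm⟩
  have he₁ : MeasurePreserving (fun (p : κ → EuclideanSpace ℝ (Fin l)) k => σₑ • p k)
      (Measure.pi fun _ : κ => γF) νe := ⟨by fun_prop, rfl⟩
  have he₂ : MeasurePreserving (fun (p : _ × (κ → EuclideanSpace ℝ (Fin l))) =>
      groupPoint (τ' • p.1) σₑ p.2) (γF.prod (Measure.pi fun _ : κ => γF)) νe :=
    ⟨by unfold groupPoint; fun_prop, hνe'⟩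
  have h1 : MeasurePreserving (centerData (ι := ι) (κ := κ) σ₁ σ₂ σₑ)
      ((Measure.pi fun _ : ι => γE).prod
        ((Measure.pi fun _ : ι => Measure.pi fun _ : κ => γE).prod
        (Measure.pi fun _ : ι => Measure.pi fun _ : κ => γF)))
      ((Measure.pi fun _ : ι => νx).prod (Measure.pi fun _ : ι => νe)) :=
    ((measurePreserving_pi _ _ fun _ : ι => hx₁).prod (measurePreserving_pi _ _ fun _ : ι => he₁)).comp
      (((measurePreserving_arrowProdEquivProdArrow _ _ ι (fun _ => γE)
        (fun _ => Measure.pi fun _ : κ => γE)).symm.prod (MeasurePreserving.id _)).comp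
        (measurePreserving_prodAssoc _ _ _).symm)
  have h2 : MeasurePreserving (groupData (ι := ι) (κ := κ) τ σ₂ τ' σₑ) (sampleLaw d l ι κ)
      ((Measure.pi fun _ : ι => νx).prod (Measure.pi fun _ : ι => νe)) :=
    ((measurePreserving_pi _ _ fun _ : ι => hx₂).prod (measurePreserving_pi _ _ fun _ : ι => he₂)).comp
      (((measurePreserving_arrowProdEquivProdArrow _ _ ι (fun _ => γE)
        (fun _ => Measure.pi fun _ : κ => γE)).symm.prod
        (measurePreserving_arrowProdEquivProdArrow _ _ ι (fun _ => γF)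
        (fun _ => Measure.pi fun _ : κ => γF)).symm).comp
        ((measurePreserving_prodProdProdComm _ _ _ _).comp
        ((MeasurePreserving.id _).prod (measurePreserving_arrowProdEquivProdArrow _ _ ι
          (fun _ => Measure.pi fun _ : κ => γE) (fun _ => Measure.pi fun _ : κ => γF)))))
  rw [h1.map_eq, h2.map_eq]

end SampleLaw

/-! ### From independent coordinates to Gaussian vectors -/

section VectorLaw

/-- The law of a multiple of a standard Gaussian vector. -/
noncomputable def scaledGaussian (E : Type*) [NormedAddCommGroup E] [InnerProductSpace ℝ E]
    [FiniteDimensional ℝ E] [MeasurableSpace E] [BorelSpace E] (σ : ℝ) : Measure E :=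
  (stdGaussian E).map fun x => σ • x

instance (E : Type*) [NormedAddCommGroup E] [InnerProductSpace ℝ E] [FiniteDimensional ℝ E]
    [MeasurableSpace E] [BorelSpace E] (σ : ℝ) : IsProbabilityMeasure (scaledGaussian E σ) :=
  Measure.isProbabilityMeasure_map (by fun_prop)

theorem measurePreserving_toLp_gaussianReal (d : ℕ) (σ : ℝ≥0) :
    MeasurePreserving (WithLp.toLp 2 : (Fin d → ℝ) → _)
      (Measure.pi fun _ : Fin d => gaussianReal 0 (σ ^ 2))
      (scaledGaussian (EuclideanSpace ℝ (Fin d)) σ) := by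
  have h1 : MeasurePreserving (fun x : ℝ => (σ : ℝ) * x) (gaussianReal 0 1)
      (gaussianReal 0 (σ ^ 2)) := by
    refine ⟨by fun_prop, ?_⟩
    rw [gaussianReal_map_const_mul]
    congr 1
    · simp
    · ext; simp
  have h2 := measurePreserving_pi (fun _ : Fin d => gaussianReal 0 1)
    (fun _ => gaussianReal 0 (σ ^ 2)) fun _ => h1
  refine ⟨by fun_prop, ?_⟩
  rw [scaledGaussian, ← map_pi_eq_stdGaussian, ← h2.map_eq, Measure.map_map (by fun_prop) h2.measurable,
    Measure.map_map (by fun_prop) (by fun_prop)]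
  rfl

theorem measurePreserving_vectors (ι : Type*) [Fintype ι] (d : ℕ) (σ : ℝ≥0) :
    MeasurePreserving (fun (f : ι × Fin d → ℝ) i => WithLp.toLp 2 fun a => f (i, a))
      (Measure.pi fun _ => gaussianReal 0 (σ ^ 2))
      (Measure.pi fun _ : ι => scaledGaussian (EuclideanSpace ℝ (Fin d)) σ) :=
  (measurePreserving_pi _ _ fun _ : ι => measurePreserving_toLp_gaussianReal d σ).comp
    (measurePreserving_curry _)

theorem measurePreserving_vectors₂ (ι κ : Type*) [Fintype ι] [Fintype κ] (d : ℕ) (σ : ℝ≥0) :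
    MeasurePreserving (fun (f : ι × κ × Fin d → ℝ) i k => WithLp.toLp 2 fun a => f (i, k, a))
      (Measure.pi fun _ => gaussianReal 0 (σ ^ 2))
      (Measure.pi fun _ : ι => Measure.pi fun _ : κ =>
        scaledGaussian (EuclideanSpace ℝ (Fin d)) σ) :=
  (measurePreserving_pi _ _ fun _ : ι => measurePreserving_vectors κ d σ).comp
    (measurePreserving_curry _)

theorem measurePreserving_smul_map {E : Type*} [NormedAddCommGroup E] [InnerProductSpace ℝ E]
    [FiniteDimensional ℝ E] [MeasurableSpace E] [BorelSpace E] (σ : ℝ) :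
    MeasurePreserving (fun x : E => σ • x) (stdGaussian E) (scaledGaussian E σ) :=
  ⟨by fun_prop, rfl⟩

end VectorLaw

/-! ### Transfer to the given probability space -/

section Transfer

variable {Ω : Type*} [MeasurableSpace Ω] {μ : Measure Ω} [IsProbabilityMeasure μ] {m g d l : ℕ}
  {σ₁ σ₂ σₑ : ℝ≥0} {center : Ω → Fin m → Fin d → ℝ} {dev : Ω → Fin m → Fin g → Fin d → ℝ}
  {noise : Ω → Fin m → Matrix (Fin g) (Fin l) ℝ}

/-- Every coordinate law is the image of a standard Gaussian under a multiplication, also for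
variance zero, so degenerate parameters need no separate treatment. -/
theorem IsGroupedGaussian.hasLaw (h : IsGroupedGaussian μ σ₁ σ₂ σₑ center dev noise) :
    HasLaw (fun ω => (fun j k => WithLp.toLp 2 fun a => center ω j a + dev ω j k a,
        fun j k => WithLp.toLp 2 (noise ω j k)))
      (((Measure.pi fun _ : Fin m => stdGaussian (EuclideanSpace ℝ (Fin d))).prod
        ((Measure.pi fun _ : Fin m => Measure.pi fun _ : Fin g =>
          stdGaussian (EuclideanSpace ℝ (Fin d))).prod
        (Measure.pi fun _ : Fin m => Measure.pi fun _ : Fin g =>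
          stdGaussian (EuclideanSpace ℝ (Fin l))))).map (centerData (σ₁ : ℝ) σ₂ σₑ)) μ := by
  let v : (Fin m × Fin d) ⊕ ((Fin m × Fin g × Fin d) ⊕ (Fin m × Fin g × Fin l)) → ℝ≥0 :=
    Sum.elim (fun _ => σ₁ ^ 2) (Sum.elim (fun _ => σ₂ ^ 2) (fun _ => σₑ ^ 2))
  let f : (Fin m × Fin d) ⊕ ((Fin m × Fin g × Fin d) ⊕ (Fin m × Fin g × Fin l)) → Ω → ℝ :=
    Sum.elim (fun (q : Fin m × Fin d) ω => center ω q.1 q.2)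
      (Sum.elim (fun (q : Fin m × Fin g × Fin d) ω => dev ω q.1 q.2.1 q.2.2)
        (fun (q : Fin m × Fin g × Fin l) ω => noise ω q.1 q.2.1 q.2.2))
  have hf : ∀ i, HasLaw (f i) (gaussianReal 0 (v i)) μ := by
    rintro (q | q | q)
    · exact h.center_law q.1 q.2
    · exact h.dev_law q.1 q.2.1 q.2.2
    · exact h.noise_law q.1 q.2.1 q.2.2
  have hlaw : HasLaw (fun ω i => f i ω) (Measure.pi fun i => gaussianReal 0 (v i)) μ := by
    refine ⟨aemeasurable_pi_lambda _ fun i => (hf i).aemeasurable, ?_⟩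
    rw [(iIndepFun_iff_map_fun_eq_pi_map fun i => (hf i).aemeasurable).1 h.indep]
    congr 1
    exact funext fun i => (hf i).map_eq
  have h1 := (measurePreserving_vectors (Fin m) d σ₁).prod
    (((measurePreserving_vectors₂ (Fin m) (Fin g) d σ₂).prod
      (measurePreserving_vectors₂ (Fin m) (Fin g) l σₑ)).comp
        (measurePreserving_sumPiEquivProdPi (X := fun _ => ℝ)
          fun i => gaussianReal 0 (v (Sum.inr i))))
  have h2 := h1.comp (measurePreserving_sumPiEquivProdPi (X := fun _ => ℝ)
    fun i => gaussianReal 0 (v i))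
  have h3 := (measurePreserving_pi _ _ fun _ : Fin m => measurePreserving_smul_map
      (E := EuclideanSpace ℝ (Fin d)) σ₁).prod
    ((measurePreserving_pi _ _ fun _ : Fin m => measurePreserving_pi _ _ fun _ : Fin g =>
      measurePreserving_smul_map (E := EuclideanSpace ℝ (Fin d)) σ₂).prod
    (measurePreserving_pi _ _ fun _ : Fin m => measurePreserving_pi _ _ fun _ : Fin g =>
      measurePreserving_smul_map (E := EuclideanSpace ℝ (Fin l)) σₑ))
  let add : (Fin m → EuclideanSpace ℝ (Fin d)) × (Fin m → Fin g → EuclideanSpace ℝ (Fin d)) ×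
      (Fin m → Fin g → EuclideanSpace ℝ (Fin l)) →
      (Fin m → Fin g → EuclideanSpace ℝ (Fin d)) × (Fin m → Fin g → EuclideanSpace ℝ (Fin l)) :=
    fun q => (fun j k => q.1 j + q.2.1 j k, q.2.2)
  have hadd : Measurable add := by fun_prop
  have h4 := h2.hasLaw.comp hlaw
  have h6 : HasLaw _ (Measure.map add _) μ := HasLaw.comp ⟨hadd.aemeasurable, rfl⟩ h4
  rw [← h3.map_eq, Measure.map_map hadd h3.measurable] at h6
  exact h6

/-- The law of the data in terms of standardized group means and deviations. -/
theorem IsGroupedGaussian.measure_not_le (h : IsGroupedGaussian μ σ₁ σ₂ σₑ center dev noise)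
    [Nonempty (Fin g)] {τ τ' : ℝ} (hτ : τ ^ 2 = σ₁ ^ 2 + σ₂ ^ 2 / g) (hτ' : τ' ^ 2 = σₑ ^ 2 / g)
    {P : (Fin m → Fin g → EuclideanSpace ℝ (Fin d)) × (Fin m → Fin g → EuclideanSpace ℝ (Fin l)) →
      Prop} (hP : MeasurableSet {D | P D}) :
    μ {ω | ¬ P (fun j k => WithLp.toLp 2 fun a => center ω j a + dev ω j k a,
        fun j k => WithLp.toLp 2 (noise ω j k))} =
      sampleLaw d l (Fin m) (Fin g) {q | ¬ P (groupData τ σ₂ τ' σₑ q)} := by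
  have hlaw := h.hasLaw
  rw [← sampleLaw_map_groupData (by simpa using hτ) (by simpa using hτ')] at hlaw
  refine (Measure.map_apply_of_aemeasurable hlaw.aemeasurable hP.compl).symm.trans ?_
  rw [hlaw.map_eq]
  exact Measure.map_apply (measurable_groupData _ _ _ _) hP.compl

end Transfer

/-! ### Sample sizes -/

section SampleSize

/-- The sample-size constant. -/
noncomputable def sampleConst (l : ℕ) (κ : ℝ) : ℝ :=
  8 + 2 * l + 6 * κ / assignProb l + 12 * κ / farConst l +
    8 * l * κ / gramConst ^ 2 * (8 * nnConst l * (l + 1)) ^ 2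

theorem sampleConst_pos (l : ℕ) {κ : ℝ} (hκ : 0 ≤ κ) : 0 < sampleConst l κ := by
  have h1 := assignProb_pos l
  have h2 := farConst_pos l
  unfold sampleConst
  positivity

theorem farConst_le_one (l : ℕ) : farConst l ≤ 1 :=
  (min_le_right _ _).trans ((min_le_left _ _).trans (by norm_num))

theorem farConst_le (l : ℕ) : farConst l ≤ 1 / 6000 :=
  (min_le_right _ _).trans (min_le_left _ _)

variable {n m g d : ℕ} {c₀ p : ℝ}

/-- For `n ≤ 1` the value of `Real.log n` is zero and the condition involving it says nothing; the
condition with `log² d` forces `n` to be large. The factor comes from `2 * 0.69² > 1/2`. -/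
theorem half_le_sampleSize (hc : 0 ≤ c₀) (hg : 1 ≤ g) (hd : 2 ≤ d) (hp : 1 ≤ p)
    (h : c₀ * p * g * d * Real.log d ^ 2 ≤ n) : c₀ / 2 ≤ n := by
  have hg' : (1 : ℝ) ≤ g := by exact_mod_cast hg
  have hd' : (2 : ℝ) ≤ d := by exact_mod_cast hd
  have h1 : (0.69 : ℝ) ≤ Real.log d :=
    (by have := Real.log_two_gt_d9; linarith : (0.69 : ℝ) ≤ Real.log 2).trans
      (Real.log_le_log (by norm_num) hd')
  refine le_trans ?_ h
  calc c₀ / 2 ≤ c₀ * 1 * 1 * 2 * 0.69 ^ 2 := by norm_num; linarith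
    _ ≤ _ := by gcongr

theorem card_groups_ge (hg : 1 ≤ g) (hn : n = m * g) (h : c₀ * p * g * d * Real.log n ≤ n) :
    c₀ * p * d * Real.log n ≤ m := by
  have hg' : (0 : ℝ) < g := by exact_mod_cast hg
  rw [hn] at h ⊢
  push_cast at h ⊢
  refine le_of_mul_le_mul_right ?_ hg'
  linarith

theorem one_le_log_of_four_le {x : ℝ} (hx : 4 ≤ x) : 1 ≤ Real.log x := by
  rw [Real.le_log_iff_exp_le (by linarith)]
  have := Real.exp_one_lt_d9
  linarith

/-- Three factors of size at most `n` are absorbed by the exponential tail. -/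
theorem mul_exp_neg_mul_log_le {x a₁ a₂ a₃ κ : ℝ} (hx : 0 < x) (h₂ : 0 ≤ a₂)
    (h₃ : 0 ≤ a₃) (h₁' : a₁ ≤ x) (h₂' : a₂ ≤ x) (h₃' : a₃ ≤ x) :
    a₁ * a₂ * a₃ * Real.exp (-(κ * Real.log x)) ≤ Real.exp (-((κ - 3) * Real.log x)) := by
  have h : Real.exp (-((κ - 3) * Real.log x)) = x * x * x * Real.exp (-(κ * Real.log x)) := by
    have : -((κ - 3) * Real.log x) =
      Real.log x + Real.log x + Real.log x + -(κ * Real.log x) := by ring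
    rw [this, Real.exp_add, Real.exp_add, Real.exp_add, Real.exp_log hx]
  rw [h]
  gcongr

end SampleSize

/-! ### Error bounds on good data -/

section Deterministic

variable {m g d l : ℕ} {B : Matrix (Fin d) (Fin l) ℝ} {x : Fin m → Fin g → EuclideanSpace ℝ (Fin d)}
  {e : Fin m → Fin g → EuclideanSpace ℝ (Fin l)} {X : Fin m → Matrix (Fin g) (Fin d) ℝ}
  {Z N : Fin m → Matrix (Fin g) (Fin l) ℝ} {π : Fin m → Equiv.Perm (Fin g)}
  {assign : Fin m → Fin g → Fin g} {T : Finset (EuclideanSpace ℝ (Fin d))}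

/-- The constant of the error bounds. -/
noncomputable def errorConst (l : ℕ) : ℝ := √(512 * l / (assignProb l * farConst l ^ 2)) + 1

theorem one_le_errorConst (l : ℕ) : 1 ≤ errorConst l :=
  le_add_of_nonneg_left (Real.sqrt_nonneg _)

theorem estimators_of_good (hm : 1 ≤ m) (hg : 1 ≤ g) (hX : ∀ j k, X j k = (x j k).ofLp)
    (hN : ∀ j k, N j k = (e j k).ofLp) (hZ : Z = responses π X B N)
    (hassign : IsAssignment X Z (estNoAS X Z) assign) {η M σₓ R q : ℝ}
    (hT : ∀ u : EuclideanSpace ℝ (Fin d), ‖u‖ = 1 → ∃ u' ∈ T, ‖u - u'‖ ≤ η)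
    (hσₓ : 0 < σₓ) (hη : M * η ≤ farConst l * σₓ / 2) (hq : 0 ≤ q)
    (hreg : RegularData (transposeMap B) R M (24 * (m * g) * l * σₓ ^ 2) q (x, e))
    (hfar : FarData (transposeMap B) T (farConst l * σₓ) (3 / 16 * assignProb l * (m * g)) (x, e)) :
    LRWellPosed (groupSums X) ∧ LRWellPosed (assigned X assign) ∧
      ‖estNoAS X Z - B‖ ^ 2 ≤ R ∧
      ‖estAS X Z assign - B‖ ≤ errorConst l * (√(q + ‖estNoAS X Z - B‖ ^ 2) * √(q + 1)) := by
  have hm' : (0 : ℝ) < m := by exact_mod_cast hm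
  have hg' : (0 : ℝ) < g := by exact_mod_cast hg
  have ha := assignProb_pos l
  have hf := farConst_pos l
  have hfit := transposeMap_estNoAS (B := B) (π := π) hX hN hZ
  have hnorm : ‖groupFit (transposeMap B) (x, e) - transposeMap B‖ = ‖estNoAS X Z - B‖ := by
    rw [← hfit, norm_transposeMap_sub]
  have h1 := hreg.fit
  have h2 := hreg.error
  rw [hnorm] at h1 h2
  obtain ⟨h3, h4⟩ := estAS_of_good hX hN hZ hassign hT hreg.norm_le hη (by positivity)
    (by positivity) hfar h2
  refine ⟨?_, h3, h1, ?_⟩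
  · have : groupSums X = fun j => (∑ k, x j k).ofLp := funext (groupSums_eq_ofLp hX)
    rw [this]
    exact hreg.wellPosed
  set r := ‖estNoAS X Z - B‖ with hr
  -- The constant is `24 / (3/16 * (1/2)²) = 512`, from the residual bound and the Gram bound; `m`,
  -- `g` and `σₓ` cancel.
  have h5 : ‖estAS X Z assign - estNoAS X Z‖ ≤
      √(512 * l / (assignProb l * farConst l ^ 2)) * √(q + r ^ 2) := by
    rw [← Real.sqrt_mul (by positivity)]
    refine Real.le_sqrt_of_sq_le (h4.trans (le_of_eq ?_))
    field_simp
    ring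
  have h6 : r ≤ √(q + r ^ 2) := Real.le_sqrt_of_sq_le (by linarith)
  have h7 : 1 ≤ √(q + 1) := Real.one_le_sqrt.2 (by linarith)
  have h8 : ‖estAS X Z assign - B‖ ≤ ‖estAS X Z assign - estNoAS X Z‖ + r := by
    rw [hr, ← sub_add_sub_cancel (estAS X Z assign) (estNoAS X Z) B]
    exact norm_add_le _ _
  calc ‖estAS X Z assign - B‖ ≤ errorConst l * √(q + r ^ 2) := by
        rw [errorConst, add_mul, one_mul]; linarith
    _ ≤ _ := by
        have := one_le_errorConst l
        gcongr
        exact le_mul_of_one_le_right (Real.sqrt_nonneg _) h7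

end Deterministic

/-! ### The sample-size conditions suffice -/

section Probability

theorem natCast_mul_ofReal (k : ℕ) (x : ℝ) :
    (k : ℝ≥0∞) * ENNReal.ofReal x = ENNReal.ofReal (k * x) := by
  rw [ENNReal.ofReal_mul (Nat.cast_nonneg _), ENNReal.ofReal_natCast]

/-- The parameters are `t = κ log n` with `κ = c₁ + 5`, the truncation level `L = √(2 t)` and a net
of mesh `√d / n`. The number of groups is at least `c₀ p d log n`, which pays for the net, for the
accuracy of the first fit and for the mesh error `d L / n`. -/
theorem exists_good_of_sampleSize {l n m g d : ℕ} {p c₁ : ℝ} (hc₁ : 0 < c₁) (hl : 1 ≤ l)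
    (hn : n = m * g) (hg : 1 ≤ g) (hd : 2 ≤ d) (hp : 1 ≤ p)
    (hA : sampleConst l (c₁ + 5) * p * g * d * Real.log d ^ 2 ≤ n)
    (hB : sampleConst l (c₁ + 5) * p * g * d * Real.log n ≤ n)
    {b : EuclideanSpace ℝ (Fin d) →L[ℝ] EuclideanSpace ℝ (Fin l)} (hb : ‖b‖ = 1)
    {τ σ₂ τ' σₑ σₓ : ℝ} (hτ : 0 < τ) (hσ₂ : 0 ≤ σ₂) (hσₑ : 0 ≤ σₑ) (hσₓ : 0 < σₓ)
    (hτ' : g * τ' ^ 2 = σₑ ^ 2) (hτσ : τ ≤ σₓ) (hσ₂σ : σ₂ ≤ σₓ)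
    (hσₓκ : σₓ ≤ g * τ) (hσₓτ : σₓ ≤ τ + σ₂) (hσ₂τ : σ₂ ^ 2 ≤ g * τ ^ 2) :
    ∃ (T : Finset (EuclideanSpace ℝ (Fin d))) (η M : ℝ),
      (∀ u : EuclideanSpace ℝ (Fin d), ‖u‖ = 1 → ∃ u' ∈ T, ‖u - u'‖ ≤ η) ∧
      M * η ≤ farConst l * σₓ / 2 ∧
      sampleLaw d l (Fin m) (Fin g) {q | ¬ (RegularData b (σₑ ^ 2 / (p * (g * τ ^ 2))) M
        (24 * (m * g) * l * σₓ ^ 2) (σₑ ^ 2 / σₓ ^ 2) (groupData τ σ₂ τ' σₑ q) ∧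
        FarData b T (farConst l * σₓ) (3 / 16 * assignProb l * (m * g))
          (groupData τ σ₂ τ' σₑ q))} ≤ ENNReal.ofReal ((n : ℝ) ^ (-c₁)) := by
  have ha := assignProb_pos l
  have ha1 := assignProb_le_one l
  have hf := farConst_pos l
  have hG := gramConst_pos
  have hK := one_le_nnConst l
  set κ := c₁ + 5 with hκ
  have hκ0 : 5 < κ := by linarith
  set c₀ := sampleConst l κ with hc₀
  have hl0 : (1 : ℝ) ≤ l := by exact_mod_cast hl
  have p1 : 0 ≤ 6 * κ / assignProb l := by positivity
  have p2 : 0 ≤ 12 * κ / farConst l := by positivity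
  have p3 : 0 ≤ 8 * l * κ / gramConst ^ 2 * (8 * nnConst l * (l + 1)) ^ 2 := by positivity
  have hc₀l : 8 + 2 * (l : ℝ) ≤ c₀ := by rw [hc₀, sampleConst]; linarith
  have hc₀a : 6 * κ / assignProb l ≤ c₀ := by rw [hc₀, sampleConst]; linarith
  have hc₀f : 12 * κ / farConst l ≤ c₀ := by rw [hc₀, sampleConst]; linarith
  have hc₀G : 8 * l * κ / gramConst ^ 2 * (8 * nnConst l * (l + 1)) ^ 2 ≤ c₀ := by
    rw [hc₀, sampleConst]; linarith
  have hc0 : 0 < c₀ := by linarith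
  have hhalf := half_le_sampleSize hc0.le hg hd hp hA
  have hn4 : (4 : ℝ) ≤ n := by linarith
  have hln : (l : ℝ) ≤ n := by linarith
  set y := Real.log n with hy
  have hy1 : 1 ≤ y := one_le_log_of_four_le hn4
  have hm := card_groups_ge hg hn hB
  have hd' : (2 : ℝ) ≤ d := by exact_mod_cast hd
  have hg' : (1 : ℝ) ≤ g := by exact_mod_cast hg
  have hnmg : (n : ℝ) = m * g := by rw [hn]; push_cast; ring
  have hmdy : c₀ * (d * y) ≤ m := by
    refine le_trans ?_ hm
    calc c₀ * (d * y) = c₀ * 1 * d * y := by ring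
      _ ≤ c₀ * p * d * y := by gcongr
  have hdy : (d : ℝ) ≤ d * y := le_mul_of_one_le_right (by positivity) hy1
  have hyd : y ≤ d * y := le_mul_of_one_le_left (by positivity) (by linarith)
  have hdm : (d : ℝ) ≤ m :=
    hdy.trans ((le_mul_of_one_le_left (by positivity) (by linarith)).trans hmdy)
  have hm0 : (0 : ℝ) < m := by linarith
  have hm1 : 1 ≤ m := by exact_mod_cast Nat.cast_pos.1 hm0
  have hmn : (m : ℝ) ≤ n := by rw [hnmg]; exact le_mul_of_one_le_right hm0.le hg'
  have hdn : (d : ℝ) ≤ n := hdm.trans hmn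
  have hn0 : (0 : ℝ) < n := by linarith
  have hnN : 0 < n := by exact_mod_cast hn0
  have hexp : (n : ℝ) = Real.exp y := (Real.exp_log hn0).symm
  set t := κ * y with ht
  have ht0 : 0 ≤ t := by positivity
  have ht1 : 5 ≤ t := hκ0.le.trans (le_mul_of_one_le_right (by linarith) hy1)
  set L := √(2 * t) with hL
  have hL2 : L ^ 2 = 2 * t := Real.sq_sqrt (by positivity)
  have hL1 : 1 ≤ L := Real.one_le_sqrt.2 (by linarith)
  have hLt : L ≤ 2 * t := (le_self_pow₀ hL1 two_ne_zero).trans hL2.le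
  obtain ⟨T, hT1, hTcard, hT⟩ := exists_sphere_net d hnN
  have hdL : d * L / n ≤ farConst l / 6 := by
    rw [div_le_iff₀ hn0]
    have h1 : 12 * κ ≤ c₀ * farConst l := (div_le_iff₀ hf).1 hc₀f
    have h2 : d * L ≤ d * (2 * t) := by gcongr
    have h3 : 12 * κ * (d * y) ≤ farConst l * m := by
      calc 12 * κ * (d * y) ≤ c₀ * farConst l * (d * y) := by gcongr
        _ = farConst l * (c₀ * (d * y)) := by ring
        _ ≤ farConst l * m := by gcongr
    have h4 : farConst l * m ≤ farConst l * n := by gcongr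
    have h5 : d * (2 * t) = 2 * κ * (d * y) := by rw [ht]; ring
    linarith
  have hsq : √(d : ℝ) * √(d : ℝ) = d := Real.mul_self_sqrt (by positivity)
  have hη : √(d : ℝ) * L * (√(d : ℝ) / n) ≤ 1 / 6000 / 2 := by
    have : √(d : ℝ) * L * (√(d : ℝ) / n) = √(d : ℝ) * √(d : ℝ) * L / n := by ring
    rw [hsq] at this
    rw [this]
    have := farConst_le l
    linarith
  have hM : 3 * σₓ * (√(d : ℝ) * L) * (√(d : ℝ) / n) ≤ farConst l * σₓ / 2 := by
    have : 3 * σₓ * (√(d : ℝ) * L) * (√(d : ℝ) / n) =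
        3 * σₓ * (√(d : ℝ) * √(d : ℝ) * L / n) := by ring
    rw [hsq] at this
    rw [this]
    calc 3 * σₓ * (d * L / n) ≤ 3 * σₓ * (farConst l / 6) := by gcongr
      _ = farConst l * σₓ / 2 := by ring
  have hTne : T.Nonempty := by
    obtain ⟨u', hu', -⟩ := hT (EuclideanSpace.single ⟨0, by omega⟩ 1) (by simp)
    exact ⟨u', hu'⟩
  -- The factor `1/p` gives the rate of the first estimator; the bound without it is the accuracy
  -- that the nearest neighbour argument requires.
  have hr : 8 * l * d * t / (gramConst ^ 2 * m) ≤ (1 / (8 * nnConst l * (l + 1))) ^ 2 / p := by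
    have hp0 : 0 < p := by linarith
    have h1 : 8 * l * κ * (8 * nnConst l * (l + 1)) ^ 2 ≤ c₀ * gramConst ^ 2 := by
      rw [div_mul_eq_mul_div, div_le_iff₀ (by positivity)] at hc₀G
      exact hc₀G
    rw [div_pow, one_pow, div_div, div_le_div_iff₀ (by positivity) (by positivity), one_mul]
    calc 8 * l * d * t * ((8 * nnConst l * (l + 1)) ^ 2 * p)
        = (8 * l * κ * (8 * nnConst l * (l + 1)) ^ 2) * (p * d * y) := by rw [ht]; ring
      _ ≤ (c₀ * gramConst ^ 2) * (p * d * y) := by gcongr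
      _ = gramConst ^ 2 * (c₀ * p * d * y) := by ring
      _ ≤ gramConst ^ 2 * m := by gcongr
  have hK1 : (1 / (8 * nnConst l * (l + 1))) ^ 2 ≤ 1 := by
    refine pow_le_one₀ (by positivity) ?_
    rw [div_le_one (by positivity)]
    exact one_le_mul_of_one_le_of_one_le (by linarith) (by linarith)
  have hfit : 8 * l * d * t / (gramConst ^ 2 * m) ≤ (1 / (8 * nnConst l * (l + 1))) ^ 2 :=
    hr.trans (div_le_self (by positivity) hp)
  have hR : 8 * l * d * t / (gramConst ^ 2 * m) * (σₑ ^ 2 / (g * τ ^ 2)) ≤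
      σₑ ^ 2 / (p * (g * τ ^ 2)) := by
    calc _ ≤ 1 / p * (σₑ ^ 2 / (g * τ ^ 2)) := by
          refine mul_le_mul_of_nonneg_right (hr.trans ?_) (by positivity)
          gcongr
      _ = _ := by rw [div_mul_div_comm, one_mul]
  have hmκ : 2 * κ * y ≤ m := by
    have h1 : 12 * κ ≤ c₀ :=
      (le_div_self (by positivity) hf (farConst_le_one l)).trans hc₀f
    calc 2 * κ * y ≤ c₀ * (d * y) := by
          gcongr
          linarith
      _ ≤ m := hmdy
  have hexpm : Real.exp (-(m : ℝ) / 2) ≤ Real.exp (-(κ * y)) := Real.exp_le_exp.2 (by linarith)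
  have : Nonempty (Fin m) := ⟨⟨0, hm1⟩⟩
  have : Nonempty (Fin g) := ⟨⟨0, hg⟩⟩
  have hn1 : (1 : ℝ) ≤ n := by linarith
  have htail : ∀ {a₁ a₂ a₃ : ℝ}, 0 ≤ a₂ → 0 ≤ a₃ → a₁ ≤ n → a₂ ≤ n → a₃ ≤ n →
      a₁ * a₂ * a₃ * Real.exp (-(κ * y)) ≤ Real.exp (-((κ - 3) * y)) :=
    fun h₂ h₃ => mul_exp_neg_mul_log_le hn0 h₂ h₃
  have key := sampleLaw_not_good_le (ι := Fin m) (κ := Fin g) (δ := ENNReal.ofReal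
      (Real.exp (-((κ - 3) * y)))) (t := t) (L := L) (b := b) (τ := τ) (σ₂ := σ₂) (τ' := τ')
      (σₑ := σₑ) (σₓ := σₓ) hl hT1 hTne hT hb (by linarith) ht0 hη hτ hσ₂ hσₑ hσₓ
      (by simpa using hτ') hτσ hσ₂σ (by simpa using hσₓκ) hσₓτ (by simpa using hσ₂τ)
      (by simpa using hfit) ?_ ?_ ?_ ?_ ?_
  · refine ⟨T, √d / n, 3 * σₓ * (√d * L), hT, hM, (measure_mono ?_).trans (key.trans ?_)⟩
    · intro q hq hq'
      refine hq ⟨?_, ?_⟩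
      · have h := hq'.1
        simp only [Fintype.card_fin] at h
        exact ⟨h.wellPosed, h.fit.trans hR, h.norm_le, h.error⟩
      · have h := hq'.2
        simp only [Fintype.card_fin] at h
        exact h
    · have h14 : (14 : ℝ≥0∞) = ENNReal.ofReal 14 := by simp
      rw [h14, ← ENNReal.ofReal_mul (by norm_num)]
      refine ENNReal.ofReal_le_ofReal ?_
      rw [Real.rpow_def_of_pos hn0, ← hy]
      -- Of the five extra powers of `n`, three absorb the prefactors of the tails and the remaining
      -- two the factor 14, since `n ≥ 4`.
      have : Real.exp (y * -c₁) = n * n * Real.exp (-((κ - 3) * y)) := by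
        rw [hexp, ← Real.exp_add, ← Real.exp_add]
        congr 1
        rw [hκ]; ring
      rw [this]
      gcongr
      calc (14 : ℝ) ≤ 4 * 4 := by norm_num
        _ ≤ n * n := by gcongr
  · rw [natCast_mul_ofReal]
    refine ENNReal.ofReal_le_ofReal ?_
    rw [Fintype.card_fin]
    -- From `2 n + 1 ≤ n²`. As `assignProb l * m` is at least `6 κ d log n` and `3/16 * 6 > 1`, the
    -- Chernoff exponent exceeds `κ d log n` and leaves enough after the net has been paid for.
    have h1 : (T.card : ℝ) ≤ Real.exp (2 * (d * y)) := by
      have : Real.exp (2 * (d * y)) = ((n : ℝ) * n) ^ d := by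
        rw [hexp, ← Real.exp_add, ← Real.exp_nat_mul]
        congr 1; ring
      rw [this]
      refine (show (T.card : ℝ) ≤ (2 * n + 1 : ℝ) ^ d by exact_mod_cast hTcard).trans ?_
      gcongr
      calc (2 * n + 1 : ℝ) ≤ 4 * n := by linarith
        _ ≤ n * n := by gcongr
    calc (T.card : ℝ) * Real.exp (-(3 / 16 * assignProb l * m))
        ≤ Real.exp (2 * (d * y)) * Real.exp (-(3 / 16 * assignProb l * m)) := by gcongr
      _ = Real.exp (2 * (d * y) - 3 / 16 * assignProb l * m) := by
          rw [← Real.exp_add]; rfl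
      _ ≤ _ := by
          refine Real.exp_le_exp.2 ?_
          have h2 : 6 * κ ≤ c₀ * assignProb l := (div_le_iff₀ ha).1 hc₀a
          have h3 : 6 * κ * (d * y) ≤ assignProb l * m := by
            calc 6 * κ * (d * y) ≤ c₀ * assignProb l * (d * y) := by gcongr
              _ = assignProb l * (c₀ * (d * y)) := by ring
              _ ≤ assignProb l * m := by gcongr
          have h4 : (κ - 3) * y ≤ (κ - 2) * (d * y) :=
            mul_le_mul (by linarith) hyd (by linarith) (by linarith)
          have h5 : 0 ≤ κ * (d * y) := by positivity
          linarith
  · rw [natCast_mul_ofReal, natCast_mul_ofReal, natCast_mul_ofReal]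
    refine ENNReal.ofReal_le_ofReal ?_
    simp only [Fintype.card_fin]
    have : -L ^ 2 / 2 = -(κ * y) := by rw [hL2, ht]; ring
    rw [this]
    refine le_trans (le_of_eq ?_) (htail (a₁ := n) (a₂ := d) (a₃ := 2) (by positivity)
      (by norm_num) le_rfl hdn (by linarith))
    rw [hnmg]; ring
  · rw [natCast_mul_ofReal, Fintype.card_fin]
    refine ENNReal.ofReal_le_ofReal (le_trans ?_ (htail (a₁ := l) (a₂ := 1) (a₃ := 1) (by norm_num)
      (by norm_num) hln hn1 hn1))
    rw [mul_one, mul_one]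
    gcongr
  · rw [natCast_mul_ofReal, Fintype.card_fin]
    refine ENNReal.ofReal_le_ofReal (le_trans ?_ (htail (a₁ := d) (a₂ := 1) (a₃ := 1) (by norm_num)
      (by norm_num) hdn hn1 hn1))
    rw [mul_one, mul_one]
    gcongr
  · have h2 : (2 : ℝ≥0∞) = ((2 : ℕ) : ℝ≥0∞) := by norm_num
    rw [h2, natCast_mul_ofReal, natCast_mul_ofReal, natCast_mul_ofReal]
    refine ENNReal.ofReal_le_ofReal (le_trans (le_of_eq ?_) (htail (a₁ := l) (a₂ := d) (a₃ := 2)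
      (by positivity) (by norm_num) hln hdn (by linarith)))
    push_cast
    ring

end Probability

/-! ### The theorem on both estimators -/

theorem theorem1 (l : ℕ) :
    ∃ C : ℝ, 0 < C ∧ ∀ c₁ : ℝ, 0 < c₁ → ∃ c₀ : ℝ, 0 < c₀ ∧
      ∀ (n m g d : ℕ) (p : ℝ) (σ₁ σ₂ σₑ : ℝ≥0) (B : Matrix (Fin d) (Fin l) ℝ),
        n = m * g → 1 ≤ g → 2 ≤ d → 1 ≤ p → 0 < σ₁ ^ 2 + σ₂ ^ 2 → ‖B‖ = 1 →
        c₀ * p * g * d * Real.log d ^ 2 ≤ n →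
        c₀ * p * g * d * Real.log n ≤ n →
        ∀ {Ω : Type*} [MeasurableSpace Ω] (μ : Measure Ω) [IsProbabilityMeasure μ]
          (center : Ω → Fin m → Fin d → ℝ) (dev : Ω → Fin m → Fin g → Fin d → ℝ)
          (noise : Ω → Fin m → Matrix (Fin g) (Fin l) ℝ)
          (perm : Ω → Fin m → Equiv.Perm (Fin g))
          (X : Ω → Fin m → Matrix (Fin g) (Fin d) ℝ)
          (Z : Ω → Fin m → Matrix (Fin g) (Fin l) ℝ)
          (assign : Ω → Fin m → Fin g → Fin g),
          IsGroupedGaussian μ σ₁ σ₂ σₑ center dev noise →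
          (∀ ω, X ω = features (center ω) (dev ω)) →
          (∀ ω, Z ω = responses (perm ω) (X ω) B (noise ω)) →
          (∀ ω, IsAssignment (X ω) (Z ω) (estNoAS (X ω) (Z ω)) (assign ω)) →
          μ {ω | ¬ (LRWellPosed (groupSums (X ω)) ∧ LRWellPosed (assigned (X ω) (assign ω)) ∧
              ‖estNoAS (X ω) (Z ω) - B‖ ≤ C * (√(1 / (p * (g * σ₁ ^ 2 + σ₂ ^ 2))) * σₑ) ∧
              ‖estAS (X ω) (Z ω) (assign ω) - B‖ ≤
                C * (√(1 / (p * g * (σ₁ ^ 2 + σ₂ ^ 2))) * σₑ) +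
                C * (√(σₑ ^ 2 / (σ₁ ^ 2 + σ₂ ^ 2) + ‖estNoAS (X ω) (Z ω) - B‖ ^ 2) *
                  √(σₑ ^ 2 / (σ₁ ^ 2 + σ₂ ^ 2) + 1)))}
            ≤ ENNReal.ofReal ((n : ℝ) ^ (-c₁)) := by

  refine ⟨errorConst l, by linarith [one_le_errorConst l], fun c₁ hc₁ =>
    ⟨sampleConst l (c₁ + 5), sampleConst_pos l (by linarith), ?_⟩⟩
  intro n m g d p σ₁ σ₂ σₑ B hn hg hd hp hσ hB hA hB' Ω _ μ _ center dev noise perm X Z assign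
    hlaw hX hZ hassign
  have hC := one_le_errorConst l
  -- A matrix without columns is zero and cannot have norm one.
  have hl : 1 ≤ l := by
    rcases Nat.eq_zero_or_pos l with rfl | h
    · have : B = 0 := by ext i j; exact j.elim0
      rw [this, norm_zero] at hB
      exact absurd hB zero_ne_one
    · exact h
  have hg' : (1 : ℝ) ≤ g := by exact_mod_cast hg
  have hg0 : (0 : ℝ) < g := by linarith
  have : Nonempty (Fin g) := ⟨⟨0, hg⟩⟩
  have hσ' : (0 : ℝ) < (σ₁ : ℝ) ^ 2 + (σ₂ : ℝ) ^ 2 := by exact_mod_cast hσ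
  have hs1 : (0 : ℝ) ≤ (σ₁ : ℝ) ^ 2 := by positivity
  have hs2 : (0 : ℝ) ≤ (σ₂ : ℝ) ^ 2 := by positivity
  have hdiv : (σ₂ : ℝ) ^ 2 / g ≤ (σ₂ : ℝ) ^ 2 := div_le_self hs2 hg'
  have hdiv' : (0 : ℝ) ≤ (σ₂ : ℝ) ^ 2 / g := by positivity
  have hτpos : (0 : ℝ) < (σ₁ : ℝ) ^ 2 + (σ₂ : ℝ) ^ 2 / g := by
    have : g * ((σ₁ : ℝ) ^ 2 + (σ₂ : ℝ) ^ 2 / g) = g * (σ₁ : ℝ) ^ 2 + (σ₂ : ℝ) ^ 2 := by field_simp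
    nlinarith
  set τ := √((σ₁ : ℝ) ^ 2 + (σ₂ : ℝ) ^ 2 / g) with hτdef
  have hτ : τ ^ 2 = (σ₁ : ℝ) ^ 2 + (σ₂ : ℝ) ^ 2 / g := Real.sq_sqrt hτpos.le
  have hτ0 : 0 < τ := Real.sqrt_pos.2 hτpos
  have hgτ : g * τ ^ 2 = g * (σ₁ : ℝ) ^ 2 + (σ₂ : ℝ) ^ 2 := by rw [hτ]; field_simp
  set τ' := σₑ / √(g : ℝ) with hτ'def
  have hτ' : τ' ^ 2 = (σₑ : ℝ) ^ 2 / g := by rw [hτ'def, div_pow, Real.sq_sqrt hg0.le]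
  set σₓ := √((σ₁ : ℝ) ^ 2 + (σ₂ : ℝ) ^ 2) with hσₓdef
  have hσₓ : σₓ ^ 2 = (σ₁ : ℝ) ^ 2 + (σ₂ : ℝ) ^ 2 := Real.sq_sqrt hσ'.le
  have hσₓ0 : 0 < σₓ := Real.sqrt_pos.2 hσ'
  obtain ⟨T, η, M, hT, hM, hprob⟩ := exists_good_of_sampleSize (τ := τ) (σ₂ := σ₂) (τ' := τ')
    (σₑ := σₑ) (σₓ := σₓ) hc₁ hl hn hg hd hp hA hB'
    (b := transposeMap B) (by rw [norm_transposeMap, hB]) hτ0 σ₂.2 σₑ.2 hσₓ0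
    (by rw [hτ']; field_simp) (Real.sqrt_le_sqrt (by linarith))
    (Real.le_sqrt_of_sq_le (by linarith))
    (by
      refine Real.sqrt_le_iff.2 ⟨by positivity, ?_⟩
      have : ((g : ℝ) * τ) ^ 2 = g * (g * τ ^ 2) := by ring
      rw [this, hgτ]
      have h1 : (σ₁ : ℝ) ^ 2 ≤ g * (σ₁ : ℝ) ^ 2 := le_mul_of_one_le_left hs1 hg'
      exact (by linarith : _ ≤ (g : ℝ) * (σ₁ : ℝ) ^ 2 + (σ₂ : ℝ) ^ 2).trans
        (le_mul_of_one_le_left (by positivity) hg'))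
    (by
      refine Real.sqrt_le_iff.2 ⟨by positivity, ?_⟩
      have : 0 ≤ τ * σ₂ := by positivity
      nlinarith)
    (by rw [hgτ]; nlinarith)
  have hm : 1 ≤ m := by
    rcases Nat.eq_zero_or_pos m with rfl | h
    · have h1 := half_le_sampleSize (sampleConst_pos l (by linarith : 0 ≤ c₁ + 5)).le hg hd hp hA
      have h2 := sampleConst_pos l (by linarith : 0 ≤ c₁ + 5)
      rw [hn, zero_mul, Nat.cast_zero] at h1
      linarith
    · exact h
  rw [← hlaw.measure_not_le hτ hτ' (P := fun D => RegularData (transposeMap B)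
    (σₑ ^ 2 / (p * (g * τ ^ 2))) M (24 * (m * g) * l * σₓ ^ 2) (σₑ ^ 2 / σₓ ^ 2) D ∧
    FarData (transposeMap B) T (farConst l * σₓ) (3 / 16 * assignProb l * (m * g)) D)
    ((measurableSet_regularData _ _ _ _ _).inter (measurableSet_farData _ _ _ _))] at hprob
  -- The permutation and the assignment are not assumed measurable in the sample point; it is enough
  -- that the exceptional set is contained in the complement of the good data event.
  refine (measure_mono ?_).trans hprob
  intro ω hω hgood
  refine hω ?_
  obtain ⟨h1, h2, h3, h4⟩ := estimators_of_good (B := B) (X := X ω) (Z := Z ω) (N := noise ω)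
    (π := perm ω) (assign := assign ω) hm hg (fun j k => by rw [hX]; rfl) (fun j k => rfl) (hZ ω)
    (hassign ω) hT hσₓ0 hM (by positivity) hgood.1 hgood.2
  rw [hσₓ] at h4
  rw [hgτ] at h3
  refine ⟨h1, h2, ?_, h4.trans ?_⟩
  · have h5 : ‖estNoAS (X ω) (Z ω) - B‖ ≤ √(1 / (p * (g * σ₁ ^ 2 + σ₂ ^ 2))) * σₑ := by
      refine le_of_sq_le_sq (h3.trans (le_of_eq ?_)) (by positivity)
      rw [mul_pow, Real.sq_sqrt (by positivity)]
      ring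
    exact h5.trans (le_mul_of_one_le_left (by positivity) hC)
  -- The second summand alone already bounds the error.
  · exact le_add_of_nonneg_left (by positivity)
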